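/- Let $M$ be an open manifold of $C^\infty$-bounded geometry, i.e. a connected, non-compact, complete smooth Riemannian manifold with positive injectivity radius whose curvature tensor is bounded together with all its covariant derivatives. Let $\delta$ be its distance, $\mathrm{vol}$ its Riemannian measure and, for $K\subset M$ and $r>0$, put $K(r)=\{x:\delta(x,K)\le r\}$ and $K(-r)=\overline{M\setminus (M\setminus K)(r)}$. Let $\mathcal K=(K_n)$ be a regular exhaustion of $M$: an increasing sequence of compact sets with union $M$ such that $\mathrm{vol}(K_n(r))/\mathrm{vol}(K_n(-r))\to1$ for every $r>0$. Let $F$ be a finite-dimensional hermitian vector bundle on $M$, $L^2(F)$ the Hilbert space of its square-integrable sections, and $E_\Omega$ the multiplication by the characteristic function of a Borel set $\Omega$. A bounded operator $A$ on $L^2(F)$ has finite propagation if there is $u>0$ such that, for every compact $K$, $\operatorname{supp} f\subset K$ implies $\operatorname{supp}Af\subset K(u)$; let $\mathcal A=\mathcal A(F)$ be the norm closure of the $*$-algebra of these operators. For a positive operator $T$ put $\mu_T(\Omega)=\mathrm{Tr}(E_\Omega TE_\Omega)$, and let $\mathcal J_{0+}$ be the set of the positive $T$ such that $\mu_T(K)<\infty$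 for every compact $K$, $\mu_T(K_n)\le c\,\mathrm{vol}(K_n)$ for all $n$ and some $c>0$, and $\mu_T(K_n(r_1)\setminus K_n(-r_2))/\mathrm{vol}(K_n)\to0$ for all $r_1,r_2>0$. Fix a state $\omega$ on $\ell^\infty(\mathbb N)$ that vanishes on the sequences tending to $0$. Roe's functional $\varphi$ is defined on positive operators by $\varphi(T)=\omega\big((\mu_T(K_n)/\mathrm{vol}(K_n))_n\big)$ if $T\in\mathcal J_{0+}$, and $\varphi(T)=+\infty$ otherwise. For $T\in\mathcal A_+$ put $$\tau(T)=\sup\{\psi(T):\psi\in\mathcal A^*_+,\ \psi\le\varphi|_{\mathcal A_+}\},\qquad \mathrm{Tr}_{\mathcal K}(T)=\sup\{\tau(B):B\in\mathcal A,\ 0\le B\le T,\ \tau(B)<\infty\}.$$ Then $\mathrm{Tr}_{\mathcal K}$ is a lower semicontinuous semifinite trace on $\mathcal A$. That is: 1. $\mathrm{Tr}_{\mathcal K}:\mathcal A_+\to[0,\infty]$ is additive and positively homogeneous, and $\mathrm{Tr}_{\mathcal K}(A^*A)=\mathrm{Tr}_{\mathcal K}(AA^*)$ for all $A\in\mathcal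 A$; the linear span $\mathcal J$ of $\mathcal J_+=\{A\in\mathcal A_+:\mathrm{Tr}_{\mathcal K}(A)<\infty\}$ is a two-sided ideal of $\mathcal A$, and $\mathrm{Tr}_{\mathcal K}$ extends to a linear functional on $\mathcal J$ with $\mathrm{Tr}_{\mathcal K}(AB)=\mathrm{Tr}_{\mathcal K}(BA)$ for all $A\in\mathcal J$, $B\in\mathcal A$; 2. $\mathrm{Tr}_{\mathcal K}$ is lower semicontinuous on $\mathcal A_+$ for the norm; 3. $\mathrm{Tr}_{\mathcal K}(A)=\sup\{\mathrm{Tr}_{\mathcal K}(B):0\le B\le A,\ B\in\mathcal J_+\}$ for all $A\in\mathcal A_+$. Moreover every compact operator on $L^2(F)$ belongs to $\mathcal J$, and $\mathrm{Tr}_{\mathcal K}$ vanishes on it. -/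

import Mathlib

open Bundle Manifold MeasureTheory Filter Topology Set
open scoped ENNReal NNReal ContDiff InnerProductSpace ComplexOrder

set_option linter.unusedSectionVars false

noncomputable section

namespace OpenManifold

/-! ### Riemannian geometry in charts -/

section Geometry

variable (n : ℕ) {M : Type*} [TopologicalSpace M] [ChartedSpace (EuclideanSpace ℝ (Fin n)) M]
  [RiemannianBundle (fun x : M => TangentSpace (𝓡 n) x)]

/-- The coordinate vector field `∂ᵢ` of the chart at `p`, at the point with coordinates `y`. -/
def coordField (p : M) (i : Fin n) (y : EuclideanSpace ℝ (Fin n)) :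
    TangentSpace (𝓡 n) ((extChartAt (𝓡 n) p).symm y) :=
  mfderiv 𝓘(ℝ, EuclideanSpace ℝ (Fin n)) (𝓡 n) (extChartAt (𝓡 n) p).symm y
    (EuclideanSpace.single i 1)

/-- The matrix `(gᵢⱼ)` of the metric in the chart at `p`. -/
def gram (p : M) (y : EuclideanSpace ℝ (Fin n)) : Matrix (Fin n) (Fin n) ℝ :=
  Matrix.of fun i j => ⟪coordField n p i y, coordField n p j y⟫_ℝ

/-- The partial derivative `∂ᵢ f` on `ℝⁿ`. -/
def pderiv (i : Fin n) (f : EuclideanSpace ℝ (Fin n) → ℝ) (y : EuclideanSpace ℝ (Fin n)) : ℝ :=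
  fderiv ℝ f y (EuclideanSpace.single i 1)

/-- The Christoffel symbol `Γᵏᵢⱼ` of the Levi-Civita connection in the chart at `p`. -/
def christoffel (p : M) (k i j : Fin n) (y : EuclideanSpace ℝ (Fin n)) : ℝ :=
  (1 / 2) * ∑ l, (gram n p y)⁻¹ k l *
    (pderiv n i (fun z => gram n p z j l) y + pderiv n j (fun z => gram n p z i l) y
      - pderiv n l (fun z => gram n p z i j) y)

/-- The coefficient `Rˡᵢⱼₖ` of `R(∂ᵢ, ∂ⱼ)∂ₖ = ∇ᵢ∇ⱼ∂ₖ - ∇ⱼ∇ᵢ∂ₖ` in the chart at `p`. -/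
def riemannUp (p : M) (l i j k : Fin n) (y : EuclideanSpace ℝ (Fin n)) : ℝ :=
  pderiv n i (christoffel n p l j k) y - pderiv n j (christoffel n p l i k) y
    + ∑ m, (christoffel n p m j k y * christoffel n p l i m y
      - christoffel n p m i k y * christoffel n p l j m y)

/-- The components `Rᵢⱼₖₗ` of the (fully covariant) curvature tensor in the chart at `p`. -/
def riemann (p : M) (i j k l : Fin n) (y : EuclideanSpace ℝ (Fin n)) : ℝ :=
  ∑ m, gram n p y l m * riemannUp n p m i j k y

/-- The components in the chart at `p` of the covariant derivative `∇T` of a covariant tensor field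
`T` of rank `r`, given by its components; the new index comes first. -/
def covDeriv (p : M) {r : ℕ} (T : (Fin r → Fin n) → EuclideanSpace ℝ (Fin n) → ℝ)
    (J : Fin (r + 1) → Fin n) (y : EuclideanSpace ℝ (Fin n)) : ℝ :=
  pderiv n (J 0) (T (Fin.tail J)) y
    - ∑ a : Fin r, ∑ m, christoffel n p m (J 0) (Fin.tail J a) y *
        T (Function.update (Fin.tail J) a m) y

/-- The components of the `m`-th covariant derivative `∇ᵐR` of the curvature tensor in the chart
at `p`. -/
def curvDeriv (p : M) : (m : ℕ) → (Fin (4 + m) → Fin n) → EuclideanSpace ℝ (Fin n) → ℝ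
  | 0 => fun J => riemann n p (J 0) (J 1) (J 2) (J 3)
  | m + 1 => covDeriv n p (curvDeriv p m)

/-- The squared pointwise norm (for the metric) of a covariant tensor of rank `r` with the given
components in the chart at `p`. -/
def tensorNormSq (p : M) {r : ℕ} (T : (Fin r → Fin n) → EuclideanSpace ℝ (Fin n) → ℝ)
    (y : EuclideanSpace ℝ (Fin n)) : ℝ :=
  ∑ I : Fin r → Fin n, ∑ J : Fin r → Fin n,
    (∏ a, (gram n p y)⁻¹ (I a) (J a)) * T I y * T J y

/-- The curve `γ` is, near `t`, smooth, and satisfies at `t` the geodesic equation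
`γ̈ᵏ + ∑ Γᵏᵢⱼ γ̇ⁱ γ̇ʲ = 0`, written in the chart at the point `γ t`. -/
def IsGeodesicAt (γ : ℝ → M) (t : ℝ) : Prop :=
  ContMDiffAt 𝓘(ℝ, ℝ) (𝓡 n) ∞ γ t ∧
    let c : ℝ → EuclideanSpace ℝ (Fin n) := fun τ => extChartAt (𝓡 n) (γ t) (γ τ)
    ∀ k, deriv (deriv c) t k
      + ∑ i, ∑ j, christoffel n (γ t) k i j (c t) * deriv c t i * deriv c t j = 0

/-- `exp_x v` is defined and equal to `y`: there is a geodesic `γ` on `[0, 1]` which starts at `x`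
with velocity `v` and ends at `y`. -/
def IsExp (x : M) (v : TangentSpace (𝓡 n) x) (y : M) : Prop :=
  ∃ γ : ℝ → M, (∀ t ∈ Icc (0 : ℝ) 1, IsGeodesicAt n γ t) ∧
    (⟨γ 0, mfderiv 𝓘(ℝ, ℝ) (𝓡 n) γ 0 (1 : ℝ)⟩ : TangentBundle (𝓡 n) M) = ⟨x, v⟩ ∧ γ 1 = y

/-- The injectivity radius at `x`: the supremum of all `r` such that `exp_x` is defined on the open
ball of radius `r` in `T_x M` and is a diffeomorphism of it onto an open subset of `M`. -/
def injRadius (x : M) : ℝ≥0∞ :=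
  sSup {r | ∃ Φ : OpenPartialHomeomorph (TangentSpace (𝓡 n) x) M,
    Φ.source = {v | ‖v‖ₑ < r} ∧
    ContMDiffOn 𝓘(ℝ, TangentSpace (𝓡 n) x) (𝓡 n) ∞ Φ Φ.source ∧
    ContMDiffOn (𝓡 n) 𝓘(ℝ, TangentSpace (𝓡 n) x) ∞ Φ.symm Φ.target ∧
    ∀ v ∈ Φ.source, IsExp n x v (Φ v)}

variable (M) in
/-- `C^∞`-bounded geometry (of a complete Riemannian manifold): the injectivity radius is positive,
and the curvature tensor is bounded, together with all its covariant derivatives. -/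
structure BoundedGeometry : Prop where
  injRadius_pos : 0 < ⨅ x : M, injRadius n x
  curvature_bounded : ∀ m : ℕ, ∃ C : ℝ, ∀ x : M,
    tensorNormSq n x (curvDeriv n x m) (extChartAt (𝓡 n) x x) ≤ C

/-- The Riemannian measure `√(det g) dy` of the chart at `p`, as a measure on `M` (concentrated on
the domain of the chart). -/
def chartVolume [MeasurableSpace M] (p : M) : Measure M :=
  ((volume.restrict (extChartAt (𝓡 n) p).target).withDensity
    fun y => ENNReal.ofReal √(gram n p y).det).map (extChartAt (𝓡 n) p).symm

variable (M) in
/-- The Riemannian volume measure: the measure whose restriction to the domain of each chart is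
`√(det g) dy`, that is, the least measure on `M` that dominates the Riemannian measures of all the
charts. -/
def riemannianVolume [MeasurableSpace M] : Measure M :=
  ⨆ p : M, chartVolume n p

end Geometry
/-! ### Square-integrable sections and operators of finite propagation -/

section L2

variable {M : Type*} (Fm : Type*) [NormedAddCommGroup Fm] [NormedSpace ℂ Fm]
  (E : M → Type*) [∀ x, NormedAddCommGroup (E x)] [∀ x, InnerProductSpace ℂ (E x)]
  [TopologicalSpace M] [TopologicalSpace (TotalSpace Fm E)] [FiberBundle Fm E]
  [VectorBundle ℂ Fm E]

/-- The inner products on the fibres of the complex vector bundle `E` form a (continuous)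
hermitian metric. -/
class IsHermitianBundle : Prop where
  continuousOn_inner : ∀ (x₀ : M) (v w : Fm), ContinuousOn
    (fun x => ⟪(trivializationAt Fm E x₀).symm x v, (trivializationAt Fm E x₀).symm x w⟫_ℂ)
    (trivializationAt Fm E x₀).baseSet

variable {E} in
/-- Borel sections of the bundle: they are Borel functions in each local trivialization (here
extended by zero outside of the domain of the trivialization). -/
def IsBorelSection [MeasurableSpace M] (s : ∀ x, E x) : Prop :=
  ∀ x₀ : M, StronglyMeasurable
    fun x => (trivializationAt Fm E x₀).linearMapAt ℂ x (s x)

variable [MeasurableSpace M] [BorelSpace M] [SecondCountableTopology M]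
  [FiniteDimensional ℂ Fm] [IsHermitianBundle Fm E]

variable {E} in
theorem stronglyMeasurable_of_local (f : M → ℂ)
    (h : ∀ x₀ : M, StronglyMeasurable
      ((trivializationAt Fm E x₀).baseSet.indicator f)) : StronglyMeasurable f := by
  obtain ⟨S, hS, hU⟩ := TopologicalSpace.countable_cover_nhds
    (f := fun x₀ : M => (trivializationAt Fm E x₀).baseSet)
    (fun x => (trivializationAt Fm E x).open_baseSet.mem_nhds
      (FiberBundle.mem_baseSet_trivializationAt Fm E x))
  refine Measurable.stronglyMeasurable fun U hUm => ?_
  have : f ⁻¹' U = ⋃ x₀ ∈ S, ((trivializationAt Fm E x₀).baseSet ∩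
      ((trivializationAt Fm E x₀).baseSet.indicator f) ⁻¹' U) := by
    ext x
    simp only [mem_preimage, mem_iUnion, mem_inter_iff, exists_prop]
    constructor
    · intro hx
      have : x ∈ ⋃ x₀ ∈ S, (trivializationAt Fm E x₀).baseSet := by rw [hU]; trivial
      simp only [mem_iUnion, exists_prop] at this
      obtain ⟨x₀, h1, h2⟩ := this
      exact ⟨x₀, h1, h2, by rwa [indicator_of_mem h2]⟩
    · rintro ⟨x₀, -, h2, h3⟩
      rwa [indicator_of_mem h2] at h3
  rw [this]
  exact MeasurableSet.biUnion hS fun x₀ _ =>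
    (trivializationAt Fm E x₀).open_baseSet.measurableSet.inter ((h x₀).measurable hUm)

variable {Fm E}

theorem IsBorelSection.inner {s t : ∀ x, E x} (hs : IsBorelSection Fm s)
    (ht : IsBorelSection Fm t) : StronglyMeasurable fun x => ⟪s x, t x⟫_ℂ := by
  refine stronglyMeasurable_of_local (E := E) Fm _ fun x₀ => ?_
  set e := trivializationAt Fm E x₀ with he
  let b := Module.finBasis ℂ Fm
  have key : e.baseSet.indicator (fun x => ⟪s x, t x⟫_ℂ) = fun x =>
      ∑ i, ∑ j, (starRingEnd ℂ (b.coord i (e.linearMapAt ℂ x (s x)))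
        * b.coord j (e.linearMapAt ℂ x (t x)))
        * e.baseSet.indicator (fun x => ⟪e.symm x (b i), e.symm x (b j)⟫_ℂ) x := by
    funext x
    by_cases hx : x ∈ e.baseSet
    · have h1 : ∀ v : E x, v = ∑ i, b.coord i (e.linearMapAt ℂ x v) • e.symm x (b i) := by
        intro v
        have : ∀ w : Fm, e.symm x w = e.symmₗ ℂ x w := fun w => by simp [e.symmₗ_apply, hx]
        simp only [this, ← map_smul, ← map_sum]
        rw [show (∑ i, b.coord i (e.linearMapAt ℂ x v) • b i) = e.linearMapAt ℂ x v from
          b.sum_repr _]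
        exact (e.symmₗ_linearMapAt hx v).symm
      simp only [indicator_of_mem hx]
      conv_lhs => rw [h1 (s x), h1 (t x)]
      simp only [sum_inner, inner_sum, inner_smul_left, inner_smul_right]
      simp only [Finset.mul_sum]
      rw [Finset.sum_comm]
      refine Finset.sum_congr rfl fun i _ => Finset.sum_congr rfl fun j _ => ?_
      ring
    · simp [indicator_of_notMem hx]
  classical
  rw [key]
  have hc : ∀ i, Continuous (b.coord i) := fun i => LinearMap.continuous_of_finiteDimensional _
  have hm : ∀ (i j) , StronglyMeasurable (e.baseSet.indicator
      (fun x => ⟪e.symm x (b i), e.symm x (b j)⟫_ℂ)) := by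
    intro i j
    have := IsHermitianBundle.continuousOn_inner (Fm := Fm) (E := E) x₀ (b i) (b j)
    rw [← piecewise_eq_indicator]
    exact (ContinuousOn.measurable_piecewise this continuousOn_const
      e.open_baseSet.measurableSet).stronglyMeasurable
  refine Finset.stronglyMeasurable_fun_sum _ fun i _ => Finset.stronglyMeasurable_fun_sum _ fun j _ => ?_
  refine StronglyMeasurable.mul (StronglyMeasurable.mul ?_ ?_) (hm i j)
  · exact RCLike.continuous_conj.comp_stronglyMeasurable ((hc i).comp_stronglyMeasurable (hs x₀))
  · exact (hc j).comp_stronglyMeasurable (ht x₀)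


theorem IsBorelSection.measurable_enorm_sq {s : ∀ x, E x} (hs : IsBorelSection Fm s) :
    Measurable fun x => ‖s x‖ₑ ^ 2 := by
  have h := (hs.inner hs).measurable.enorm
  have h2 : (fun x => ‖s x‖ₑ ^ 2) = fun x => ‖⟪s x, s x⟫_ℂ‖ₑ := by
    funext x
    rw [← ofReal_norm, ← ofReal_norm, inner_self_eq_norm_sq_to_K, norm_pow,
      ENNReal.ofReal_pow (norm_nonneg _)]
    simp
  rw [h2]
  exact h

theorem enorm_add_sq_le {V : Type*} [NormedAddCommGroup V] (a b : V) :
    ‖a + b‖ₑ ^ 2 ≤ 2 * ‖a‖ₑ ^ 2 + 2 * ‖b‖ₑ ^ 2 := by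
  have h : ‖a + b‖ ^ 2 ≤ 2 * ‖a‖ ^ 2 + 2 * ‖b‖ ^ 2 := by
    have := norm_add_le a b
    nlinarith [sq_nonneg (‖a‖ - ‖b‖), norm_nonneg a, norm_nonneg b, norm_nonneg (a + b)]
  have h2 := ENNReal.ofReal_le_ofReal h
  rw [ENNReal.ofReal_add (by positivity) (by positivity), ENNReal.ofReal_mul (by norm_num),
    ENNReal.ofReal_mul (by norm_num), ENNReal.ofReal_pow (norm_nonneg _),
    ENNReal.ofReal_pow (norm_nonneg _), ENNReal.ofReal_pow (norm_nonneg _)] at h2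
  simpa using h2

variable (μ : Measure M) (Fm E)

/-- The space of square-integrable Borel sections. -/
def sqIntSubmodule : Submodule ℂ (∀ x, E x) where
  carrier := {s | IsBorelSection Fm s ∧ ∫⁻ x, ‖s x‖ₑ ^ 2 ∂μ < ⊤}
  zero_mem' := by
    refine ⟨fun x₀ => ?_, by simp⟩
    simpa using stronglyMeasurable_const
  add_mem' := by
    rintro s t ⟨hs, hs2⟩ ⟨ht, ht2⟩
    refine ⟨fun x₀ => by simpa using! (hs x₀).add (ht x₀), ?_⟩
    have hm : Measurable fun x => 2 * ‖s x‖ₑ ^ 2 := hs.measurable_enorm_sq.const_mul 2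
    calc ∫⁻ x, ‖(s + t) x‖ₑ ^ 2 ∂μ ≤ ∫⁻ x, (2 * ‖s x‖ₑ ^ 2 + 2 * ‖t x‖ₑ ^ 2) ∂μ := by
          exact lintegral_mono fun x => enorm_add_sq_le _ _
      _ < ⊤ := by
          rw [lintegral_add_left hm, lintegral_const_mul' _ _ (by simp),
            lintegral_const_mul' _ _ (by simp)]
          exact ENNReal.add_lt_top.2 ⟨ENNReal.mul_lt_top (by simp) hs2,
            ENNReal.mul_lt_top (by simp) ht2⟩
  smul_mem' := by
    rintro c s ⟨hs, hs2⟩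
    refine ⟨fun x₀ => by simpa using! (hs x₀).const_smul c, ?_⟩
    simp only [Pi.smul_apply, enorm_smul, mul_pow]
    rw [lintegral_const_mul' _ _ (by simp)]
    exact ENNReal.mul_lt_top (by simp) hs2

/-- The square-integrable Borel sections, as a type of its own (it carries the seminorm of `L²`,
not the topology of pointwise convergence). -/
def SqInt : Type _ := sqIntSubmodule Fm E μ

instance : AddCommGroup (SqInt Fm E μ) := inferInstanceAs (AddCommGroup (sqIntSubmodule Fm E μ))
instance : Module ℂ (SqInt Fm E μ) := inferInstanceAs (Module ℂ (sqIntSubmodule Fm E μ))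

variable {μ Fm E}

theorem SqInt.integrable_inner (s t : SqInt Fm E μ) :
    Integrable (fun x => ⟪s.1 x, t.1 x⟫_ℂ) μ := by
  refine ⟨(s.2.1.inner t.2.1).aestronglyMeasurable, ?_⟩
  calc ∫⁻ x, ‖⟪s.1 x, t.1 x⟫_ℂ‖ₑ ∂μ ≤ ∫⁻ x, (‖s.1 x‖ₑ ^ 2 + ‖t.1 x‖ₑ ^ 2) ∂μ := by
        refine lintegral_mono fun x => ?_
        have h : ‖⟪s.1 x, t.1 x⟫_ℂ‖ ≤ ‖s.1 x‖ ^ 2 + ‖t.1 x‖ ^ 2 := by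
          have := norm_inner_le_norm (𝕜 := ℂ) (s.1 x) (t.1 x)
          nlinarith [sq_nonneg (‖s.1 x‖ - ‖t.1 x‖), sq_nonneg ‖s.1 x‖, sq_nonneg ‖t.1 x‖]
        have h2 := ENNReal.ofReal_le_ofReal h
        rw [ENNReal.ofReal_add (by positivity) (by positivity),
          ENNReal.ofReal_pow (norm_nonneg _), ENNReal.ofReal_pow (norm_nonneg _)] at h2
        simpa using h2
    _ < ⊤ := by
        rw [lintegral_add_left s.2.1.measurable_enorm_sq]
        exact ENNReal.add_lt_top.2 ⟨s.2.2, t.2.2⟩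

variable (μ Fm E)

/-- The (semi-definite) scalar product `∫ ⟨s x, t x⟩ dμ`. -/
instance SqInt.core : PreInnerProductSpace.Core ℂ (SqInt Fm E μ) where
  inner s t := ∫ x, ⟪s.1 x, t.1 x⟫_ℂ ∂μ
  conj_inner_symm s t := by
    rw [← integral_conj]
    simp
  re_inner_nonneg s := by
    rw [← integral_re (SqInt.integrable_inner s s)]
    exact integral_nonneg fun x => inner_self_nonneg
  add_left s t u := by
    rw [← integral_add (SqInt.integrable_inner s u) (SqInt.integrable_inner t u)]
    refine integral_congr_ae (ae_of_all _ fun x => ?_)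
    exact inner_add_left _ _ _
  smul_left s t c := by
    rw [← integral_const_mul]
    refine integral_congr_ae (ae_of_all _ fun x => ?_)
    exact inner_smul_left _ _ _

instance : SeminormedAddCommGroup (SqInt Fm E μ) :=
  InnerProductSpace.Core.toSeminormedAddCommGroup (𝕜 := ℂ)

instance : InnerProductSpace ℂ (SqInt Fm E μ) := InnerProductSpace.ofCore _

/-- The Hilbert space `L²(E)`: the Hilbert space completion of the space of square-integrable
sections (the elements of norm zero being identified with `0`). -/
abbrev L2 : Type _ := UniformSpace.Completion (SqInt Fm E μ)


variable {μ Fm E}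

section Cutoff

open scoped Classical

theorem SqInt.norm_sq (s : SqInt Fm E μ) : ‖s‖ ^ 2 = ∫ x, ‖s.1 x‖ ^ 2 ∂μ := by
  rw [← inner_self_eq_norm_sq (𝕜 := ℂ) s]
  change RCLike.re (∫ x, ⟪s.1 x, s.1 x⟫_ℂ ∂μ) = _
  rw [← integral_re (SqInt.integrable_inner s s)]
  refine integral_congr_ae (ae_of_all _ fun x => ?_)
  exact inner_self_eq_norm_sq _

theorem SqInt.integrable_norm_sq (s : SqInt Fm E μ) : Integrable (fun x => ‖s.1 x‖ ^ 2) μ := by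
  refine (SqInt.integrable_inner s s).norm.congr (ae_of_all _ fun x => ?_)
  simp [inner_self_eq_norm_sq_to_K]

/-- The section `1_S s`. -/
def SqInt.indicator {S : Set M} (hS : MeasurableSet S) (s : SqInt Fm E μ) : SqInt Fm E μ :=
  ⟨fun x => if x ∈ S then s.1 x else 0, by
    refine ⟨fun x₀ => ?_, ?_⟩
    · have h : (fun x => (trivializationAt Fm E x₀).linearMapAt ℂ x (if x ∈ S then s.1 x else 0))
          = S.indicator fun x => (trivializationAt Fm E x₀).linearMapAt ℂ x (s.1 x) := by
        funext x
        by_cases hx : x ∈ S <;> simp [hx]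
      rw [h]
      exact (s.2.1 x₀).indicator hS
    · refine lt_of_le_of_lt (lintegral_mono fun x => ?_) s.2.2
      by_cases hx : x ∈ S <;> simp [hx]⟩

theorem SqInt.indicator_of_mem {S : Set M} (hS : MeasurableSet S) (s : SqInt Fm E μ) {x : M}
    (hx : x ∈ S) : (SqInt.indicator hS s).1 x = s.1 x := if_pos hx

theorem SqInt.indicator_of_notMem {S : Set M} (hS : MeasurableSet S) (s : SqInt Fm E μ) {x : M}
    (hx : x ∉ S) : (SqInt.indicator hS s).1 x = 0 := if_neg hx

/-- Multiplication by the characteristic function of `S`, on square-integrable sections. -/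
def cutoff {S : Set M} (hS : MeasurableSet S) : SqInt Fm E μ →L[ℂ] SqInt Fm E μ :=
  LinearMap.mkContinuous
    { toFun := SqInt.indicator hS
      map_add' := fun s t => Subtype.ext <| funext fun x => by
        change (if x ∈ S then s.1 x + t.1 x else 0)
          = (if x ∈ S then s.1 x else 0) + (if x ∈ S then t.1 x else 0)
        split_ifs <;> simp
      map_smul' := fun c s => Subtype.ext <| funext fun x => by
        change (if x ∈ S then c • s.1 x else 0) = c • (if x ∈ S then s.1 x else 0)
        split_ifs <;> simp } 1 fun s => by
    rw [one_mul]
    refine abs_le_of_sq_le_sq' ?_ (norm_nonneg _) |>.2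
    rw [SqInt.norm_sq, SqInt.norm_sq]
    refine integral_mono (SqInt.integrable_norm_sq _) (SqInt.integrable_norm_sq _) fun x => ?_
    change ‖(if x ∈ S then s.1 x else 0)‖ ^ 2 ≤ ‖s.1 x‖ ^ 2
    split_ifs <;> simp

variable (Fm E μ)

/-- The projection `E_S` of `L²(E)` given by the characteristic function of the Borel set `S`. -/
def proj (S : Set M) : L2 Fm E μ →L[ℂ] L2 Fm E μ :=
  if hS : MeasurableSet S then (cutoff hS).completion else 0

variable {Fm E μ}

theorem proj_coe {S : Set M} (hS : MeasurableSet S) (s : SqInt Fm E μ) :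
    proj Fm E μ S (s : L2 Fm E μ) = (SqInt.indicator hS s : SqInt Fm E μ) := by
  rw [proj, dif_pos hS]
  exact ContinuousLinearMap.completion_apply_coe _ _

theorem proj_proj {S T : Set M} (hS : MeasurableSet S) (hT : MeasurableSet T) (f : L2 Fm E μ) :
    proj Fm E μ S (proj Fm E μ T f) = proj Fm E μ (S ∩ T) f := by
  induction f using UniformSpace.Completion.induction_on with
  | hp => exact isClosed_eq (by fun_prop) (by fun_prop)
  | ih s =>
    rw [proj_coe hT, proj_coe hS, proj_coe (hS.inter hT)]
    congr 1
    refine Subtype.ext <| funext fun x => ?_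
    by_cases h1 : x ∈ S
    · rw [SqInt.indicator_of_mem hS _ h1]
      by_cases h2 : x ∈ T
      · rw [SqInt.indicator_of_mem hT _ h2, SqInt.indicator_of_mem (hS.inter hT) _ ⟨h1, h2⟩]
      · rw [SqInt.indicator_of_notMem hT _ h2,
          SqInt.indicator_of_notMem (hS.inter hT) _ fun h => h2 h.2]
    · rw [SqInt.indicator_of_notMem hS _ h1,
        SqInt.indicator_of_notMem (hS.inter hT) _ fun h => h1 h.1]

theorem proj_univ (f : L2 Fm E μ) : proj Fm E μ univ f = f := by
  induction f using UniformSpace.Completion.induction_on with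
  | hp => exact isClosed_eq (by fun_prop) (by fun_prop)
  | ih s =>
    rw [proj_coe MeasurableSet.univ]
    congr 1
    refine Subtype.ext <| funext fun x => ?_
    exact if_pos (mem_univ x)

theorem proj_empty (f : L2 Fm E μ) : proj Fm E μ ∅ f = 0 := by
  induction f using UniformSpace.Completion.induction_on with
  | hp => exact isClosed_eq (by fun_prop) (by fun_prop)
  | ih s =>
    rw [proj_coe MeasurableSet.empty, ← UniformSpace.Completion.coe_zero]
    congr 1
    refine Subtype.ext <| funext fun x => ?_
    exact if_neg (notMem_empty x)

theorem proj_add_compl {S : Set M} (hS : MeasurableSet S) (f : L2 Fm E μ) :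
    proj Fm E μ S f + proj Fm E μ Sᶜ f = f := by
  induction f using UniformSpace.Completion.induction_on with
  | hp => exact isClosed_eq (by fun_prop) (by fun_prop)
  | ih s =>
    rw [proj_coe hS, proj_coe hS.compl, ← UniformSpace.Completion.coe_add]
    congr 1
    refine Subtype.ext <| funext fun x => ?_
    change (SqInt.indicator hS s).1 x + (SqInt.indicator hS.compl s).1 x = s.1 x
    by_cases h1 : x ∈ S
    · rw [SqInt.indicator_of_mem hS _ h1, SqInt.indicator_of_notMem hS.compl _ (fun h => h h1),
        add_zero]
    · rw [SqInt.indicator_of_notMem hS _ h1, SqInt.indicator_of_mem hS.compl _ h1, zero_add]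

theorem inner_proj {S : Set M} (hS : MeasurableSet S) (f g : L2 Fm E μ) :
    ⟪proj Fm E μ S f, g⟫_ℂ = ⟪f, proj Fm E μ S g⟫_ℂ := by
  induction f, g using UniformSpace.Completion.induction_on₂ with
  | hp => exact isClosed_eq (by fun_prop) (by fun_prop)
  | ih s t =>
    rw [proj_coe hS, proj_coe hS, UniformSpace.Completion.inner_coe,
      UniformSpace.Completion.inner_coe]
    refine integral_congr_ae (ae_of_all _ fun x => ?_)
    change ⟪(if x ∈ S then s.1 x else 0), t.1 x⟫_ℂ = ⟪s.1 x, (if x ∈ S then t.1 x else 0)⟫_ℂ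
    by_cases h1 : x ∈ S <;> simp [h1]

theorem norm_proj_le (S : Set M) (f : L2 Fm E μ) : ‖proj Fm E μ S f‖ ≤ ‖f‖ := by
  by_cases hS : MeasurableSet S
  · induction f using UniformSpace.Completion.induction_on with
    | hp => exact isClosed_le (by fun_prop) (by fun_prop)
    | ih s =>
      rw [proj_coe hS, UniformSpace.Completion.norm_coe, UniformSpace.Completion.norm_coe]
      exact (LinearMap.mkContinuous_norm_le _ zero_le_one _ |> fun h =>
        ((cutoff hS).le_of_opNorm_le h s).trans (one_mul _).le)
  · simp [proj, hS]

theorem tendsto_proj {C : ℕ → Set M} (hC : ∀ k, MeasurableSet (C k)) (hmono : Monotone C)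
    (hU : ⋃ k, C k = univ) (f : L2 Fm E μ) :
    Tendsto (fun k => proj Fm E μ (C k) f) atTop (𝓝 f) := by
  rw [Metric.tendsto_atTop]
  intro ε hε
  obtain ⟨s, hs⟩ := UniformSpace.Completion.denseRange_coe.exists_dist_lt f
    (show (0 : ℝ) < ε / 3 by positivity)
  have key : Tendsto (fun k => ‖SqInt.indicator (hC k) s - s‖ ^ 2) atTop (𝓝 0) := by
    have h0 : (0 : ℝ) = ∫ x, (0 : ℝ) ∂μ := by simp
    simp only [SqInt.norm_sq]
    rw [h0]
    refine tendsto_integral_of_dominated_convergence (fun x => ‖s.1 x‖ ^ 2)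
      (fun k => (SqInt.integrable_norm_sq _).aestronglyMeasurable) (SqInt.integrable_norm_sq s)
      (fun k => ae_of_all _ fun x => ?_) (ae_of_all _ fun x => ?_)
    · change ‖‖(if x ∈ C k then s.1 x else 0) - s.1 x‖ ^ 2‖ ≤ _
      split_ifs <;> simp
    · have hx : x ∈ ⋃ k, C k := by rw [hU]; trivial
      obtain ⟨k₀, hk₀⟩ := mem_iUnion.1 hx
      refine tendsto_const_nhds.congr' ?_
      filter_upwards [eventually_ge_atTop k₀] with k hk
      change 0 = ‖(if x ∈ C k then s.1 x else 0) - s.1 x‖ ^ 2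
      rw [if_pos (hmono hk hk₀)]
      simp
  have key2 : Tendsto (fun k => ‖SqInt.indicator (hC k) s - s‖) atTop (𝓝 0) := by
    have := (Real.continuous_sqrt.tendsto 0).comp key
    simpa [Function.comp_def, Real.sqrt_sq (norm_nonneg _)] using this
  obtain ⟨N, hN⟩ := Metric.tendsto_atTop.1 key2 (ε / 3) (by positivity)
  refine ⟨N, fun k hk => ?_⟩
  have h1 := hN k hk
  rw [dist_zero_right, norm_norm] at h1
  have h2 : dist (proj Fm E μ (C k) f) (proj Fm E μ (C k) (s : L2 Fm E μ)) ≤ dist f s := by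
    rw [dist_eq_norm, ← map_sub, dist_eq_norm]
    exact norm_proj_le _ _
  have h3 : dist (proj Fm E μ (C k) (s : L2 Fm E μ)) (s : L2 Fm E μ) < ε / 3 := by
    rw [proj_coe (hC k), dist_eq_norm, ← UniformSpace.Completion.coe_sub,
      UniformSpace.Completion.norm_coe]
    exact h1
  have h4 := dist_triangle4 (proj Fm E μ (C k) f) (proj Fm E μ (C k) (s : L2 Fm E μ))
    (s : L2 Fm E μ) f
  rw [dist_comm (s : L2 Fm E μ) f] at h4
  linarith

end Cutoff

end L2

section Propagation

variable {M : Type*} [MetricSpace M] [SecondCountableTopology M] [MeasurableSpace M] [BorelSpace M]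
  {Fm : Type*} [NormedAddCommGroup Fm] [NormedSpace ℂ Fm] [FiniteDimensional ℂ Fm]
  {E : M → Type*} [∀ x, NormedAddCommGroup (E x)] [∀ x, InnerProductSpace ℂ (E x)]
  [TopologicalSpace (TotalSpace Fm E)] [FiberBundle Fm E] [VectorBundle ℂ Fm E]
  [IsHermitianBundle Fm E] {μ : Measure M}

/-- The support of `f ∈ L²(E)` is contained in the closed set `C`, i.e. `f` vanishes almost
everywhere outside of `C`. -/
def SuppIn (f : L2 Fm E μ) (C : Set M) : Prop := proj Fm E μ C f = f

/-- The bounded operator `A` has finite propagation: there is `u > 0` such that, for every compact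
set `K`, if the support of `f` is contained in `K`, then that of `A f` is contained in the set of
points at distance at most `u` from `K`. -/
def HasFinitePropagation (A : L2 Fm E μ →L[ℂ] L2 Fm E μ) : Prop :=
  ∃ u : ℝ, 0 < u ∧ ∀ K : Set M, IsCompact K → ∀ f : L2 Fm E μ,
    SuppIn f K → SuppIn (A f) (Metric.cthickening u K)

theorem SuppIn.mono {f : L2 Fm E μ} {C D : Set M} (hC : MeasurableSet C) (hD : MeasurableSet D)
    (h : C ⊆ D) (hf : SuppIn f C) : SuppIn f D := by
  unfold SuppIn at hf ⊢
  conv_lhs => rw [← hf]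
  rw [proj_proj hD hC, inter_eq_self_of_subset_right h, hf]

theorem isClosed_suppIn (C : Set M) : IsClosed {f : L2 Fm E μ | SuppIn f C} :=
  isClosed_eq (by fun_prop) continuous_id

theorem suppIn_proj {C : Set M} (hC : MeasurableSet C) (f : L2 Fm E μ) :
    SuppIn (proj Fm E μ C f) C := by
  rw [SuppIn, proj_proj hC hC, inter_self]

theorem suppIn_of_proj_compl {C : Set M} (hC : MeasurableSet C) {f : L2 Fm E μ}
    (h : proj Fm E μ Cᶜ f = 0) : SuppIn f C := by
  have := proj_add_compl hC f
  rwa [h, add_zero] at this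

theorem SuppIn.of_closed [SigmaCompactSpace M] {A : L2 Fm E μ →L[ℂ] L2 Fm E μ} {u : ℝ}
    (hA : ∀ K : Set M, IsCompact K → ∀ f : L2 Fm E μ,
      SuppIn f K → SuppIn (A f) (Metric.cthickening u K))
    {C : Set M} (hC : IsClosed C) {f : L2 Fm E μ} (hf : SuppIn f C) :
    SuppIn (A f) (Metric.cthickening u C) := by
  have hcc : ∀ k, IsCompact (compactCovering M k) := isCompact_compactCovering M
  have hm : ∀ k, MeasurableSet (compactCovering M k) := fun k => (hcc k).isClosed.measurableSet
  have ht := tendsto_proj (μ := μ) (Fm := Fm) (E := E) hm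
    (fun _ _ h => compactCovering_subset M h) (iUnion_compactCovering M) f
  refine (isClosed_suppIn _).mem_of_tendsto ((A.continuous.tendsto f).comp ht)
    (Eventually.of_forall fun k => ?_)
  have h1 : SuppIn (proj Fm E μ (compactCovering M k) f) (compactCovering M k ∩ C) := by
    unfold SuppIn at hf ⊢
    conv_rhs => rw [← hf, proj_proj (hm k) hC.measurableSet]
    rw [proj_proj ((hm k).inter hC.measurableSet) (hm k)]
    conv_lhs => rw [← hf, proj_proj (((hm k).inter hC.measurableSet).inter (hm k)) hC.measurableSet]
    congr 2
    ext x; simp; tauto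
  exact SuppIn.mono Metric.isClosed_cthickening.measurableSet
    Metric.isClosed_cthickening.measurableSet
    (Metric.cthickening_subset_of_subset _ inter_subset_right)
    (hA _ ((hcc k).inter_right hC) _ h1)

theorem HasFinitePropagation.add {A B : L2 Fm E μ →L[ℂ] L2 Fm E μ}
    (hA : HasFinitePropagation A) (hB : HasFinitePropagation B) :
    HasFinitePropagation (A + B) := by
  obtain ⟨u, hu, hA⟩ := hA
  obtain ⟨v, hv, hB⟩ := hB
  refine ⟨max u v, lt_max_of_lt_left hu, fun K hK f hf => ?_⟩
  have h1 : SuppIn (A f) (Metric.cthickening (max u v) K) :=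
    (hA K hK f hf).mono Metric.isClosed_cthickening.measurableSet
      Metric.isClosed_cthickening.measurableSet (Metric.cthickening_mono (le_max_left _ _) _)
  have h2 : SuppIn (B f) (Metric.cthickening (max u v) K) :=
    (hB K hK f hf).mono Metric.isClosed_cthickening.measurableSet
      Metric.isClosed_cthickening.measurableSet (Metric.cthickening_mono (le_max_right _ _) _)
  unfold SuppIn at h1 h2 ⊢
  rw [add_apply, map_add, h1, h2]

theorem hasFinitePropagation_algebraMap (c : ℂ) :
    HasFinitePropagation (algebraMap ℂ (L2 Fm E μ →L[ℂ] L2 Fm E μ) c) := by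
  refine ⟨1, one_pos, fun K hK f hf => ?_⟩
  have h1 : SuppIn f (Metric.cthickening 1 K) := hf.mono hK.isClosed.measurableSet
      Metric.isClosed_cthickening.measurableSet (Metric.self_subset_cthickening _)
  unfold SuppIn at h1 ⊢
  rw [ContinuousLinearMap.algebraMap_apply, map_smul, h1]

theorem HasFinitePropagation.mul [SigmaCompactSpace M] {A B : L2 Fm E μ →L[ℂ] L2 Fm E μ}
    (hA : HasFinitePropagation A) (hB : HasFinitePropagation B) :
    HasFinitePropagation (A * B) := by
  obtain ⟨u, hu, hA⟩ := hA
  obtain ⟨v, hv, hB⟩ := hB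
  refine ⟨u + v, add_pos hu hv, fun K hK f hf => ?_⟩
  exact (SuppIn.of_closed hA Metric.isClosed_cthickening (hB K hK f hf)).mono
    Metric.isClosed_cthickening.measurableSet Metric.isClosed_cthickening.measurableSet
    (Metric.cthickening_cthickening_subset hu.le hv.le K)

theorem HasFinitePropagation.star [SigmaCompactSpace M] {A : L2 Fm E μ →L[ℂ] L2 Fm E μ}
    (hA : HasFinitePropagation A) : HasFinitePropagation (star A) := by
  obtain ⟨u, hu, hA⟩ := hA
  refine ⟨u + 1, by positivity, fun K hK g hg => ?_⟩
  have hC : IsClosed (Metric.thickening (u + 1) K)ᶜ := Metric.isOpen_thickening.isClosed_compl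
  have hT : MeasurableSet (Metric.thickening (u + 1) K) := Metric.isOpen_thickening.measurableSet
  refine SuppIn.mono hT Metric.isClosed_cthickening.measurableSet
    (Metric.thickening_subset_cthickening _ _) (suppIn_of_proj_compl hT ?_)
  refine ext_inner_right ℂ fun f => ?_
  rw [inner_proj hT.compl, ContinuousLinearMap.star_eq_adjoint,
    ContinuousLinearMap.adjoint_inner_left, inner_zero_left]
  have h1 := SuppIn.of_closed hA hC (suppIn_proj hT.compl f)
  have hg' : proj Fm E μ K g = g := hg
  have hm := (Metric.isClosed_cthickening (δ := u) (E := (Metric.thickening (u + 1) K)ᶜ)).measurableSet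
  have hd : K ∩ Metric.cthickening u (Metric.thickening (u + 1) K)ᶜ = ∅ := by
    rw [eq_empty_iff_forall_notMem]
    rintro x ⟨hx, hx2⟩
    rw [Metric.mem_cthickening_iff] at hx2
    have h3 : ENNReal.ofReal (u + 1) ≤ Metric.infEDist x (Metric.thickening (u + 1) K)ᶜ := by
      rw [Metric.le_infEDist]
      intro y hy
      rw [mem_compl_iff, Metric.mem_thickening_iff_infEDist_lt, not_lt] at hy
      rw [edist_comm]
      exact hy.trans (Metric.infEDist_le_edist_of_mem hx)
    have h4 : ENNReal.ofReal u < ENNReal.ofReal (u + 1) :=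
      (ENNReal.ofReal_lt_ofReal_iff (by positivity)).2 (by linarith)
    exact absurd (h3.trans hx2) (not_le.2 h4)
  unfold SuppIn at h1
  rw [← hg', inner_proj hK.isClosed.measurableSet, ← h1,
    proj_proj hK.isClosed.measurableSet hm, hd, proj_empty, inner_zero_right]

variable (Fm E μ)

/-- The `*`-algebra `𝒜₀` of the operators of finite propagation. -/
def finitePropagation [SigmaCompactSpace M] : StarSubalgebra ℂ (L2 Fm E μ →L[ℂ] L2 Fm E μ) where
  carrier := {A | HasFinitePropagation A}
  mul_mem' := HasFinitePropagation.mul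
  add_mem' := HasFinitePropagation.add
  algebraMap_mem' := hasFinitePropagation_algebraMap
  star_mem' := HasFinitePropagation.star

/-- The C⋆-algebra `𝒜` of almost local operators: the norm closure of `𝒜₀`. -/
abbrev almostLocal [SigmaCompactSpace M] : StarSubalgebra ℂ (L2 Fm E μ →L[ℂ] L2 Fm E μ) :=
  (finitePropagation Fm E μ).topologicalClosure

end Propagation
/-! ### Weights and traces on C⋆-algebras -/

section Weights

variable {A : Type*} [NormedRing A] [NormedAlgebra ℂ A] [StarRing A] [PartialOrder A]

/-- `τ` restricts to a weight on the cone of positive elements: `τ : A₊ → [0, ∞]` is additive and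
positively homogeneous (its values outside of `A₊` play no role). -/
structure IsWeight (τ : A → ℝ≥0∞) : Prop where
  map_zero : τ 0 = 0
  map_add : ∀ a b : A, 0 ≤ a → 0 ≤ b → τ (a + b) = τ a + τ b
  map_smul : ∀ (r : ℝ) (a : A), 0 < r → 0 ≤ a → τ ((r : ℂ) • a) = ENNReal.ofReal r * τ a

/-- The cone `J₊` of the positive elements on which `τ` is finite. -/
def finiteCone (τ : A → ℝ≥0∞) : Set A := {a | 0 ≤ a ∧ τ a < ⊤}

/-- The linear span `J` of `J₊`. -/
def finiteSpan (τ : A → ℝ≥0∞) : Submodule ℂ A := Submodule.span ℂ (finiteCone τ)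

/-- The linear functional `t` on `J` extends the restriction of `τ` to `J₊`. -/
def IsLinearExtension (τ : A → ℝ≥0∞) (t : finiteSpan τ →ₗ[ℂ] ℂ) : Prop :=
  ∀ (a : A) (ha : a ∈ finiteCone τ), t ⟨a, Submodule.subset_span ha⟩ = ((τ a).toReal : ℂ)

/-- `τ` is a trace on `A₊`: a weight with `τ(a* a) = τ(a a*)`, such that `J` is a two-sided ideal
and the linear extension `t` of `τ` to `J` satisfies `t(ab) = t(ba)` for `a ∈ J` and `b ∈ A`. -/
structure IsTrace (τ : A → ℝ≥0∞) : Prop extends IsWeight τ where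
  map_star_mul : ∀ a : A, τ (star a * a) = τ (a * star a)
  mul_mem : ∀ a ∈ finiteSpan τ, ∀ b : A, a * b ∈ finiteSpan τ ∧ b * a ∈ finiteSpan τ
  exists_extension : ∃ t : finiteSpan τ →ₗ[ℂ] ℂ, IsLinearExtension τ t ∧
    ∀ (a : A) (ha : a ∈ finiteSpan τ) (b : A),
      t ⟨a * b, (mul_mem a ha b).1⟩ = t ⟨b * a, (mul_mem a ha b).2⟩

/-- `τ` is semifinite: `τ(a) = sup {τ(b) : 0 ≤ b ≤ a, b ∈ J₊}` for all `a ∈ A₊`. -/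
def IsSemifinite (τ : A → ℝ≥0∞) : Prop :=
  ∀ a : A, 0 ≤ a → IsLUB (τ '' {b | b ∈ finiteCone τ ∧ b ≤ a}) (τ a)

/-- The lower semicontinuous regularization of `τ₀`:
`a ↦ sup {ψ(a) : ψ a positive linear functional, ψ ≤ τ₀ on A₊}`. -/
def lscRegularization (τ₀ : A → ℝ≥0∞) (a : A) : ℝ≥0∞ :=
  sSup {r | ∃ ψ : A →L[ℂ] ℂ, (∀ b, 0 ≤ b → 0 ≤ ψ b) ∧
    (∀ b, 0 ≤ b → ENNReal.ofReal (ψ b).re ≤ τ₀ b) ∧ r = ENNReal.ofReal (ψ a).re}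

/-- The semifinite regularization of `τ`, which coincides with `τ` on `J₊`:
`a ↦ sup {τ(b) : 0 ≤ b ≤ a, τ(b) < ∞}`. -/
def semifiniteRegularization (τ : A → ℝ≥0∞) (a : A) : ℝ≥0∞ :=
  sSup (τ '' {b | b ∈ finiteCone τ ∧ b ≤ a})

end Weights

/-! ### The functional of Roe -/

section Trace

variable {H : Type*} [NormedAddCommGroup H] [InnerProductSpace ℂ H] [CompleteSpace H]

/-- The trace `∑ ⟨T eᵢ, eᵢ⟩ ∈ [0, ∞]` of a positive operator, in an orthonormal basis (it does not
depend on the basis). -/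
def posTrace (T : H →L[ℂ] H) : ℝ≥0∞ :=
  ∑' i, ENNReal.ofReal
    (RCLike.re ⟪T ((exists_hilbertBasis ℂ H).choose_spec.choose i),
      (exists_hilbertBasis ℂ H).choose_spec.choose i⟫_ℂ)

end Trace

/-- A generalized limit: a state on the C⋆-algebra `ℓ^∞(ℕ)` which vanishes on the sequences that
tend to `0`. -/
structure GeneralizedLimit where
  /-- the underlying linear functional -/
  toLinearMap : lp (fun _ : ℕ => ℂ) ⊤ →ₗ[ℂ] ℂ
  map_nonneg : ∀ a : lp (fun _ : ℕ => ℂ) ⊤, (∀ k, 0 ≤ a k) → 0 ≤ toLinearMap a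
  map_one : toLinearMap 1 = 1
  map_of_tendsto_zero : ∀ a : lp (fun _ : ℕ => ℂ) ⊤, Tendsto (fun k => a k) atTop (𝓝 0) →
    toLinearMap a = 0

section Roe

variable {M : Type*} [MetricSpace M] [MeasurableSpace M]

/-- `K(-r)`: the closure of the complement of `(M ∖ K)(r)`, where `K(r)` is the set of points at
distance at most `r` from `K` (`Metric.cthickening r K`). -/
def innerPen (K : Set M) (r : ℝ) : Set M := closure (Metric.cthickening r Kᶜ)ᶜ

/-- A regular exhaustion of `M`, with respect to the volume `μ`. -/
structure RegularExhaustion (μ : Measure M) where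
  /-- the compact sets -/
  K : ℕ → Set M
  monotone : Monotone K
  isCompact : ∀ k, IsCompact (K k)
  iUnion_eq : ⋃ k, K k = univ
  tendsto_ratio : ∀ r : ℝ, 0 < r →
    Tendsto (fun k => μ (Metric.cthickening r (K k)) / μ (innerPen (K k) r)) atTop (𝓝 1)

variable [BorelSpace M] [SecondCountableTopology M]
  {Fm : Type*} [NormedAddCommGroup Fm] [NormedSpace ℂ Fm] [FiniteDimensional ℂ Fm]
  {E : M → Type*} [∀ x, NormedAddCommGroup (E x)] [∀ x, InnerProductSpace ℂ (E x)]
  [TopologicalSpace (TotalSpace Fm E)] [FiberBundle Fm E] [VectorBundle ℂ Fm E]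
  [IsHermitianBundle Fm E] {μ : Measure M}

/-- `μ_T(S) = Tr(E_S T E_S)`, for a positive operator `T` and a Borel set `S`. -/
def localTrace (T : L2 Fm E μ →L[ℂ] L2 Fm E μ) (S : Set M) : ℝ≥0∞ :=
  posTrace (proj Fm E μ S * T * proj Fm E μ S)

/-- `T` belongs to the cone `J₀₊`: it is positive and locally trace class, `μ_T(K_k) ≤ c vol(K_k)`
for all `k`, and `μ_T(K_k(r₁) ∖ K_k(-r₂)) / vol(K_k) → 0` for all `r₁, r₂ > 0`. -/
structure MemRoeCone (𝒦 : RegularExhaustion μ) (T : L2 Fm E μ →L[ℂ] L2 Fm E μ) : Prop where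
  isPositive : T.IsPositive
  locallyTraceClass : ∀ C : Set M, IsCompact C → localTrace T C < ⊤
  bounded : ∃ c : ℝ≥0, 0 < c ∧ ∀ k, localTrace T (𝒦.K k) ≤ c * μ (𝒦.K k)
  tendsto_boundary : ∀ r₁ r₂ : ℝ, 0 < r₁ → 0 < r₂ →
    Tendsto (fun k =>
      localTrace T (Metric.cthickening r₁ (𝒦.K k) \ innerPen (𝒦.K k) r₂) / μ (𝒦.K k))
      atTop (𝓝 0)

theorem MemRoeCone.memℓp {𝒦 : RegularExhaustion μ} {T : L2 Fm E μ →L[ℂ] L2 Fm E μ}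
    (hT : MemRoeCone 𝒦 T) :
    Memℓp (fun k => (((localTrace T (𝒦.K k) / μ (𝒦.K k)).toReal : ℝ) : ℂ)) ⊤ := by
  obtain ⟨c, -, hc⟩ := hT.bounded
  refine memℓp_infty ⟨c, ?_⟩
  rintro _ ⟨k, rfl⟩
  simp only [Complex.norm_real, Real.norm_eq_abs, abs_of_nonneg ENNReal.toReal_nonneg]
  exact ENNReal.toReal_le_coe_of_le_coe (ENNReal.div_le_of_le_mul (hc k))

open Classical in
/-- The functional `φ` of Roe: `φ(T) = Lim μ_T(K_k) / vol(K_k)` for `T ∈ J₀₊`, and `φ(T) = ∞` for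
all other positive operators. -/
def roeFunctional (𝒦 : RegularExhaustion μ) (Lim : GeneralizedLimit)
    (T : L2 Fm E μ →L[ℂ] L2 Fm E μ) : ℝ≥0∞ :=
  if hT : MemRoeCone 𝒦 T then ENNReal.ofReal (Lim.toLinearMap ⟨_, hT.memℓp⟩).re else ⊤

variable (Fm E) in
/-- The regularization `Tr_𝒦` of `φ`: the semifinite regularization of the lower semicontinuous
regularization of the restriction of `φ` to the C⋆-algebra of almost local operators. -/
def roeTrace [SigmaCompactSpace M] (𝒦 : RegularExhaustion μ) (Lim : GeneralizedLimit) :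
    almostLocal Fm E μ → ℝ≥0∞ :=
  semifiniteRegularization
    (lscRegularization fun T : almostLocal Fm E μ => roeFunctional 𝒦 Lim (T : L2 Fm E μ →L[ℂ] _))

end Roe

end OpenManifold

end

open OpenManifold

/-! The argument has an analytic half, which turns `φ` into a trace, and a geometric half, which
shows that the volume of `M` is infinite.

`φ` is a weight, because `J₀₊` is a hereditary cone on which `T ↦ μ_T(S)` is additive. It need not
be tracial, but `φ(V T V⋆) ≤ φ(T)` for every contraction `V` of finite propagation `u`. Indeed, if
`T = C C⋆`, then `μ_{VTV⋆}(K)` is the squared Hilbert–Schmidt norm of `E_K V C`, and `E_K V` only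
sees the `(u+1)`-neighbourhood of `K`; so `μ_{VTV⋆}(K_n)` exceeds `μ_T(K_n)` at most by the mass of
a collar, negligible against the volume (`MemRoeCone.conj`, `roeFunctional_conj_le`).

The rest of the analytic half is order theory in C⋆-algebras. By Hahn–Banach, `τ(a) ≤ t` provides
`b` with `a ≤ b + δ` and `φ(b) ≤ t + ε` (`exists_le_add_of_lscRegularization_le`). Compression by
`(c/(c+δ))^{1/2}` makes such an approximate inequality exact (`star_mul_le_cutRoot`,
`cutRoot_conj_le`). Since `x⋆x` is almost `w(xx⋆)w⋆` for a contraction `w`, and `w` is a limit of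
contractions of finite propagation, `τ(x⋆x) ≤ φ(xx⋆)`; with the duality this gives both the
additivity and the traciality of `τ` (`isWeight_lscRegularization`,
`lscRegularization_star_mul_eq`). The semifinite regularization preserves these properties by a
Riesz-type decomposition, and polarization yields the ideal `J` and the linear trace on it
(`isTrace_of_isWeight`).

A positive compact `T` satisfies `T ≤ C C⋆ + δ` with `C C⋆` of finite rank, and `φ(C C⋆) = 0` as
soon as `vol(K_n) → ∞`; semicontinuity then gives `Tr_𝒦(T) = 0`. For an arbitrary compact `T`, the
nullity of `T⋆T` puts `T` in `J` with trace `0` (`mem_finiteSpan_of_null`).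

For the infinite volume (`BoundedGeometry.riemannianVolume_univ`): a complete non-compact `M` is not
totally bounded, so it contains an infinite separated sequence. The exponential images of a small
ball of fixed radius at these points are disjoint. Comparison for Jacobi fields under the curvature
bound gives `|d exp(w)| ≥ |w|/2` on that ball, so these images have volumes bounded below. -/

noncomputable section

namespace OpenManifold

/-! ### Order and functional calculus in a C⋆-algebra -/

section CStar

variable {A : Type*} [CStarAlgebra A] [PartialOrder A] [StarOrderedRing A]

/-- The element `(c / (c + δ))^{1/2}`. -/
def cutRoot (c : A) (δ : ℝ) : A := cfc (fun t : ℝ => √(t / (t + δ))) c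

theorem isSelfAdjoint_cutRoot (c : A) (δ : ℝ) : IsSelfAdjoint (cutRoot c δ) :=
  cfc_predicate _ _

theorem le_add_algebraMap_norm_sub {a b : A} (ha : IsSelfAdjoint a) (hb : IsSelfAdjoint b) :
    a ≤ b + algebraMap ℝ A ‖a - b‖ := by
  have := (ha.sub hb).le_algebraMap_norm_self
  rwa [sub_le_iff_le_add'] at this

theorem le_algebraMap_of_norm_le {a : A} (ha : IsSelfAdjoint a) {r : ℝ} (h : ‖a‖ ≤ r) :
    a ≤ algebraMap ℝ A r :=
  ha.le_algebraMap_norm_self.trans (by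
    rw [← sub_nonneg, ← map_sub]; exact algebraMap_nonneg A (sub_nonneg.2 h))

theorem cfc_mul_add_mul {c : A} (hc : 0 ≤ c) (δ : ℝ) {f h : ℝ → ℝ}
    (hf : ContinuousOn f (spectrum ℝ c)) (hh : ∀ t, 0 ≤ t → f t * (t + δ) * f t = h t) :
    cfc f c * (c + algebraMap ℝ A δ) * cfc f c = cfc h c := by
  have hsa : IsSelfAdjoint c := IsSelfAdjoint.of_nonneg hc
  have h1 : c + algebraMap ℝ A δ = cfc (fun t : ℝ => t + δ) c := by
    rw [cfc_add_const δ (fun t => t) c, cfc_id' ℝ c]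
  rw [h1, ← cfc_mul f _ c, ← cfc_mul _ f c]
  exact cfc_congr fun t ht => hh t (spectrum_nonneg_of_nonneg hc ht)

theorem continuousOn_cutRoot {c : A} (hc : 0 ≤ c) {δ : ℝ} (hδ : 0 < δ) :
    ContinuousOn (fun t : ℝ => √(t / (t + δ))) (spectrum ℝ c) := by
  refine ContinuousOn.sqrt (ContinuousOn.div continuousOn_id (by fun_prop) fun t ht => ?_)
  have : 0 ≤ t := spectrum_nonneg_of_nonneg hc ht
  positivity

theorem continuousOn_cutRoot' {c : A} (hc : 0 ≤ c) {δ : ℝ} (hδ : 0 < δ) :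
    ContinuousOn (fun t : ℝ => √(δ / (t + δ))) (spectrum ℝ c) := by
  refine ContinuousOn.sqrt (ContinuousOn.div continuousOn_const (by fun_prop) fun t ht => ?_)
  have : 0 ≤ t := spectrum_nonneg_of_nonneg hc ht
  positivity

theorem cutRoot_conj {c : A} (hc : 0 ≤ c) {δ : ℝ} (hδ : 0 < δ) :
    cutRoot c δ * (c + algebraMap ℝ A δ) * cutRoot c δ = c := by
  have hsa : IsSelfAdjoint c := IsSelfAdjoint.of_nonneg hc
  rw [cutRoot, cfc_mul_add_mul hc δ (h := fun t => t) (continuousOn_cutRoot hc hδ) fun t ht => ?_]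
  · exact cfc_id' ℝ c
  · have h : 0 < t + δ := by positivity
    rw [mul_right_comm, Real.mul_self_sqrt (by positivity)]
    field_simp

/-- `(c / (c + δ))^{1/2} T (c / (c + δ))^{1/2} ≤ c` if `T ≤ c + δ`. -/
theorem cutRoot_conj_le {c T : A} (hc : 0 ≤ c) {δ : ℝ} (hδ : 0 < δ)
    (hT : T ≤ c + algebraMap ℝ A δ) : cutRoot c δ * T * cutRoot c δ ≤ c :=
  ((isSelfAdjoint_cutRoot c δ).conjugate_le_conjugate hT).trans_eq (cutRoot_conj hc hδ)

/-- With `G² = c/(c+δ)` and `H² = δ/(c+δ)`, the partition `G² + H² = 1` splits `x⋆x` into `(Gx)⋆(Gx)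
+ (Hx)⋆(Hx)`, and the last term has the norm of `H x x⋆ H ≤ H (c+δ) H = δ`. Thus `Gx` loses only `δ`
on the side of `x⋆x`, while on the other side `(Gx)(Gx)⋆ ≤ c` holds exactly, by `cutRoot_conj_le`.
-/
theorem star_mul_le_cutRoot {c x : A} (hc : 0 ≤ c) {δ : ℝ} (hδ : 0 < δ)
    (hx : x * star x ≤ c + algebraMap ℝ A δ) :
    star x * x ≤ star (cutRoot c δ * x) * (cutRoot c δ * x) + algebraMap ℝ A δ := by
  set G := cutRoot c δ with hG
  set H := cfc (fun t : ℝ => √(δ / (t + δ))) c with hH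
  have hsa : IsSelfAdjoint c := IsSelfAdjoint.of_nonneg hc
  have hHs : IsSelfAdjoint H := cfc_predicate _ _
  have hGs : IsSelfAdjoint G := cfc_predicate _ _
  have hcG := continuousOn_cutRoot hc hδ
  have hcH := continuousOn_cutRoot' hc hδ
  have h1 : G * G + H * H = 1 := by
    rw [hG, hH, cutRoot, ← cfc_mul _ _ c hcG hcG, ← cfc_mul _ _ c hcH hcH,
      ← cfc_add c (fun t : ℝ => √(t / (t + δ)) * √(t / (t + δ)))
        (fun t : ℝ => √(δ / (t + δ)) * √(δ / (t + δ))) (hcG.mul hcG) (hcH.mul hcH),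
      ← cfc_one ℝ c]
    refine cfc_congr fun t ht => ?_
    have h0 : 0 ≤ t := spectrum_nonneg_of_nonneg hc ht
    have h : 0 < t + δ := by positivity
    simp only [Pi.one_apply]
    rw [Real.mul_self_sqrt (by positivity), Real.mul_self_sqrt (by positivity)]
    field_simp
  have h2 : H * (x * star x) * H ≤ algebraMap ℝ A δ := by
    refine (hHs.conjugate_le_conjugate hx).trans_eq ?_
    rw [hH, cfc_mul_add_mul hc δ (h := fun _ => δ) hcH fun t ht => ?_]
    · exact cfc_const δ c
    · have h : 0 < t + δ := by positivity
      rw [mul_right_comm, Real.mul_self_sqrt (by positivity)]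
      field_simp
  -- The order of the factors is exchanged here, through `‖y⋆y‖ = ‖yy⋆‖`.
  have h3 : star (H * x) * (H * x) ≤ algebraMap ℝ A δ := by
    refine le_algebraMap_of_norm_le (.star_mul_self _) ?_
    rw [CStarRing.norm_star_mul_self, ← CStarRing.norm_self_mul_star]
    have h4 : 0 ≤ H * x * star (H * x) := mul_star_self_nonneg _
    refine (CStarAlgebra.norm_le_iff_le_algebraMap _ hδ.le h4).2 ?_
    rwa [star_mul, hHs.star_eq, ← mul_assoc, mul_assoc H x]
  calc star x * x = star x * (G * G + H * H) * x := by rw [h1, mul_one]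
    _ = star (G * x) * (G * x) + star (H * x) * (H * x) := by
      rw [star_mul, star_mul, hHs.star_eq, hGs.star_eq]; noncomm_ring
    _ ≤ _ := by gcongr

/-- The element `(c + δ)^{-1/2}`. -/
def invRoot (c : A) (δ : ℝ) : A := cfc (fun t : ℝ => √(1 / (t + δ))) c

theorem isSelfAdjoint_invRoot (c : A) (δ : ℝ) : IsSelfAdjoint (invRoot c δ) :=
  cfc_predicate _ _

theorem continuousOn_invRoot {c : A} (hc : 0 ≤ c) {δ : ℝ} (hδ : 0 < δ) :
    ContinuousOn (fun t : ℝ => √(1 / (t + δ))) (spectrum ℝ c) := by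
  refine ContinuousOn.sqrt (ContinuousOn.div continuousOn_const (by fun_prop) fun t ht => ?_)
  have : 0 ≤ t := spectrum_nonneg_of_nonneg hc ht
  positivity

theorem invRoot_conj {c : A} (hc : 0 ≤ c) {δ : ℝ} (hδ : 0 < δ) :
    invRoot c δ * c * invRoot c δ = cutRoot c δ * cutRoot c δ := by
  have hsa : IsSelfAdjoint c := IsSelfAdjoint.of_nonneg hc
  have hcG := continuousOn_cutRoot hc hδ
  have hcH := continuousOn_invRoot hc hδ
  rw [cutRoot, ← cfc_mul _ _ c hcG hcG]
  have h2 : invRoot c δ * c * invRoot c δ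
      = cfc (fun t : ℝ => √(1 / (t + δ)) * t * √(1 / (t + δ))) c := by
    rw [invRoot]
    conv_lhs => enter [1, 2]; rw [← cfc_id' ℝ c]
    rw [← cfc_mul _ _ c hcH (by fun_prop), ← cfc_mul (fun t : ℝ => √(1 / (t + δ)) * t) _ c
      (hcH.mul continuousOn_id) hcH]
  rw [h2]
  refine cfc_congr fun t ht => ?_
  have h0 : 0 ≤ t := spectrum_nonneg_of_nonneg hc ht
  have h : 0 < t + δ := by positivity
  rw [mul_right_comm, Real.mul_self_sqrt (by positivity), Real.mul_self_sqrt (by positivity)]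
  field_simp

/-- A substitute for dividing `T ≤ c` by `c`, which need not be invertible: `(c+δ)^{-1/2} T
(c+δ)^{-1/2}` is bounded by the same expression with `c + δ` in place of `T`. -/
theorem invRoot_conj_le_one {c T : A} (hc : 0 ≤ c) {δ : ℝ} (hδ : 0 < δ)
    (hT : T ≤ c + algebraMap ℝ A δ) : invRoot c δ * T * invRoot c δ ≤ 1 := by
  have hsa : IsSelfAdjoint c := IsSelfAdjoint.of_nonneg hc
  refine ((isSelfAdjoint_invRoot c δ).conjugate_le_conjugate hT).trans_eq ?_
  rw [invRoot, cfc_mul_add_mul hc δ (h := fun _ => 1) (continuousOn_invRoot hc hδ) fun t ht => ?_]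
  · rw [cfc_const_one ℝ c]
  · have h : 0 < t + δ := by positivity
    rw [mul_right_comm, Real.mul_self_sqrt (by positivity)]
    field_simp

theorem cutRoot_mul_self_le_one {c : A} (hc : 0 ≤ c) {δ : ℝ} (hδ : 0 < δ) :
    cutRoot c δ * cutRoot c δ ≤ 1 := by
  rw [← invRoot_conj hc hδ]
  exact invRoot_conj_le_one hc hδ (le_add_of_nonneg_right (algebraMap_nonneg A hδ.le))

/-- `x⋆ (x x⋆ + δ)^{-1/2}` is a contraction `w` such that `w (x x⋆) w⋆` is almost `x⋆ x`. -/
theorem exists_contraction_conj (x : A) {δ : ℝ} (hδ : 0 < δ) :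
    ∃ w : A, ‖w‖ ≤ 1 ∧ star x * x ≤ w * (x * star x) * star w + algebraMap ℝ A δ := by
  set c := x * star x with hcdef
  have hc : 0 ≤ c := mul_star_self_nonneg x
  set H := invRoot c δ with hH
  have hHs : IsSelfAdjoint H := isSelfAdjoint_invRoot c δ
  have h1 : H * c * H = cutRoot c δ * cutRoot c δ := invRoot_conj hc hδ
  refine ⟨star x * H, ?_, ?_⟩
  · have h3 : ‖star (star x * H) * (star x * H)‖ ≤ 1 := by
      have h4 : star (star x * H) * (star x * H) = cutRoot c δ * cutRoot c δ := by
        rw [← h1, star_mul, hHs.star_eq, star_star, hcdef]; noncomm_ring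
      have h0 : 0 ≤ star (star x * H) * (star x * H) := star_mul_self_nonneg _
      rw [CStarAlgebra.norm_le_one_iff_of_nonneg _ h0, h4]
      exact cutRoot_mul_self_le_one hc hδ
    rw [CStarRing.norm_star_mul_self] at h3
    nlinarith [norm_nonneg (star x * H)]
  · have h6 := star_mul_le_cutRoot (x := x) hc hδ (by
      rw [← hcdef, le_add_iff_nonneg_right]
      exact algebraMap_nonneg A hδ.le)
    refine h6.trans_eq ?_
    congr 1
    rw [star_mul, star_mul, star_star, hHs.star_eq, (isSelfAdjoint_cutRoot c δ).star_eq]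
    calc star x * cutRoot c δ * (cutRoot c δ * x) = star x * (cutRoot c δ * cutRoot c δ) * x := by
          noncomm_ring
      _ = star x * (H * c * H) * x := by rw [h1]
      _ = _ := by noncomm_ring

end CStar

/-! ### Regularizations of weights -/

/-- A sublinear function on a real vector space is attained by a linear functional below it. -/
theorem exists_linearMap_le_of_sublinear {V : Type*} [AddCommGroup V] [Module ℝ V] (N : V → ℝ)
    (hom : ∀ c : ℝ, 0 < c → ∀ x, N (c • x) = c * N x) (add : ∀ x y, N (x + y) ≤ N x + N y)
    (a : V) : ∃ g : V →ₗ[ℝ] ℝ, g a = N a ∧ ∀ x, g x ≤ N x := by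
  have h0 : N 0 = 0 := by
    have := hom 2 (by norm_num) 0
    rw [smul_zero] at this; linarith
  rcases eq_or_ne a 0 with rfl | ha
  · obtain ⟨g, -, hg⟩ := exists_extension_of_le_sublinear
      (⟨⊥, 0⟩ : V →ₗ.[ℝ] ℝ) N hom add (by
        rintro ⟨x, hx⟩
        obtain rfl := (Submodule.mem_bot ℝ).1 hx
        exact h0.ge)
    exact ⟨g, by simp [h0], hg⟩
  · obtain ⟨g, hg, hg'⟩ := exists_extension_of_le_sublinear
      (LinearPMap.mkSpanSingleton (σ := RingHom.id ℝ) a (N a) ha) N hom add (by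
        rintro ⟨x, hx⟩
        obtain ⟨c, rfl⟩ := Submodule.mem_span_singleton.1 hx
        rw [LinearPMap.mkSpanSingleton'_apply]
        change c * N a ≤ N (c • a)
        rcases lt_trichotomy c 0 with hc | rfl | hc
        · have h1 := add (c • a) ((-c) • a)
          rw [← add_smul, add_neg_cancel, zero_smul, h0, hom (-c) (by linarith)] at h1
          linarith
        · simp [h0]
        · exact (hom c hc a).ge)
    refine ⟨g, ?_, hg'⟩
    have := hg ⟨a, Submodule.mem_span_singleton_self a⟩
    rw [LinearPMap.mkSpanSingleton_apply] at this
    exact this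

section Regularization

variable {A : Type*} [CStarAlgebra A] [PartialOrder A] [StarOrderedRing A]
  {φ τ : A → ℝ≥0∞}

theorem IsWeight.mono (hφ : IsWeight φ) {a b : A} (ha : 0 ≤ a) (hab : a ≤ b) : φ a ≤ φ b := by
  have := hφ.map_add a (b - a) ha (sub_nonneg.2 hab)
  rw [add_sub_cancel] at this
  rw [this]
  exact le_self_add

theorem algebraMap_real_eq_smul (δ : ℝ) : algebraMap ℝ A δ = (δ : ℂ) • (1 : A) := by
  rw [Algebra.algebraMap_eq_smul_one]
  exact (Complex.coe_smul δ (1 : A)).symm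

theorem algebraMap_real_nonneg {δ : ℝ} (hδ : 0 ≤ δ) : 0 ≤ algebraMap ℝ A δ :=
  algebraMap_nonneg A hδ

theorem coe_smul_nonneg {r : ℝ} (hr : 0 ≤ r) {a : A} (ha : 0 ≤ a) : 0 ≤ (r : ℂ) • a := by
  rw [Complex.coe_smul]; exact smul_nonneg hr ha

/-- Lower semicontinuity with respect to the order: `t < τ a` implies `t < τ b` for all `b ≥ 0`
with `a ≤ b + δ`, for some `δ > 0`. -/
def OrderLsc (τ : A → ℝ≥0∞) : Prop :=
  ∀ a, 0 ≤ a → ∀ t < τ a, ∃ δ : ℝ, 0 < δ ∧ ∀ b, 0 ≤ b → a ≤ b + algebraMap ℝ A δ → t < τ b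

/-- Norm-closeness gives `a ≤ b + ‖a - b‖`, so the order version is the stronger one. -/
theorem OrderLsc.lowerSemicontinuousOn (h : OrderLsc τ) :
    LowerSemicontinuousOn τ {a | 0 ≤ a} := by
  intro a ha t ht
  obtain ⟨δ, hδ, H⟩ := h a ha t ht
  filter_upwards [self_mem_nhdsWithin, mem_nhdsWithin_of_mem_nhds (Metric.ball_mem_nhds a hδ)]
    with b hb hb'
  refine H b hb ((le_add_algebraMap_norm_sub (IsSelfAdjoint.of_nonneg ha)
    (IsSelfAdjoint.of_nonneg hb)).trans ?_)
  rw [add_le_add_iff_left, ← sub_nonneg, ← map_sub]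
  refine algebraMap_real_nonneg (sub_nonneg.2 ?_)
  rw [← dist_eq_norm, dist_comm]
  exact (Metric.mem_ball.1 hb').le

theorem OrderLsc.mono (h : OrderLsc τ) {a b : A} (ha : 0 ≤ a) (hab : a ≤ b) : τ a ≤ τ b := by
  refine le_of_forall_lt fun t ht => ?_
  obtain ⟨δ, hδ, H⟩ := h a ha t ht
  exact H b (ha.trans hab) (hab.trans (le_add_of_nonneg_right (algebraMap_real_nonneg hδ.le)))

/-- The form in which order semicontinuity is applied throughout: an upper bound for `τ a` follows
from elements that dominate `a` only up to `δ`, without being close to it. -/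
theorem OrderLsc.le_of_forall (h : OrderLsc τ) {a : A} (ha : 0 ≤ a) {s : ℝ≥0∞}
    (H : ∀ δ : ℝ, 0 < δ → ∃ b, 0 ≤ b ∧ a ≤ b + algebraMap ℝ A δ ∧ τ b ≤ s) : τ a ≤ s := by
  refine le_of_forall_lt fun t ht => ?_
  obtain ⟨δ, hδ, H'⟩ := h a ha t ht
  obtain ⟨b, hb, hab, hs⟩ := H δ hδ
  exact (H' b hb hab).trans_le hs

theorem lscRegularization_le (a : A) (ha : 0 ≤ a) : lscRegularization φ a ≤ φ a := by
  refine sSup_le ?_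
  rintro r ⟨ψ, -, h, rfl⟩
  exact h a ha

theorem re_le_re_of_le {ψ : A →L[ℂ] ℂ} (hψ : ∀ b, 0 ≤ b → 0 ≤ ψ b) {a b : A} (hab : a ≤ b) :
    (ψ a).re ≤ (ψ b).re := by
  have := hψ (b - a) (sub_nonneg.2 hab)
  rw [map_sub, sub_nonneg] at this
  exact (Complex.le_def.1 this).1

/-- For one positive functional, `a ≤ b + δ` gives `ψ(b) ≥ ψ(a) - δ ψ(1)`; the property passes to
the supremum over `ψ`. -/
theorem orderLsc_lscRegularization : OrderLsc (lscRegularization φ) := by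
  intro a ha t ht
  obtain ⟨r, ⟨ψ, hψ, hψφ, rfl⟩, htr⟩ := lt_sSup_iff.1 ht
  set C := (ψ 1).re with hC
  have hlim : Tendsto (fun δ : ℝ => ENNReal.ofReal ((ψ a).re - δ * C)) (𝓝[>] 0)
      (𝓝 (ENNReal.ofReal (ψ a).re)) := by
    have : Continuous fun δ : ℝ => ENNReal.ofReal ((ψ a).re - δ * C) :=
      ENNReal.continuous_ofReal.comp (by fun_prop)
    simpa using (this.tendsto 0).mono_left nhdsWithin_le_nhds
  obtain ⟨δ, h1, h2⟩ := ((hlim.eventually (lt_mem_nhds htr)).and self_mem_nhdsWithin).exists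
  refine ⟨δ, h2, fun b hb hab => h1.trans_le ?_⟩
  refine le_trans (ENNReal.ofReal_le_ofReal ?_) (le_sSup ⟨ψ, hψ, hψφ, rfl⟩)
  have h3 := re_le_re_of_le hψ hab
  rw [map_add, algebraMap_real_eq_smul, map_smul] at h3
  simp only [Complex.add_re, smul_eq_mul, Complex.re_ofReal_mul] at h3
  linarith

theorem lscRegularization_zero : lscRegularization φ 0 = 0 := by
  refine le_antisymm (sSup_le ?_) bot_le
  rintro r ⟨ψ, -, -, rfl⟩
  simp

theorem lscRegularization_add_le {a b : A} :
    lscRegularization φ (a + b) ≤ lscRegularization φ a + lscRegularization φ b := by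
  refine sSup_le ?_
  rintro r ⟨ψ, h1, h2, rfl⟩
  rw [map_add, Complex.add_re]
  exact ENNReal.ofReal_add_le.trans
    (add_le_add (le_sSup ⟨ψ, h1, h2, rfl⟩) (le_sSup ⟨ψ, h1, h2, rfl⟩))

theorem lscRegularization_smul {r : ℝ} (hr : 0 < r) (a : A) :
    lscRegularization φ ((r : ℂ) • a) = ENNReal.ofReal r * lscRegularization φ a := by
  have key : ∀ ψ : A →L[ℂ] ℂ, ENNReal.ofReal (ψ ((r : ℂ) • a)).re
      = ENNReal.ofReal r * ENNReal.ofReal (ψ a).re := by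
    intro ψ
    rw [map_smul, smul_eq_mul, Complex.re_ofReal_mul, ENNReal.ofReal_mul hr.le]
  unfold lscRegularization
  rw [ENNReal.mul_sSup]
  refine le_antisymm (sSup_le ?_) (iSup₂_le ?_)
  · rintro _ ⟨ψ, h1, h2, rfl⟩
    rw [key]
    exact le_iSup₂_of_le _ ⟨ψ, h1, h2, rfl⟩ le_rfl
  · rintro _ ⟨ψ, h1, h2, rfl⟩
    rw [← key]
    exact le_sSup ⟨ψ, h1, h2, rfl⟩

/-- Duality: if `ψ a ≤ t` for all positive functionals `ψ ≤ φ`, then `a ≤ b + δ` for some `b` with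
`φ b ≤ t + ε`. -/
theorem exists_le_add_of_lscRegularization_le (hφ : IsWeight φ) {a : A} (ha : 0 ≤ a) {t : ℝ}
    (ht : 0 ≤ t) (h : lscRegularization φ a ≤ ENNReal.ofReal t) {ε δ : ℝ} (hε : 0 < ε)
    (hδ : 0 < δ) :
    ∃ b, 0 ≤ b ∧ a ≤ b + algebraMap ℝ A δ ∧ φ b ≤ ENNReal.ofReal (t + ε) := by
  -- The price of one unit of the scalar part: a total cost below `t + ε` then forces this part to
  -- be at most `δ`.
  set m : ℝ := (t + ε) / δ with hm
  have hmpos : 0 < m := by positivity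
  -- `N x`, the infimum of `S x`, is the least cost `φ(b) + m s` of dominating `Re x` by `b + s`. A
  -- linear `g ≤ N` is at once positive, bounded by `m` and dominated by `φ`; Hahn–Banach provides
  -- one with `g a = N a`, so the hypothesis on `a` bounds `N a` by `t`.
  let S : A → Set ℝ := fun x => {r | ∃ b : A, ∃ s : ℝ, 0 ≤ b ∧ 0 ≤ s ∧ φ b ≠ ⊤ ∧
    (realPart x : A) ≤ b + algebraMap ℝ A s ∧ r = (φ b).toReal + m * s}
  have hbdd : ∀ x, ∀ r ∈ S x, 0 ≤ r := by
    rintro x r ⟨b, s, -, hs, -, -, rfl⟩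
    positivity
  have hbb : ∀ x, BddBelow (S x) := fun x => ⟨0, fun r hr => hbdd x r hr⟩
  have hmem : ∀ x, m * ‖x‖ ∈ S x := by
    intro x
    refine ⟨0, ‖x‖, le_rfl, norm_nonneg _, by simp [hφ.map_zero], ?_, by simp [hφ.map_zero]⟩
    rw [zero_add]
    exact le_algebraMap_of_norm_le (realPart x).2 (realPart.norm_le x)
  let N : A → ℝ := fun x => sInf (S x)
  have hNle : ∀ x, N x ≤ m * ‖x‖ := fun x => csInf_le (hbb x) (hmem x)
  have hom1 : ∀ c : ℝ, 0 < c → ∀ x, N (c • x) ≤ c * N x := by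
    intro c hc x
    rw [← div_le_iff₀' hc]
    refine le_csInf ⟨_, hmem x⟩ ?_
    rintro r ⟨b, s, hb, hs, hb', hx, rfl⟩
    rw [div_le_iff₀' hc]
    refine csInf_le (hbb _) ⟨(c : ℂ) • b, c * s, coe_smul_nonneg hc.le hb, by positivity, ?_, ?_,
      ?_⟩
    · rw [hφ.map_smul c b hc hb]
      exact ENNReal.mul_ne_top (by simp) hb'
    · have h1 : (realPart (c • x) : A) = c • (realPart x : A) := by
        rw [map_smul]; rfl
      rw [h1, Complex.coe_smul, map_mul, ← Algebra.smul_def, ← smul_add]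
      exact smul_le_smul_of_nonneg_left hx hc.le
    · rw [hφ.map_smul c b hc hb, ENNReal.toReal_mul, ENNReal.toReal_ofReal hc.le]
      ring
  have hom : ∀ c : ℝ, 0 < c → ∀ x, N (c • x) = c * N x := by
    intro c hc x
    refine le_antisymm (hom1 c hc x) ?_
    have := hom1 c⁻¹ (by positivity) (c • x)
    rwa [smul_smul, inv_mul_cancel₀ hc.ne', one_smul, le_inv_mul_iff₀ hc] at this
  have add : ∀ x y, N (x + y) ≤ N x + N y := by
    intro x y
    rw [← sub_le_iff_le_add]
    refine le_csInf ⟨_, hmem x⟩ ?_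
    rintro r ⟨b, s, hb, hs, hb', hx, rfl⟩
    rw [sub_le_comm]
    refine le_csInf ⟨_, hmem y⟩ ?_
    rintro r' ⟨b', s', hbb', hs', hb'', hy, rfl⟩
    rw [sub_le_iff_le_add]
    refine csInf_le (hbb _) ⟨b' + b, s' + s, add_nonneg hbb' hb, by positivity, ?_, ?_, ?_⟩
    · rw [hφ.map_add _ _ hbb' hb]
      exact ENNReal.add_ne_top.2 ⟨hb'', hb'⟩
    · have h1 : (realPart (x + y) : A) = (realPart y : A) + (realPart x : A) := by
        rw [map_add, add_comm]; rfl
      rw [h1, map_add]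
      exact (add_le_add hy hx).trans_eq (by abel)
    · rw [hφ.map_add _ _ hbb' hb, ENNReal.toReal_add hb'' hb']
      ring
  obtain ⟨g, hga, hgN⟩ := exists_linearMap_le_of_sublinear N hom add a
  have hN0 : ∀ x, (realPart x : A) ≤ 0 → N x ≤ 0 := fun x hx =>
    csInf_le (hbb x) ⟨0, 0, le_rfl, le_rfl, by simp [hφ.map_zero], by simpa using hx,
      by simp [hφ.map_zero]⟩
  have hgnorm : ∀ x, ‖g x‖ ≤ m * ‖x‖ := by
    intro x
    rw [Real.norm_eq_abs, abs_le]
    have h1 := (hgN (-x)).trans (hNle (-x))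
    rw [map_neg, norm_neg] at h1
    exact ⟨by linarith, (hgN x).trans (hNle x)⟩
  let gc : StrongDual ℝ A := g.mkContinuous m hgnorm
  let ψ : StrongDual ℂ A := gc.extendRCLike
  have hψre : ∀ x, (ψ x).re = g x := fun x => StrongDual.re_extendRCLike_apply (𝕜 := ℂ) gc x
  have hψim : ∀ x, (ψ x).im = - g (Complex.I • x) := fun x =>
    StrongDual.im_extendRCLike_apply (𝕜 := ℂ) gc x
  -- Since `Re(i b) = 0`, both `i b` and `-i b` cost nothing; hence `g(i b) = 0`, and the complex
  -- extension of `g` is real on positive elements.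
  have hre0 : ∀ b : A, 0 ≤ b → (realPart (Complex.I • b) : A) = 0 := by
    intro b hb
    rw [realPart_I_smul, imaginaryPart_eq_zero_iff.2 (IsSelfAdjoint.of_nonneg hb)]
    simp
  have hψpos : ∀ b, 0 ≤ b → 0 ≤ ψ b := by
    intro b hb
    rw [Complex.le_def]
    constructor
    · have h1 := (hgN (-b)).trans (hN0 (-b) (by
        rw [map_neg]
        change -((realPart b : A)) ≤ 0
        rw [IsSelfAdjoint.coe_realPart (IsSelfAdjoint.of_nonneg hb)]
        exact neg_nonpos.2 hb))
      rw [map_neg] at h1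
      rw [hψre, Complex.zero_re]; linarith
    · have h1 := (hgN (Complex.I • b)).trans (hN0 _ (hre0 b hb).le)
      have h2 := (hgN (-(Complex.I • b))).trans (hN0 _ (by
        rw [map_neg]
        change -((realPart (Complex.I • b) : A)) ≤ 0
        rw [hre0 b hb, neg_zero]))
      rw [map_neg] at h2
      rw [hψim, Complex.zero_im]; linarith
  have hψφ : ∀ b, 0 ≤ b → ENNReal.ofReal (ψ b).re ≤ φ b := by
    intro b hb
    by_cases hb' : φ b = ⊤
    · rw [hb']; exact le_top
    · rw [hψre]
      refine ENNReal.ofReal_le_of_le_toReal ((hgN b).trans ?_)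
      refine csInf_le (hbb b) ⟨b, 0, hb, le_rfl, hb', ?_, by simp⟩
      rw [IsSelfAdjoint.coe_realPart (IsSelfAdjoint.of_nonneg hb)]
      simp
  have h1 : ENNReal.ofReal (ψ a).re ≤ ENNReal.ofReal t := by
    refine le_trans ?_ h
    exact le_sSup ⟨ψ, hψpos, hψφ, rfl⟩
  rw [hψre, hga, ENNReal.ofReal_le_ofReal_iff ht] at h1
  obtain ⟨r, ⟨b, s, hb, hs, hb', hab, rfl⟩, hr⟩ := exists_lt_of_csInf_lt (s := S a) ⟨_, hmem a⟩
    (show sInf (S a) < t + ε by change N a < _; linarith)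
  have h3 : 0 ≤ (φ b).toReal := ENNReal.toReal_nonneg
  refine ⟨b, hb, ?_, ?_⟩
  · rw [IsSelfAdjoint.coe_realPart (IsSelfAdjoint.of_nonneg ha)] at hab
    refine hab.trans ?_
    rw [add_le_add_iff_left, ← sub_nonneg, ← map_sub]
    refine algebraMap_real_nonneg (sub_nonneg.2 ?_)
    have h4 : m * s ≤ m * δ := by
      rw [hm, div_mul_cancel₀ _ hδ.ne', ← hm]; linarith
    exact le_of_mul_le_mul_left h4 hmpos
  · refine ENNReal.le_ofReal_iff_toReal_le hb' (by positivity) |>.2 ?_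
    have : 0 ≤ m * s := by positivity
    linarith

end Regularization

section Regularization

variable {A : Type*} [CStarAlgebra A] [PartialOrder A] [StarOrderedRing A]
  {φ τ : A → ℝ≥0∞}

/-- Shrinking `w` by the factor `1 - η/2` leaves room for an approximation by an element of the
dense set that stays in the unit ball. -/
theorem exists_mem_contraction_near {S : Set A} (hS : Dense S) {w : A} (hw : ‖w‖ ≤ 1) {ε : ℝ}
    (hε : 0 < ε) : ∃ v ∈ S, ‖v‖ ≤ 1 ∧ ‖w - v‖ ≤ ε := by
  set η := min ε 1 with hη
  have hη0 : 0 < η := by positivity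
  have hη1 : η ≤ 1 := min_le_right _ _
  obtain ⟨v, hv, hvS⟩ := Metric.dense_iff.1 hS ((1 - η / 2 : ℝ) • w) (η / 2) (by positivity)
  rw [Metric.mem_ball, dist_eq_norm] at hv
  have h1 : ‖(1 - η / 2 : ℝ) • w‖ ≤ 1 - η / 2 := by
    rw [norm_smul, Real.norm_eq_abs, abs_of_nonneg (by linarith)]
    nlinarith
  have h2 : ‖(η / 2 : ℝ) • w‖ ≤ η / 2 := by
    rw [norm_smul, Real.norm_eq_abs, abs_of_nonneg (by linarith)]
    nlinarith
  refine ⟨v, hvS, ?_, ?_⟩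
  · have := norm_add_le (v - (1 - η / 2 : ℝ) • w) ((1 - η / 2 : ℝ) • w)
    rw [sub_add_cancel] at this
    linarith
  · have h3 : w - v = (η / 2 : ℝ) • w - (v - (1 - η / 2 : ℝ) • w) := by module
    rw [h3]
    have := norm_sub_le ((η / 2 : ℝ) • w) (v - (1 - η / 2 : ℝ) • w)
    have : η ≤ ε := min_le_left _ _
    linarith

/-- If `φ` decreases under the conjugation with contractions from a dense set, then the
regularization of `φ` satisfies `τ(x⋆ x) ≤ φ(x x⋆)`. -/
theorem lscRegularization_star_mul_le {S : Set A} (hS : Dense S)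
    (hinv : ∀ v ∈ S, ‖v‖ ≤ 1 → ∀ a, 0 ≤ a → φ (v * a * star v) ≤ φ a) (x : A) :
    lscRegularization φ (star x * x) ≤ φ (x * star x) := by
  refine orderLsc_lscRegularization.le_of_forall (star_mul_self_nonneg x) fun δ hδ => ?_
  set T := x * star x with hT
  have hT0 : 0 ≤ T := mul_star_self_nonneg x
  obtain ⟨w, hw, hxw⟩ := exists_contraction_conj x (half_pos hδ)
  -- Replacing `w` by `v` costs at most `2 η ‖T‖ ≤ δ/2`; the other half of `δ` is spent on the
  -- contraction `w`.
  set η : ℝ := δ / (4 * (‖T‖ + 1)) with hη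
  have hη0 : 0 < η := by positivity
  obtain ⟨v, hvS, hv, hwv⟩ := exists_mem_contraction_near hS hw hη0
  have hb0 : 0 ≤ v * T * star v := star_right_conjugate_nonneg hT0 v
  refine ⟨v * T * star v, hb0, ?_,
    (lscRegularization_le _ hb0).trans (hinv v hvS hv T hT0)⟩
  have h1 : ‖w * T * star w - v * T * star v‖ ≤ δ / 2 := by
    have h2 : w * T * star w - v * T * star v
        = (w - v) * T * star w + v * T * star (w - v) := by
      rw [star_sub]; noncomm_ring
    have h3 : ‖(w - v) * T * star w‖ ≤ η * ‖T‖ * 1 := by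
      refine (norm_mul_le _ _).trans ?_
      rw [norm_star]
      gcongr
      exact (norm_mul_le _ _).trans (by gcongr)
    have h4 : ‖v * T * star (w - v)‖ ≤ 1 * ‖T‖ * η := by
      refine (norm_mul_le _ _).trans ?_
      rw [norm_star]
      gcongr
      exact (norm_mul_le _ _).trans (by gcongr)
    rw [h2]
    refine (norm_add_le _ _).trans ((add_le_add h3 h4).trans ?_)
    have h5 : η * (‖T‖ + 1) = δ / 4 := by rw [hη]; field_simp
    nlinarith [norm_nonneg T]
  have h6 := le_add_algebraMap_norm_sub
    (IsSelfAdjoint.of_nonneg (star_right_conjugate_nonneg hT0 w)) (IsSelfAdjoint.of_nonneg hb0)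
  have h7 : algebraMap ℝ A ‖w * T * star w - v * T * star v‖ ≤ algebraMap ℝ A (δ / 2) := by
    rw [← sub_nonneg, ← map_sub]
    exact algebraMap_real_nonneg (sub_nonneg.2 h1)
  calc star x * x ≤ w * T * star w + algebraMap ℝ A (δ / 2) := hxw
    _ ≤ v * T * star v + algebraMap ℝ A (δ / 2) + algebraMap ℝ A (δ / 2) := by
      gcongr; exact h6.trans (by gcongr)
    _ = v * T * star v + algebraMap ℝ A δ := by
      rw [add_assoc, ← map_add, add_halves]

theorem sqrt_mul_sqrt {a : A} (ha : 0 ≤ a) : CFC.sqrt a * CFC.sqrt a = a :=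
  CFC.sqrt_mul_sqrt_self a ha

theorem star_sqrt (a : A) : star (CFC.sqrt a) = CFC.sqrt a :=
  (IsSelfAdjoint.of_nonneg (CFC.sqrt_nonneg a)).star_eq

/-- Only superadditivity needs an argument. Duality gives `c` with `a + b ≤ c + δ` and `φ(c)` almost
at most `τ(a + b)`. Put `G = (c/(c+δ))^{1/2}`. Up to `δ`, `a` and `b` lie below `a^{1/2}G²a^{1/2}`
and `b^{1/2}G²b^{1/2}`, whose `τ`-values are at most `φ(GaG)` and `φ(GbG)` by the exchange
inequality; and these add up to `φ(G(a+b)G) ≤ φ(c)`. -/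
theorem isWeight_lscRegularization {S : Set A} (hS : Dense S) (hφ : IsWeight φ)
    (hinv : ∀ v ∈ S, ‖v‖ ≤ 1 → ∀ a, 0 ≤ a → φ (v * a * star v) ≤ φ a) :
    IsWeight (lscRegularization φ) where
  map_zero := lscRegularization_zero
  map_smul r a hr _ := lscRegularization_smul hr a
  map_add a b ha hb := by
    refine le_antisymm lscRegularization_add_le ?_
    have hab : 0 ≤ a + b := add_nonneg ha hb
    rcases eq_or_ne (lscRegularization φ a) 0 with h0 | ha0
    · rw [h0, zero_add]
      exact orderLsc_lscRegularization.mono hb (le_add_of_nonneg_left ha)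
    rcases eq_or_ne (lscRegularization φ b) 0 with h0 | hb0
    · rw [h0, add_zero]
      exact orderLsc_lscRegularization.mono ha (le_add_of_nonneg_right hb)
    refine le_of_forall_lt fun z hz => ?_
    obtain ⟨s₁, hs₁, s₂, hs₂, hz⟩ := ENNReal.exists_lt_add_of_lt_add hz ha0 hb0
    refine hz.trans_le ?_
    by_cases htop : lscRegularization φ (a + b) = ⊤
    · rw [htop]; exact le_top
    set t := (lscRegularization φ (a + b)).toReal with ht
    have ht' : lscRegularization φ (a + b) = ENNReal.ofReal t := (ENNReal.ofReal_toReal htop).symm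
    have ht0 : 0 ≤ t := ENNReal.toReal_nonneg
    refine ENNReal.le_of_forall_pos_le_add fun ε hε _ => ?_
    -- The tolerance `δ` is fixed by semicontinuity at `a` and at `b` before `c` is chosen: the loss
    -- of `δ` must keep the values above `s₁` and `s₂`.
    obtain ⟨δ₁, hδ₁, H₁⟩ := orderLsc_lscRegularization a ha s₁ hs₁
    obtain ⟨δ₂, hδ₂, H₂⟩ := orderLsc_lscRegularization b hb s₂ hs₂
    set δ := min δ₁ δ₂ with hδ
    have hδ0 : 0 < δ := lt_min hδ₁ hδ₂
    obtain ⟨c, hc, habc, hcφ⟩ := exists_le_add_of_lscRegularization_le hφ hab ht0 ht'.le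
      (NNReal.coe_pos.2 hε) hδ0
    have key : ∀ d, 0 ≤ d → d ≤ a + b → d ≤ star (cutRoot c δ * CFC.sqrt d)
        * (cutRoot c δ * CFC.sqrt d) + algebraMap ℝ A δ := by
      intro d hd hdab
      have h1 := star_mul_le_cutRoot (x := CFC.sqrt d) hc hδ0 (by
        rw [star_sqrt, sqrt_mul_sqrt hd]; exact hdab.trans habc)
      rwa [star_sqrt, sqrt_mul_sqrt hd] at h1
    have key2 : ∀ d, 0 ≤ d → (cutRoot c δ * CFC.sqrt d) * star (cutRoot c δ * CFC.sqrt d)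
        = cutRoot c δ * d * cutRoot c δ := by
      intro d hd
      rw [star_mul, star_sqrt, (isSelfAdjoint_cutRoot c δ).star_eq]
      conv_rhs => rw [← sqrt_mul_sqrt hd]
      noncomm_ring
    have mono : ∀ {r s : ℝ}, r ≤ s → algebraMap ℝ A r ≤ algebraMap ℝ A s := fun h => by
      rw [← sub_nonneg, ← map_sub]; exact algebraMap_real_nonneg (sub_nonneg.2 h)
    have h1 := H₁ _ (star_mul_self_nonneg _) ((key a ha (le_add_of_nonneg_right hb)).trans
      (add_le_add le_rfl (mono (min_le_left _ _))))
    have h2 := H₂ _ (star_mul_self_nonneg _) ((key b hb (le_add_of_nonneg_left ha)).trans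
      (add_le_add le_rfl (mono (min_le_right _ _))))
    have h3 := h1.le.trans (lscRegularization_star_mul_le hS hinv _)
    have h4 := h2.le.trans (lscRegularization_star_mul_le hS hinv _)
    rw [key2 a ha] at h3
    rw [key2 b hb] at h4
    have hG := isSelfAdjoint_cutRoot c δ
    calc s₁ + s₂ ≤ φ (cutRoot c δ * a * cutRoot c δ) + φ (cutRoot c δ * b * cutRoot c δ) :=
          add_le_add h3 h4
      _ = φ (cutRoot c δ * (a + b) * cutRoot c δ) := by
          rw [← hφ.map_add _ _ (hG.conjugate_nonneg ha) (hG.conjugate_nonneg hb)]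
          congr 1; noncomm_ring
      _ ≤ φ c := hφ.mono (hG.conjugate_nonneg hab) (cutRoot_conj_le hc hδ0 habc)
      _ ≤ ENNReal.ofReal (t + ε) := hcφ
      _ = lscRegularization φ (a + b) + ε := by
          rw [ENNReal.ofReal_add ht0 ε.coe_nonneg, ← ht']; simp

/-- Duality upgrades `τ(x⋆x) ≤ φ(xx⋆)`: if `xx⋆ ≤ c + δ` with `φ(c)` almost at most `τ(xx⋆)`, then
`x⋆x` is dominated up to `δ` by `(Gx)⋆(Gx)`, whose `τ`-value is at most `φ(G xx⋆ G) ≤ φ(c)`. -/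
theorem lscRegularization_star_mul_eq {S : Set A} (hS : Dense S) (hφ : IsWeight φ)
    (hinv : ∀ v ∈ S, ‖v‖ ≤ 1 → ∀ a, 0 ≤ a → φ (v * a * star v) ≤ φ a) (x : A) :
    lscRegularization φ (star x * x) = lscRegularization φ (x * star x) := by
  have key : ∀ x : A, lscRegularization φ (star x * x) ≤ lscRegularization φ (x * star x) := by
    intro x
    by_cases htop : lscRegularization φ (x * star x) = ⊤
    · rw [htop]; exact le_top
    set t := (lscRegularization φ (x * star x)).toReal with ht
    have ht' : lscRegularization φ (x * star x) = ENNReal.ofReal t :=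
      (ENNReal.ofReal_toReal htop).symm
    have ht0 : 0 ≤ t := ENNReal.toReal_nonneg
    refine ENNReal.le_of_forall_pos_le_add fun ε hε _ => ?_
    refine orderLsc_lscRegularization.le_of_forall (star_mul_self_nonneg x) fun δ hδ => ?_
    obtain ⟨c, hc, hxc, hcφ⟩ := exists_le_add_of_lscRegularization_le hφ (mul_star_self_nonneg x)
      ht0 ht'.le (NNReal.coe_pos.2 hε) hδ
    refine ⟨_, star_mul_self_nonneg _, star_mul_le_cutRoot hc hδ hxc, ?_⟩
    refine (lscRegularization_star_mul_le hS hinv _).trans ?_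
    have h1 : cutRoot c δ * x * star (cutRoot c δ * x)
        = cutRoot c δ * (x * star x) * cutRoot c δ := by
      rw [star_mul, (isSelfAdjoint_cutRoot c δ).star_eq]; noncomm_ring
    calc φ (cutRoot c δ * x * star (cutRoot c δ * x)) ≤ φ c := by
          refine hφ.mono (mul_star_self_nonneg _) ?_
          rw [h1]
          exact cutRoot_conj_le hc hδ hxc
      _ ≤ ENNReal.ofReal (t + ε) := hcφ
      _ = _ := by rw [ENNReal.ofReal_add ht0 ε.coe_nonneg, ← ht']; simp
  refine le_antisymm (key x) ?_
  have := key (star x)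
  rwa [star_star] at this

/-! ### The semifinite regularization -/

theorem semifiniteRegularization_le (hτ : IsWeight τ) {a : A} :
    semifiniteRegularization τ a ≤ τ a := by
  refine sSup_le ?_
  rintro _ ⟨b, ⟨⟨hb, -⟩, hba⟩, rfl⟩
  exact hτ.mono hb hba

theorem le_semifiniteRegularization {a b : A} (hb : b ∈ finiteCone τ) (hba : b ≤ a) :
    τ b ≤ semifiniteRegularization τ a :=
  le_sSup ⟨b, ⟨hb, hba⟩, rfl⟩

theorem semifiniteRegularization_of_mem (hτ : IsWeight τ) {a : A} (ha : a ∈ finiteCone τ) :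
    semifiniteRegularization τ a = τ a :=
  le_antisymm (semifiniteRegularization_le hτ) (le_semifiniteRegularization ha le_rfl)

theorem finiteCone_of_le (hτ : IsWeight τ) {a b : A} (ha : a ∈ finiteCone τ) (hb : 0 ≤ b)
    (hba : b ≤ a) : b ∈ finiteCone τ :=
  ⟨hb, (hτ.mono hb hba).trans_lt ha.2⟩

theorem finiteCone_swap (ht : ∀ x : A, τ (star x * x) = τ (x * star x)) {x : A}
    (hx : star x * x ∈ finiteCone τ) : x * star x ∈ finiteCone τ :=
  ⟨mul_star_self_nonneg x, by rw [← ht]; exact hx.2⟩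

/-- With `G = (h/(h+δ))^{1/2}`, the element `c^{1/2} G² c^{1/2}` inherits finiteness from `c` by
lying below it. If `c ≤ h + δ`, it also differs from `c` by at most `δ`, and its exchanged form `G c
G` lies exactly below `h`. The semifinite regularization is handled through such replacements. -/
theorem star_cutRoot_sqrt_mul_le {h c : A} (hh : 0 ≤ h) (hc : 0 ≤ c) {δ : ℝ} (hδ : 0 < δ) :
    star (cutRoot h δ * CFC.sqrt c) * (cutRoot h δ * CFC.sqrt c) ≤ c := by
  have h1 := star_left_conjugate_le_conjugate (cutRoot_mul_self_le_one hh hδ) (CFC.sqrt c)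
  rw [mul_one, star_sqrt, sqrt_mul_sqrt hc] at h1
  rw [star_mul, star_sqrt, (isSelfAdjoint_cutRoot h δ).star_eq]
  refine le_trans (le_of_eq ?_) h1
  noncomm_ring

theorem le_star_cutRoot_sqrt_mul {h c : A} (hh : 0 ≤ h) (hc : 0 ≤ c) {δ : ℝ} (hδ : 0 < δ)
    (hch : c ≤ h + algebraMap ℝ A δ) :
    c ≤ star (cutRoot h δ * CFC.sqrt c) * (cutRoot h δ * CFC.sqrt c) + algebraMap ℝ A δ := by
  have h1 := star_mul_le_cutRoot (x := CFC.sqrt c) hh hδ (by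
    rwa [star_sqrt, sqrt_mul_sqrt hc])
  rwa [star_sqrt, sqrt_mul_sqrt hc] at h1

/-- If `c ≤ a` has finite `τ` and `a ≤ b + δ`, then `c^{1/2}G²c^{1/2}` still has `τ` above `t`, and
traciality moves this value to `G c G ≤ b`, a competitor in the supremum for `b`. -/
theorem orderLsc_semifiniteRegularization (hτ : IsWeight τ)
    (ht : ∀ x : A, τ (star x * x) = τ (x * star x)) (hl : OrderLsc τ) :
    OrderLsc (semifiniteRegularization τ) := by
  intro a ha t hta
  obtain ⟨_, ⟨c, ⟨hc, hca⟩, rfl⟩, htc⟩ := lt_sSup_iff.1 hta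
  obtain ⟨δ, hδ, H⟩ := hl c hc.1 t htc
  refine ⟨δ, hδ, fun b hb hab => ?_⟩
  have hcb := hca.trans hab
  have h1 := H _ (star_mul_self_nonneg _) (le_star_cutRoot_sqrt_mul hb hc.1 hδ hcb)
  have h2 := finiteCone_of_le hτ hc (star_mul_self_nonneg _)
    (star_cutRoot_sqrt_mul_le hb hc.1 hδ)
  rw [ht] at h1
  refine h1.trans_le (le_semifiniteRegularization (finiteCone_swap ht h2) ?_)
  rw [star_mul, star_sqrt, (isSelfAdjoint_cutRoot b δ).star_eq]
  have h3 := cutRoot_conj_le hb hδ hcb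
  rw [← sqrt_mul_sqrt hc.1] at h3
  refine le_trans (le_of_eq ?_) h3
  noncomm_ring

/-- A competitor `c ≤ h = x⋆x` is transported to `xx⋆` by `y = c^{1/2}(h+δ)^{-1/2}x⋆`: here `yy⋆ =
c^{1/2} h(h+δ)⁻¹ c^{1/2}` is `c` up to `δ`, and `y⋆y = x (h+δ)^{-1/2} c (h+δ)^{-1/2} x⋆ ≤ xx⋆`. -/
theorem semifiniteRegularization_star_mul_eq (hτ : IsWeight τ)
    (ht : ∀ x : A, τ (star x * x) = τ (x * star x)) (hl : OrderLsc τ) (x : A) :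
    semifiniteRegularization τ (star x * x) = semifiniteRegularization τ (x * star x) := by
  have key : ∀ x : A,
      semifiniteRegularization τ (star x * x) ≤ semifiniteRegularization τ (x * star x) := by
    intro x
    refine sSup_le ?_
    rintro _ ⟨c, ⟨hc, hca⟩, rfl⟩
    refine hl.le_of_forall hc.1 fun δ hδ => ?_
    set h := star x * x with hh
    have hh0 : 0 ≤ h := star_mul_self_nonneg x
    have hch : c ≤ h + algebraMap ℝ A δ :=
      hca.trans (le_add_of_nonneg_right (algebraMap_real_nonneg hδ.le))
    set P := invRoot h δ with hP
    have hPs : star P = P := isSelfAdjoint_invRoot h δ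
    set y := CFC.sqrt c * P * star x with hy
    have h1 : y * star y
        = star (cutRoot h δ * CFC.sqrt c) * (cutRoot h δ * CFC.sqrt c) := by
      have h2 := invRoot_conj hh0 hδ
      rw [← hP] at h2
      rw [hy, star_mul, star_mul, star_mul, star_star, star_sqrt, hPs,
        (isSelfAdjoint_cutRoot h δ).star_eq]
      calc CFC.sqrt c * P * star x * (x * (P * CFC.sqrt c))
          = CFC.sqrt c * (P * (star x * x) * P) * CFC.sqrt c := by noncomm_ring
        _ = _ := by rw [← hh, h2]; noncomm_ring
    have h3 : star y * y ≤ x * star x := by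
      have h4 := star_right_conjugate_le_conjugate (invRoot_conj_le_one hh0 hδ hch) x
      rw [mul_one, ← hP, ← sqrt_mul_sqrt hc.1] at h4
      refine le_trans (le_of_eq ?_) h4
      rw [hy, star_mul, star_mul, star_star, star_sqrt, hPs]
      noncomm_ring
    have h5 : y * star y ∈ finiteCone τ := finiteCone_of_le hτ hc (mul_star_self_nonneg _)
      (h1.trans_le (star_cutRoot_sqrt_mul_le hh0 hc.1 hδ))
    refine ⟨y * star y, mul_star_self_nonneg _, ?_, ?_⟩
    · rw [h1]
      exact le_star_cutRoot_sqrt_mul hh0 hc.1 hδ hch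
    · rw [← ht]
      refine le_semifiniteRegularization ?_ h3
      have := finiteCone_swap (x := star y) ht (by rwa [star_star])
      rwa [star_star] at this
  refine le_antisymm (key x) ?_
  have := key (star x)
  rwa [star_star] at this

/-- Superadditivity is immediate, as competitors for `a` and `b` add up. Subadditivity needs a
decomposition of `c ≤ h = a + b`: with `x_d = d^{1/2}(h+δ)^{-1/2}c^{1/2}`, the sum of `x_a⋆x_a` and
`x_b⋆x_b` is `c` up to `δ`, while `x_d x_d⋆ ≤ d`, so that traciality sends the two pieces below `a`
and `b`. -/
theorem isWeight_semifiniteRegularization (hτ : IsWeight τ)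
    (ht : ∀ x : A, τ (star x * x) = τ (x * star x)) (hl : OrderLsc τ) :
    IsWeight (semifiniteRegularization τ) := by
  have hzero : (0 : A) ∈ finiteCone τ := ⟨le_rfl, by rw [hτ.map_zero]; exact ENNReal.zero_lt_top⟩
  have hl' := orderLsc_semifiniteRegularization hτ ht hl
  refine ⟨(semifiniteRegularization_of_mem hτ hzero).trans hτ.map_zero, ?_, ?_⟩
  · intro a b ha hb
    refine le_antisymm (sSup_le ?_) ?_
    · rintro _ ⟨c, ⟨hc, hca⟩, rfl⟩
      refine hl.le_of_forall hc.1 fun δ hδ => ?_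
      set h := a + b with hh
      have hh0 : 0 ≤ h := add_nonneg ha hb
      have hch : c ≤ h + algebraMap ℝ A δ :=
        hca.trans (le_add_of_nonneg_right (algebraMap_real_nonneg hδ.le))
      set P := invRoot h δ with hP
      have hPs : star P = P := isSelfAdjoint_invRoot h δ
      set x : A → A := fun d => CFC.sqrt d * P * CFC.sqrt c with hx
      have h1 : ∀ d, 0 ≤ d → star (x d) * x d = CFC.sqrt c * (P * d * P) * CFC.sqrt c := by
        intro d hd
        rw [hx]
        simp only
        rw [star_mul, star_mul, star_sqrt, star_sqrt, hPs]
        conv_rhs => rw [← sqrt_mul_sqrt hd]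
        noncomm_ring
      have h2 : star (x a) * x a + star (x b) * x b
          = star (cutRoot h δ * CFC.sqrt c) * (cutRoot h δ * CFC.sqrt c) := by
        have h2 := invRoot_conj hh0 hδ
        rw [← hP] at h2
        rw [h1 a ha, h1 b hb, star_mul, star_sqrt, (isSelfAdjoint_cutRoot h δ).star_eq]
        calc CFC.sqrt c * (P * a * P) * CFC.sqrt c + CFC.sqrt c * (P * b * P) * CFC.sqrt c
            = CFC.sqrt c * (P * (a + b) * P) * CFC.sqrt c := by noncomm_ring
          _ = _ := by rw [← hh, h2]; noncomm_ring
      have h3 : star (x a) * x a + star (x b) * x b ≤ c :=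
        h2.trans_le (star_cutRoot_sqrt_mul_le hh0 hc.1 hδ)
      have h4 : ∀ d, 0 ≤ d → star (x d) * x d ≤ c → τ (star (x d) * x d)
          ≤ semifiniteRegularization τ d := by
        intro d hd hdc
        rw [ht]
        refine le_semifiniteRegularization
          (finiteCone_swap ht (finiteCone_of_le hτ hc (star_mul_self_nonneg _) hdc)) ?_
        have h4 := star_right_conjugate_le_conjugate (invRoot_conj_le_one hh0 hδ hch) (CFC.sqrt d)
        rw [mul_one, ← hP, ← sqrt_mul_sqrt hc.1, star_sqrt, sqrt_mul_sqrt hd] at h4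
        refine le_trans (le_of_eq ?_) h4
        rw [hx]
        simp only
        rw [star_mul, star_mul, star_sqrt, star_sqrt, hPs]
        noncomm_ring
      refine ⟨_, add_nonneg (star_mul_self_nonneg (x a)) (star_mul_self_nonneg (x b)), ?_, ?_⟩
      · rw [h2]
        exact le_star_cutRoot_sqrt_mul hh0 hc.1 hδ hch
      · rw [hτ.map_add _ _ (star_mul_self_nonneg _) (star_mul_self_nonneg _)]
        exact add_le_add
          (h4 a ha ((le_add_of_nonneg_right (star_mul_self_nonneg _)).trans h3))
          (h4 b hb ((le_add_of_nonneg_left (star_mul_self_nonneg _)).trans h3))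
    · rcases eq_or_ne (semifiniteRegularization τ a) 0 with h0 | ha0
      · rw [h0, zero_add]
        exact hl'.mono hb (le_add_of_nonneg_left ha)
      rcases eq_or_ne (semifiniteRegularization τ b) 0 with h0 | hb0
      · rw [h0, add_zero]
        exact hl'.mono ha (le_add_of_nonneg_right hb)
      refine le_of_forall_lt fun z hz => ?_
      obtain ⟨s₁, hs₁, s₂, hs₂, hz⟩ := ENNReal.exists_lt_add_of_lt_add hz ha0 hb0
      obtain ⟨_, ⟨c, ⟨hc, hca⟩, rfl⟩, hsc⟩ := lt_sSup_iff.1 hs₁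
      obtain ⟨_, ⟨d, ⟨hd, hdb⟩, rfl⟩, hsd⟩ := lt_sSup_iff.1 hs₂
      refine hz.trans_le ((add_le_add hsc.le hsd.le).trans ?_)
      rw [← hτ.map_add c d hc.1 hd.1]
      refine le_semifiniteRegularization ⟨add_nonneg hc.1 hd.1, ?_⟩ (add_le_add hca hdb)
      rw [hτ.map_add c d hc.1 hd.1]
      exact ENNReal.add_lt_top.2 ⟨hc.2, hd.2⟩
  · have key : ∀ (r : ℝ) (a : A), 0 < r → 0 ≤ a →
        ENNReal.ofReal r * semifiniteRegularization τ a
          ≤ semifiniteRegularization τ ((r : ℂ) • a) := by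
      intro r a hr ha
      rw [semifiniteRegularization, ENNReal.mul_sSup]
      refine iSup₂_le ?_
      rintro _ ⟨c, ⟨hc, hca⟩, rfl⟩
      rw [← hτ.map_smul r c hr hc.1]
      refine le_semifiniteRegularization ⟨coe_smul_nonneg hr.le hc.1, ?_⟩ ?_
      · rw [hτ.map_smul r c hr hc.1]
        exact ENNReal.mul_lt_top ENNReal.ofReal_lt_top hc.2
      · rw [Complex.coe_smul, Complex.coe_smul]
        exact smul_le_smul_of_nonneg_left hca hr.le
    intro r a hr ha
    refine le_antisymm ?_ (key r a hr ha)
    have h1 := key r⁻¹ ((r : ℂ) • a) (by positivity) (coe_smul_nonneg hr.le ha)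
    have h2 : ((r⁻¹ : ℝ) : ℂ) • (r : ℂ) • a = a := by
      rw [smul_smul, ← Complex.ofReal_mul, inv_mul_cancel₀ hr.ne', Complex.ofReal_one, one_smul]
    rw [h2] at h1
    calc semifiniteRegularization τ ((r : ℂ) • a)
        = ENNReal.ofReal r * (ENNReal.ofReal r⁻¹ * semifiniteRegularization τ ((r : ℂ) • a)) := by
          rw [← mul_assoc, ← ENNReal.ofReal_mul hr.le, mul_inv_cancel₀ hr.ne', ENNReal.ofReal_one,
            one_mul]
      _ ≤ _ := by gcongr

/-- The regularization agrees with `τ` where `τ` is finite, so every competitor for `τ` is a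
competitor of the same value for the regularization. -/
theorem isSemifinite_semifiniteRegularization (hτ : IsWeight τ)
    (ht : ∀ x : A, τ (star x * x) = τ (x * star x)) (hl : OrderLsc τ) :
    IsSemifinite (semifiniteRegularization τ) := by
  intro a ha
  constructor
  · rintro _ ⟨b, ⟨hb, hba⟩, rfl⟩
    exact (orderLsc_semifiniteRegularization hτ ht hl).mono hb.1 hba
  · intro u hu
    refine sSup_le ?_
    rintro _ ⟨c, ⟨hc, hca⟩, rfl⟩
    have h1 := semifiniteRegularization_of_mem hτ hc
    rw [← h1]
    exact hu ⟨c, ⟨⟨hc.1, h1.trans_lt hc.2⟩, hca⟩, rfl⟩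

end Regularization

/-! ### Traces and their linear extension -/

section Extension

variable {A : Type*} [CStarAlgebra A] [PartialOrder A] [StarOrderedRing A] {τ : A → ℝ≥0∞}

theorem IsWeight.map_smul_of_nonneg (hτ : IsWeight τ) {r : ℝ} (hr : 0 ≤ r) {a : A} (ha : 0 ≤ a) :
    τ ((r : ℂ) • a) = ENNReal.ofReal r * τ a := by
  rcases hr.eq_or_lt with rfl | hr
  · simp [hτ.map_zero]
  · exact hτ.map_smul r a hr ha

theorem IsWeight.map_sum (hτ : IsWeight τ) {ι : Type*} (s : Finset ι) (f : ι → A)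
    (hf : ∀ i ∈ s, 0 ≤ f i) : τ (∑ i ∈ s, f i) = ∑ i ∈ s, τ (f i) := by
  classical
  induction s using Finset.induction_on with
  | empty => simp [hτ.map_zero]
  | insert i s his ih =>
    rw [Finset.sum_insert his, Finset.sum_insert his, hτ.map_add, ih]
    · exact fun j hj => hf j (Finset.mem_insert_of_mem hj)
    · exact hf i (Finset.mem_insert_self i s)
    · exact Finset.sum_nonneg fun j hj => hf j (Finset.mem_insert_of_mem hj)

theorem IsWeight.toReal_sum_smul (hτ : IsWeight τ) (s : Finset (finiteCone τ))
    (r : finiteCone τ → ℝ) (hr : ∀ i, 0 ≤ r i) :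
    (τ (∑ i ∈ s, (r i : ℂ) • (i : A))).toReal = ∑ i ∈ s, r i * (τ i).toReal := by
  rw [hτ.map_sum s _ fun i _ => coe_smul_nonneg (hr i) i.2.1, ENNReal.toReal_sum]
  · refine Finset.sum_congr rfl fun i _ => ?_
    rw [hτ.map_smul_of_nonneg (hr i) i.2.1, ENNReal.toReal_mul, ENNReal.toReal_ofReal (hr i)]
  · intro i _
    rw [hτ.map_smul_of_nonneg (hr i) i.2.1]
    exact ENNReal.mul_ne_top ENNReal.ofReal_ne_top i.2.2.ne

/-- A weight is additive on positive combinations only, so the relation is rewritten as an equality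
between the sums over the positive and the negative parts of the coefficients. -/
theorem IsWeight.sum_eq_zero_of_real (hτ : IsWeight τ) (s : Finset (finiteCone τ))
    (r : finiteCone τ → ℝ) (h : ∑ i ∈ s, (r i : ℂ) • (i : A) = 0) :
    ∑ i ∈ s, r i * (τ i).toReal = 0 := by
  have h1 : ∑ i ∈ s, ((max (r i) 0 : ℝ) : ℂ) • (i : A)
      = ∑ i ∈ s, ((max (-r i) 0 : ℝ) : ℂ) • (i : A) := by
    rw [← sub_eq_zero, ← Finset.sum_sub_distrib, ← h]
    refine Finset.sum_congr rfl fun i _ => ?_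
    rw [← sub_smul, ← Complex.ofReal_sub]
    congr 2
    rcases le_total 0 (r i) with h0 | h0
    · rw [max_eq_left h0, max_eq_right (by linarith)]; ring
    · rw [max_eq_right h0, max_eq_left (by linarith)]; ring
  have h2 := congrArg (fun a => (τ a).toReal) h1
  rw [hτ.toReal_sum_smul s _ fun i => le_max_right _ _,
    hτ.toReal_sum_smul s _ fun i => le_max_right _ _, ← sub_eq_zero,
    ← Finset.sum_sub_distrib] at h2
  rw [← h2]
  refine Finset.sum_congr rfl fun i _ => ?_
  rw [← sub_mul]
  congr 1
  rcases le_total 0 (r i) with h0 | h0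
  · rw [max_eq_left h0, max_eq_right (by linarith)]; ring
  · rw [max_eq_right h0, max_eq_left (by linarith)]; ring

/-- The elements of the cone are self-adjoint: the adjoint of a relation has the conjugate
coefficients, which separates real and imaginary parts. -/
theorem IsWeight.sum_eq_zero (hτ : IsWeight τ) (s : Finset (finiteCone τ))
    (f : finiteCone τ → ℂ) (h : ∑ i ∈ s, f i • (i : A) = 0) :
    ∑ i ∈ s, f i * ((τ i).toReal : ℂ) = 0 := by
  have hsa : ∀ i : finiteCone τ, star (i : A) = i := fun i =>
    (IsSelfAdjoint.of_nonneg i.2.1).star_eq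
  have hstar : ∑ i ∈ s, (starRingEnd ℂ (f i)) • (i : A) = 0 := by
    have := congrArg star h
    rw [star_sum, star_zero] at this
    rw [← this]
    refine Finset.sum_congr rfl fun i _ => ?_
    rw [star_smul, hsa]; rfl
  have hre : ∑ i ∈ s, ((f i).re : ℂ) • (i : A) = 0 := by
    have h1 : (2 : ℂ)⁻¹ • (∑ i ∈ s, f i • (i : A) + ∑ i ∈ s, (starRingEnd ℂ (f i)) • (i : A)) = 0 := by
      rw [h, hstar, add_zero, smul_zero]
    rw [← h1, ← Finset.sum_add_distrib, Finset.smul_sum]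
    refine Finset.sum_congr rfl fun i _ => ?_
    rw [← add_smul, smul_smul, Complex.add_conj]
    congr 1
    push_cast; ring
  have him : ∑ i ∈ s, ((f i).im : ℂ) • (i : A) = 0 := by
    have h1 : (2 * Complex.I)⁻¹ • (∑ i ∈ s, f i • (i : A)
        - ∑ i ∈ s, (starRingEnd ℂ (f i)) • (i : A)) = 0 := by
      rw [h, hstar, sub_zero, smul_zero]
    rw [← h1, ← Finset.sum_sub_distrib, Finset.smul_sum]
    refine Finset.sum_congr rfl fun i _ => ?_
    rw [← sub_smul, smul_smul, Complex.sub_conj]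
    congr 1
    have := Complex.I_ne_zero
    push_cast; field_simp
  have h1 := hτ.sum_eq_zero_of_real s _ hre
  have h2 := hτ.sum_eq_zero_of_real s _ him
  apply Complex.ext
  · simpa using h1
  · simpa using h2

/-- `J` is the image of the free vector space on `J₊`, and the linear functional given there by `τ`
descends because it kills every relation. -/
theorem IsWeight.exists_linearExtension (hτ : IsWeight τ) :
    ∃ t : finiteSpan τ →ₗ[ℂ] ℂ, IsLinearExtension τ t := by
  let L : (finiteCone τ →₀ ℂ) →ₗ[ℂ] A := Finsupp.linearCombination ℂ (Subtype.val)
  let N : (finiteCone τ →₀ ℂ) →ₗ[ℂ] ℂ :=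
    Finsupp.linearCombination ℂ fun i => ((τ (i : A)).toReal : ℂ)
  have hLN : LinearMap.ker L ≤ LinearMap.ker N := by
    intro f hf
    rw [LinearMap.mem_ker] at hf ⊢
    simp only [L, N, Finsupp.linearCombination_apply, Finsupp.sum] at hf ⊢
    exact hτ.sum_eq_zero f.support f hf
  have hrange : finiteSpan τ = LinearMap.range L := by
    rw [Finsupp.range_linearCombination, Subtype.range_coe]; rfl
  let t : finiteSpan τ →ₗ[ℂ] ℂ := (Submodule.liftQ _ N hLN).comp
    ((L.quotKerEquivRange.symm.toLinearMap).comp (LinearEquiv.ofEq _ _ hrange).toLinearMap)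
  refine ⟨t, fun a ha => ?_⟩
  have h1 : LinearEquiv.ofEq _ _ hrange ⟨a, Submodule.subset_span ha⟩
      = L.quotKerEquivRange (Submodule.Quotient.mk (Finsupp.single ⟨a, ha⟩ 1)) := by
    apply Subtype.ext
    rw [LinearMap.quotKerEquivRange_apply_mk]
    simp [L]
  change Submodule.liftQ _ N hLN (L.quotKerEquivRange.symm (LinearEquiv.ofEq _ _ hrange _)) = _
  rw [h1, LinearEquiv.symm_apply_apply]
  change N _ = _
  simp [N]

/-- The left ideal of the `x` with `τ(x⋆ x) < ∞`. -/
def SqFinite (τ : A → ℝ≥0∞) (x : A) : Prop := star x * x ∈ finiteCone τ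

variable (hτ : IsWeight τ) (ht : ∀ x : A, τ (star x * x) = τ (x * star x))

-- By the parallelogram identity, `(x+y)⋆(x+y)` is at most `2(x⋆x + y⋆y)`.
include hτ in
theorem SqFinite.add {x y : A} (hx : SqFinite τ x) (hy : SqFinite τ y) : SqFinite τ (x + y) := by
  have h1 : star (x + y) * (x + y) + star (x - y) * (x - y)
      = ((2 : ℝ) : ℂ) • (star x * x + star y * y) := by
    have h2 : ((2 : ℝ) : ℂ) • (star x * x + star y * y)
        = (star x * x + star y * y) + (star x * x + star y * y) := by
      push_cast; rw [two_smul]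
    rw [h2, star_add, star_sub]; noncomm_ring
  have h3 : ((2 : ℝ) : ℂ) • (star x * x + star y * y) ∈ finiteCone τ := by
    have h0 : 0 ≤ star x * x + star y * y := add_nonneg hx.1 hy.1
    refine ⟨coe_smul_nonneg zero_le_two h0, ?_⟩
    rw [hτ.map_smul 2 _ two_pos h0, hτ.map_add _ _ hx.1 hy.1]
    exact ENNReal.mul_lt_top ENNReal.ofReal_lt_top (ENNReal.add_lt_top.2 ⟨hx.2, hy.2⟩)
  refine finiteCone_of_le hτ h3 (star_mul_self_nonneg _) ?_
  rw [← h1]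
  exact le_add_of_nonneg_right (star_mul_self_nonneg _)

-- Because `x⋆(b⋆b)x ≤ ‖b‖² x⋆x`. Traciality later makes this left ideal self-adjoint, hence
-- two-sided.
include hτ in
theorem SqFinite.mul_left {x : A} (hx : SqFinite τ x) (b : A) : SqFinite τ (b * x) := by
  have h1 : star x * (star b * b) * x ≤ star x * (algebraMap ℝ A (‖b‖ ^ 2)) * x :=
    star_left_conjugate_le_conjugate CStarAlgebra.star_mul_le_algebraMap_norm_sq x
  have h2 : star x * (algebraMap ℝ A (‖b‖ ^ 2)) * x = ((‖b‖ ^ 2 : ℝ) : ℂ) • (star x * x) := by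
    rw [algebraMap_real_eq_smul, mul_smul_comm, mul_one, smul_mul_assoc]
  have h3 : ((‖b‖ ^ 2 : ℝ) : ℂ) • (star x * x) ∈ finiteCone τ := by
    refine ⟨coe_smul_nonneg (by positivity) hx.1, ?_⟩
    rw [hτ.map_smul_of_nonneg (by positivity) hx.1]
    exact ENNReal.mul_lt_top ENNReal.ofReal_lt_top hx.2
  refine finiteCone_of_le hτ h3 (star_mul_self_nonneg _) ?_
  rw [← h2]
  refine le_trans (le_of_eq ?_) h1
  rw [star_mul]; noncomm_ring

include hτ in
theorem SqFinite.smul {x : A} (hx : SqFinite τ x) (c : ℂ) : SqFinite τ (c • x) := by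
  have := hx.mul_left hτ (algebraMap ℂ A c)
  rwa [← Algebra.smul_def] at this

include ht in
theorem SqFinite.adjoint {x : A} (hx : SqFinite τ x) : SqFinite τ (star x) := by
  have := finiteCone_swap ht hx
  rw [SqFinite, star_star]
  exact this

include hτ ht in
theorem SqFinite.mul_right {x : A} (hx : SqFinite τ x) (b : A) : SqFinite τ (x * b) := by
  have := ((hx.adjoint ht).mul_left hτ (star b)).adjoint ht
  rwa [star_mul, star_star, star_star] at this

/-- The companion `polarization_swap` has the same coefficients and the same four vectors with each
square `y⋆y` reversed. Hence an identity between `y⋆y` and `yy⋆` passes to one between `x⋆z` and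
`zx⋆`. -/
theorem polarization (x z : A) : star x * z = (4 : ℂ)⁻¹ • (star (x + z) * (x + z)
    - star (x - z) * (x - z) - Complex.I • (star (x + Complex.I • z) * (x + Complex.I • z))
    + Complex.I • (star (x - Complex.I • z) * (x - Complex.I • z))) := by
  simp only [star_add, star_sub, star_smul, Complex.star_def, Complex.conj_I, mul_add, add_mul,
    mul_sub, sub_mul, smul_add, smul_sub, smul_mul_assoc, mul_smul_comm, smul_smul,
    neg_smul, neg_mul, Complex.I_mul_I, smul_neg]
  module

theorem polarization_swap (x z : A) : z * star x = (4 : ℂ)⁻¹ • ((x + z) * star (x + z)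
    - (x - z) * star (x - z) - Complex.I • ((x + Complex.I • z) * star (x + Complex.I • z))
    + Complex.I • ((x - Complex.I • z) * star (x - Complex.I • z))) := by
  simp only [star_add, star_sub, star_smul, Complex.star_def, Complex.conj_I, mul_add, add_mul,
    mul_sub, sub_mul, smul_add, smul_sub, smul_mul_assoc, mul_smul_comm, smul_smul,
    mul_neg, neg_smul, Complex.I_mul_I, smul_neg]
  module

include hτ in
theorem SqFinite.sub {x y : A} (hx : SqFinite τ x) (hy : SqFinite τ y) : SqFinite τ (x - y) := by
  have := hx.add hτ (hy.smul hτ (-1))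
  rwa [neg_one_smul, ← sub_eq_add_neg] at this

include hτ in
theorem SqFinite.star_mul_mem {x z : A} (hx : SqFinite τ x) (hz : SqFinite τ z) :
    star x * z ∈ finiteSpan τ := by
  have hI := hz.smul hτ Complex.I
  have hsub : ∀ y, SqFinite τ y → star y * y ∈ finiteSpan τ := fun y hy =>
    Submodule.subset_span hy
  rw [polarization]
  exact Submodule.smul_mem _ _ (Submodule.add_mem _ (Submodule.sub_mem _ (Submodule.sub_mem _
    (hsub _ (hx.add hτ hz)) (hsub _ (hx.sub hτ hz)))
    (Submodule.smul_mem _ _ (hsub _ (hx.add hτ hI))))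
    (Submodule.smul_mem _ _ (hsub _ (hx.sub hτ hI))))

include ht in
theorem IsLinearExtension.map_star_mul {t : finiteSpan τ →ₗ[ℂ] ℂ} (hext : IsLinearExtension τ t)
    {y : A} (hy : SqFinite τ y) (h1 : star y * y ∈ finiteSpan τ) (h2 : y * star y ∈ finiteSpan τ) :
    t ⟨star y * y, h1⟩ = t ⟨y * star y, h2⟩ := by
  rw [hext _ hy, hext _ (finiteCone_swap ht hy), ht]

include hτ ht in
theorem IsLinearExtension.map_mul_comm {t : finiteSpan τ →ₗ[ℂ] ℂ} (hext : IsLinearExtension τ t)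
    {x z : A} (hx : SqFinite τ x) (hz : SqFinite τ z) (h1 : star x * z ∈ finiteSpan τ)
    (h2 : z * star x ∈ finiteSpan τ) : t ⟨star x * z, h1⟩ = t ⟨z * star x, h2⟩ := by
  have hI := hz.smul hτ Complex.I
  have hsub : ∀ y, SqFinite τ y → star y * y ∈ finiteSpan τ := fun y hy =>
    Submodule.subset_span hy
  have hsub' : ∀ y, SqFinite τ y → y * star y ∈ finiteSpan τ := fun y hy =>
    Submodule.subset_span (finiteCone_swap ht hy)
  have ha := hx.add hτ hz
  have hb := hx.sub hτ hz
  have hc := hx.add hτ hI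
  have hd := hx.sub hτ hI
  have e1 : (⟨star x * z, h1⟩ : finiteSpan τ) = (4 : ℂ)⁻¹ • ((⟨_, hsub _ ha⟩ : finiteSpan τ)
      - ⟨_, hsub _ hb⟩ - Complex.I • ⟨_, hsub _ hc⟩ + Complex.I • ⟨_, hsub _ hd⟩) :=
    Subtype.ext (polarization x z)
  have e2 : (⟨z * star x, h2⟩ : finiteSpan τ) = (4 : ℂ)⁻¹ • ((⟨_, hsub' _ ha⟩ : finiteSpan τ)
      - ⟨_, hsub' _ hb⟩ - Complex.I • ⟨_, hsub' _ hc⟩ + Complex.I • ⟨_, hsub' _ hd⟩) :=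
    Subtype.ext (polarization_swap x z)
  rw [e1, e2]
  simp only [map_smul, map_add, map_sub]
  rw [hext.map_star_mul ht ha, hext.map_star_mul ht hb, hext.map_star_mul ht hc,
    hext.map_star_mul ht hd]

include hτ ht in
theorem sqFinite_sqrt {a : A} (ha : a ∈ finiteCone τ) : SqFinite τ (CFC.sqrt a) := by
  rw [SqFinite, star_sqrt, sqrt_mul_sqrt ha.1]
  exact ha

-- For `a ∈ J₊` with `s = a^{1/2}`, both `ab = s⋆(sb)` and `ba = (bs)s` are products of two
-- square-finite elements.
include hτ ht in
theorem mul_mem_finiteSpan {a : A} (ha : a ∈ finiteSpan τ) (b : A) :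
    a * b ∈ finiteSpan τ ∧ b * a ∈ finiteSpan τ := by
  induction ha using Submodule.span_induction with
  | mem a ha =>
    have hs := sqFinite_sqrt hτ ht ha
    have h1 := hs.star_mul_mem hτ (hs.mul_right hτ ht b)
    have h2 := ((hs.mul_left hτ b).adjoint ht).star_mul_mem hτ hs
    rw [star_sqrt, ← mul_assoc, sqrt_mul_sqrt ha.1] at h1
    rw [star_star, mul_assoc, sqrt_mul_sqrt ha.1] at h2
    exact ⟨h1, h2⟩
  | zero => simp
  | add x y _ _ hx hy =>
    rw [add_mul, mul_add]
    exact ⟨Submodule.add_mem _ hx.1 hy.1, Submodule.add_mem _ hx.2 hy.2⟩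
  | smul c x _ hx =>
    rw [smul_mul_assoc, mul_smul_comm]
    exact ⟨Submodule.smul_mem _ _ hx.1, Submodule.smul_mem _ _ hx.2⟩

-- For `a = s²`, two exchanges of square-finite factors suffice: `s(sb) → (sb)s = s(bs) → (bs)s`.
include hτ ht in
theorem IsLinearExtension.map_mul {t : finiteSpan τ →ₗ[ℂ] ℂ} (hext : IsLinearExtension τ t)
    {a : A} (ha : a ∈ finiteSpan τ) (b : A) :
    t ⟨a * b, (mul_mem_finiteSpan hτ ht ha b).1⟩ = t ⟨b * a, (mul_mem_finiteSpan hτ ht ha b).2⟩ := by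
  induction ha using Submodule.span_induction with
  | mem a ha =>
    have hs := sqFinite_sqrt hτ ht ha
    set s := CFC.sqrt a with hsdef
    have hss : s * s = a := sqrt_mul_sqrt ha.1
    have hst : star s = s := star_sqrt a
    have hb := hs.mul_right hτ ht b
    have hb' := hs.mul_left hτ b
    have m1 : s * (s * b) ∈ finiteSpan τ := by
      have := hs.star_mul_mem hτ hb; rwa [hst] at this
    have m2 : s * b * s ∈ finiteSpan τ := by
      have := (hb.adjoint ht).star_mul_mem hτ hs; rwa [star_star] at this
    have m3 : s * (b * s) ∈ finiteSpan τ := by rwa [← mul_assoc]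
    have m4 : b * s * s ∈ finiteSpan τ := by
      have := (hb'.adjoint ht).star_mul_mem hτ hs; rwa [star_star] at this
    have e1 : t ⟨s * (s * b), m1⟩ = t ⟨s * b * s, m2⟩ := by
      have := hext.map_mul_comm hτ ht hs hb (by rwa [hst]) (by rwa [hst])
      simpa only [hst] using this
    have e2 : t ⟨s * (b * s), m3⟩ = t ⟨b * s * s, m4⟩ := by
      have := hext.map_mul_comm hτ ht hs hb' (by rwa [hst]) (by rwa [hst])
      simpa only [hst] using this
    calc t ⟨a * b, _⟩ = t ⟨s * (s * b), m1⟩ := by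
          
          refine congrArg t (Subtype.ext ?_)
          change a * b = s * (s * b)
          rw [← mul_assoc, hss]
      _ = t ⟨s * b * s, m2⟩ := e1
      _ = t ⟨s * (b * s), m3⟩ := by congr 1; exact Subtype.ext (mul_assoc _ _ _)
      _ = t ⟨b * s * s, m4⟩ := e2
      _ = _ := by
          refine congrArg t (Subtype.ext ?_)
          change b * s * s = b * a
          rw [mul_assoc, hss]
  | zero => exact congrArg t (Subtype.ext ((zero_mul b).trans (mul_zero b).symm))
  | add x y hx hy ihx ihy =>
    have e1 : (⟨(x + y) * b, (mul_mem_finiteSpan hτ ht (add_mem hx hy) b).1⟩ : finiteSpan τ)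
        = ⟨x * b, (mul_mem_finiteSpan hτ ht hx b).1⟩ + ⟨y * b, (mul_mem_finiteSpan hτ ht hy b).1⟩ :=
      Subtype.ext (add_mul _ _ _)
    have e2 : (⟨b * (x + y), (mul_mem_finiteSpan hτ ht (add_mem hx hy) b).2⟩ : finiteSpan τ)
        = ⟨b * x, (mul_mem_finiteSpan hτ ht hx b).2⟩ + ⟨b * y, (mul_mem_finiteSpan hτ ht hy b).2⟩ :=
      Subtype.ext (mul_add _ _ _)
    exact (congrArg t e1).trans ((map_add t _ _).trans
      ((congrArg₂ (· + ·) ihx ihy).trans ((map_add t _ _).symm.trans (congrArg t e2).symm)))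
  | smul c x hx ih =>
    have e1 : (⟨(c • x) * b, (mul_mem_finiteSpan hτ ht (Submodule.smul_mem _ c hx) b).1⟩ :
        finiteSpan τ) = c • ⟨x * b, (mul_mem_finiteSpan hτ ht hx b).1⟩ :=
      Subtype.ext (smul_mul_assoc _ _ _)
    have e2 : (⟨b * (c • x), (mul_mem_finiteSpan hτ ht (Submodule.smul_mem _ c hx) b).2⟩ :
        finiteSpan τ) = c • ⟨b * x, (mul_mem_finiteSpan hτ ht hx b).2⟩ :=
      Subtype.ext (mul_smul_comm _ _ _)
    exact (congrArg t e1).trans ((map_smul t _ _).trans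
      ((congrArg (c • ·) ih).trans ((map_smul t _ _).symm.trans (congrArg t e2).symm)))

include hτ ht in
theorem isTrace_of_isWeight : IsTrace τ where
  toIsWeight := hτ
  map_star_mul := ht
  mul_mem a ha b := mul_mem_finiteSpan hτ ht ha b
  exists_extension := by
    obtain ⟨t, hext⟩ := hτ.exists_linearExtension
    exact ⟨t, hext, fun a ha b => hext.map_mul hτ ht ha b⟩

/-- If `a⋆ a` is a null element, then `a` belongs to `J`, and linear extensions vanish on it. -/
theorem mem_finiteSpan_of_null (hτ : IsWeight τ) (hl : OrderLsc τ)
    (ht : ∀ x : A, τ (star x * x) = τ (x * star x)) {x : A} (hx : τ (star x * x) = 0) :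
    ∃ hJ : x ∈ finiteSpan τ, ∀ t : finiteSpan τ →ₗ[ℂ] ℂ, IsLinearExtension τ t →
      t ⟨x, hJ⟩ = 0 := by
  -- Nullity of a square passes to its root: `(p - δ/2)² ≥ 0` gives `p ≤ δ⁻¹p² + δ/4`, so `p` is
  -- dominated, up to `δ`, by the null element `δ⁻¹y²`. The comparison `p² ≤ y²` will be used with
  -- `p = y⁺` and `p = y⁻`.
  have hsa : ∀ y : A, IsSelfAdjoint y → τ (y * y) = 0 → ∀ p : A, 0 ≤ p → p * p ≤ y * y →
      τ p = 0 := by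
    intro y hy hy0 p hp hpy
    refine le_antisymm (hl.le_of_forall hp fun δ hδ => ?_) bot_le
    have hyy : 0 ≤ y * y := hy.mul_self_nonneg
    refine ⟨((δ⁻¹ : ℝ) : ℂ) • (y * y), coe_smul_nonneg (by positivity) hyy, ?_, ?_⟩
    · have hps : IsSelfAdjoint p := IsSelfAdjoint.of_nonneg hp
      have h1 : p ≤ ((δ⁻¹ : ℝ) : ℂ) • (p * p) + algebraMap ℝ A δ := by
        have h2 : 0 ≤ (p - algebraMap ℝ A (δ / 2)) * (p - algebraMap ℝ A (δ / 2)) :=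
          (hps.sub (IsSelfAdjoint.of_nonneg (algebraMap_real_nonneg (by positivity)))).mul_self_nonneg
        have h3 := coe_smul_nonneg (show 0 ≤ δ⁻¹ by positivity) h2
        have h4 : ((δ⁻¹ : ℝ) : ℂ) • ((p - algebraMap ℝ A (δ / 2)) * (p - algebraMap ℝ A (δ / 2)))
            = ((δ⁻¹ : ℝ) : ℂ) • (p * p) + algebraMap ℝ A (δ / 4) - p := by
          have hδ' : (δ : ℂ) ≠ 0 := by exact_mod_cast hδ.ne'
          simp only [algebraMap_real_eq_smul, sub_mul, mul_sub, mul_smul_comm, smul_mul_assoc,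
            mul_one, one_mul, smul_sub, smul_smul]
          push_cast
          have e1 : (δ : ℂ)⁻¹ * ((δ : ℂ) / 2) = 1 / 2 := by field_simp
          have e2 : (δ : ℂ)⁻¹ * ((δ : ℂ) / 2 * ((δ : ℂ) / 2)) = (δ : ℂ) / 4 := by field_simp; norm_num
          rw [e1, e2]
          module
        rw [h4, sub_nonneg] at h3
        refine h3.trans (add_le_add le_rfl ?_)
        rw [← sub_nonneg, ← map_sub]
        exact algebraMap_real_nonneg (by linarith)
      refine h1.trans (add_le_add ?_ le_rfl)
      rw [Complex.coe_smul, Complex.coe_smul]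
      exact smul_le_smul_of_nonneg_left hpy (by positivity)
    · rw [hτ.map_smul _ _ (by positivity) hyy, hy0, mul_zero]
  have hparts : ∀ y : A, IsSelfAdjoint y → τ (y * y) = 0 → τ (y⁺) = 0 ∧ τ (y⁻) = 0 := by
    intro y hy hy0
    have h1 : y * y = y⁺ * y⁺ + y⁻ * y⁻ := by
      conv_lhs => rw [← CFC.posPart_sub_negPart y hy]
      rw [sub_mul, mul_sub, mul_sub, CFC.posPart_mul_negPart, CFC.negPart_mul_posPart]
      simp
    exact ⟨hsa y hy hy0 _ (CFC.posPart_nonneg y) (by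
        rw [h1]
        exact le_add_of_nonneg_right (IsSelfAdjoint.of_nonneg (CFC.negPart_nonneg y)).mul_self_nonneg),
      hsa y hy hy0 _ (CFC.negPart_nonneg y) (by
        rw [h1]
        exact le_add_of_nonneg_left (IsSelfAdjoint.of_nonneg (CFC.posPart_nonneg y)).mul_self_nonneg)⟩
  set R : A := (realPart x : A) with hR
  set J : A := (imaginaryPart x : A) with hJdef
  have hRs : IsSelfAdjoint R := (realPart x).2
  have hJs : IsSelfAdjoint J := (imaginaryPart x).2
  -- By traciality `xx⋆` is null together with `x⋆x`, so the squares of the real and imaginary parts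
  -- of `x` are null.
  have hsum : R * R + J * J = ((2⁻¹ : ℝ) : ℂ) • (star x * x + x * star x) := by
    have hxRJ : x = R + Complex.I • J := (realPart_add_I_smul_imaginaryPart x).symm
    rw [hxRJ]
    simp only [star_add, star_smul, hRs.star_eq, hJs.star_eq, Complex.star_def, Complex.conj_I,
      mul_add, add_mul, smul_mul_assoc, mul_smul_comm, neg_smul, mul_neg, neg_mul]
    push_cast
    match_scalars <;> ring_nf
    simp [Complex.I_sq]
  have hzero : τ (R * R + J * J) = 0 := by
    rw [hsum, hτ.map_smul _ _ (by positivity) (add_nonneg (star_mul_self_nonneg _)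
      (mul_star_self_nonneg _)), hτ.map_add _ _ (star_mul_self_nonneg _) (mul_star_self_nonneg _),
      ← ht, hx]
    simp
  rw [hτ.map_add _ _ hRs.mul_self_nonneg hJs.mul_self_nonneg, add_eq_zero] at hzero
  obtain ⟨hR1, hR2⟩ := hparts R hRs hzero.1
  obtain ⟨hJ1, hJ2⟩ := hparts J hJs hzero.2
  have hmem : ∀ p : A, 0 ≤ p → τ p = 0 → p ∈ finiteCone τ := fun p hp h =>
    ⟨hp, by rw [h]; exact ENNReal.zero_lt_top⟩
  have c1 := hmem _ (CFC.posPart_nonneg R) hR1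
  have c2 := hmem _ (CFC.negPart_nonneg R) hR2
  have c3 := hmem _ (CFC.posPart_nonneg J) hJ1
  have c4 := hmem _ (CFC.negPart_nonneg J) hJ2
  have hsub : ∀ {p : A}, p ∈ finiteCone τ → p ∈ finiteSpan τ := fun h => Submodule.subset_span h
  have hx' : x = (R⁺ - R⁻) + Complex.I • (J⁺ - J⁻) := by
    rw [CFC.posPart_sub_negPart R hRs, CFC.posPart_sub_negPart J hJs]
    exact (realPart_add_I_smul_imaginaryPart x).symm
  have hJx : x ∈ finiteSpan τ := by
    rw [hx']
    exact Submodule.add_mem _ (Submodule.sub_mem _ (hsub c1) (hsub c2))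
      (Submodule.smul_mem _ _ (Submodule.sub_mem _ (hsub c3) (hsub c4)))
  refine ⟨hJx, fun t hext => ?_⟩
  have e : (⟨x, hJx⟩ : finiteSpan τ) = ((⟨_, hsub c1⟩ : finiteSpan τ) - ⟨_, hsub c2⟩)
      + Complex.I • ((⟨_, hsub c3⟩ : finiteSpan τ) - ⟨_, hsub c4⟩) := Subtype.ext hx'
  rw [e, map_add, map_smul, map_sub, map_sub, hext _ c1, hext _ c2, hext _ c3, hext _ c4, hR1, hR2,
    hJ1, hJ2]
  simp

end Extension

/-- The order of `S` is the one induced by `A`. An element of `S` that is positive in `A` is a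
square within `S`, since the continuous functional calculus stays in a closed star subalgebra. -/
theorem starOrderedRing_of_isClosed {A : Type*} [CStarAlgebra A] [PartialOrder A]
    [StarOrderedRing A] (S : StarSubalgebra ℂ A) [hS : IsClosed (S : Set A)] :
    StarOrderedRing S := by
  refine StarOrderedRing.of_nonneg_iff' (fun {x y} hxy z => ?_) fun x => ⟨fun hx => ?_, ?_⟩
  · exact add_le_add (le_refl (z : A)) (show (x : A) ≤ y from hxy)
  · have hx' : 0 ≤ (x : A) := hx
    have hm : cfc Real.sqrt (x : A) ∈ S := cfc_mem (𝕜' := ℂ) Real.sqrt x.2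
    refine ⟨⟨cfc Real.sqrt (x : A), hm⟩, Subtype.ext ?_⟩
    change (x : A) = star (cfc Real.sqrt (x : A)) * cfc Real.sqrt (x : A)
    have hsa : IsSelfAdjoint (x : A) := IsSelfAdjoint.of_nonneg hx'
    rw [(cfc_predicate Real.sqrt (x : A) : IsSelfAdjoint _).star_eq,
      ← cfc_mul Real.sqrt Real.sqrt (x : A)]
    conv_lhs => rw [← cfc_id' ℝ (x : A)]
    exact cfc_congr fun t ht => (Real.mul_self_sqrt (spectrum_nonneg_of_nonneg hx' ht)).symm
  · rintro ⟨s, rfl⟩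
    exact star_mul_self_nonneg (s : A)

/-! ### The regularized trace on the almost local operators -/

section AlmostLocal

variable {M : Type*} [MetricSpace M] [SecondCountableTopology M] [MeasurableSpace M] [BorelSpace M]
  [SigmaCompactSpace M]
  {Fm : Type*} [NormedAddCommGroup Fm] [NormedSpace ℂ Fm] [FiniteDimensional ℂ Fm]
  {E : M → Type*} [∀ x, NormedAddCommGroup (E x)] [∀ x, InnerProductSpace ℂ (E x)]
  [TopologicalSpace (TotalSpace Fm E)] [FiberBundle Fm E] [VectorBundle ℂ Fm E]
  [IsHermitianBundle Fm E] {μ : Measure M}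

local instance isClosed_almostLocal :
    IsClosed (almostLocal Fm E μ : Set (L2 Fm E μ →L[ℂ] L2 Fm E μ)) :=
  StarSubalgebra.isClosed_topologicalClosure _

local instance cstarAlgebra_almostLocal : CStarAlgebra (almostLocal Fm E μ) :=
  StarSubalgebra.cstarAlgebra _

local instance starOrderedRing_almostLocal : StarOrderedRing (almostLocal Fm E μ) :=
  starOrderedRing_of_isClosed _

variable (Fm E μ) in
/-- The operators of finite propagation, as elements of the algebra of almost local operators. -/
def finitePropagationSet : Set (almostLocal Fm E μ) :=
  {v | HasFinitePropagation (v : L2 Fm E μ →L[ℂ] L2 Fm E μ)}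

theorem dense_finitePropagationSet : Dense (finitePropagationSet Fm E μ) := by
  rw [Subtype.dense_iff]
  rintro x hx
  refine closure_mono ?_ hx
  intro v hv
  exact ⟨⟨v, StarSubalgebra.le_topologicalClosure _ hv⟩, hv, rfl⟩

variable (𝒦 : RegularExhaustion μ) (Lim : GeneralizedLimit)

/-- The restriction of the functional of Roe to the algebra of almost local operators. -/
abbrev roeOnAlmostLocal (T : almostLocal Fm E μ) : ℝ≥0∞ :=
  roeFunctional 𝒦 Lim (T : L2 Fm E μ →L[ℂ] L2 Fm E μ)

/-- All that the abstract theory asks of Roe's functional is that it be a weight which decreases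
under conjugation by contractions of finite propagation. The last two conclusions are the nullity
criteria that will be applied to compact operators. -/
theorem roeTrace_main
    (hφ : IsWeight (roeOnAlmostLocal (Fm := Fm) (E := E) 𝒦 Lim))
    (hinv : ∀ v ∈ finitePropagationSet Fm E μ, ‖v‖ ≤ 1 → ∀ a, 0 ≤ a →
      roeOnAlmostLocal 𝒦 Lim (v * a * star v) ≤ roeOnAlmostLocal 𝒦 Lim a) :
    IsTrace (roeTrace Fm E 𝒦 Lim) ∧
      LowerSemicontinuousOn (roeTrace Fm E 𝒦 Lim) {T | 0 ≤ T} ∧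
      IsSemifinite (roeTrace Fm E 𝒦 Lim) ∧
      (∀ a : almostLocal Fm E μ, 0 ≤ a → (∀ δ : ℝ, 0 < δ → ∃ b : almostLocal Fm E μ, 0 ≤ b ∧
        a ≤ b + algebraMap ℝ _ δ ∧ roeOnAlmostLocal 𝒦 Lim b = 0) →
        roeTrace Fm E 𝒦 Lim a = 0) ∧
      ∀ x : almostLocal Fm E μ, roeTrace Fm E 𝒦 Lim (star x * x) = 0 →
        ∃ hJ : x ∈ finiteSpan (roeTrace Fm E 𝒦 Lim), ∀ t : finiteSpan (roeTrace Fm E 𝒦 Lim) →ₗ[ℂ] ℂ,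
          IsLinearExtension (roeTrace Fm E 𝒦 Lim) t → t ⟨x, hJ⟩ = 0 := by
  have hS := dense_finitePropagationSet (Fm := Fm) (E := E) (μ := μ)
  have hτ := isWeight_lscRegularization hS hφ hinv
  have ht := lscRegularization_star_mul_eq hS hφ hinv
  have hl := orderLsc_lscRegularization (φ := roeOnAlmostLocal (Fm := Fm) (E := E) 𝒦 Lim)
  have hσ := isWeight_semifiniteRegularization hτ ht hl
  have hσt := semifiniteRegularization_star_mul_eq hτ ht hl
  have hσl := orderLsc_semifiniteRegularization hτ ht hl
  refine ⟨isTrace_of_isWeight hσ hσt, hσl.lowerSemicontinuousOn,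
    isSemifinite_semifiniteRegularization hτ ht hl, fun a ha H => ?_, fun x hx =>
    mem_finiteSpan_of_null hσ hσl hσt hx⟩
  refine le_antisymm (hσl.le_of_forall ha fun δ hδ => ?_) bot_le
  obtain ⟨b, hb, hab, hb0⟩ := H δ hδ
  exact ⟨b, hb, hab, (semifiniteRegularization_le hτ).trans
    ((lscRegularization_le b hb).trans_eq hb0)⟩

end AlmostLocal

/-! ### Hilbert–Schmidt norms and local traces -/

section HilbertSchmidt

variable {H : Type*} [NormedAddCommGroup H] [InnerProductSpace ℂ H] [CompleteSpace H]

theorem parseval_enorm {ι : Type*} (b : HilbertBasis ι ℂ H) (x : H) :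
    ∑' i, ‖⟪b i, x⟫_ℂ‖ₑ ^ 2 = ‖x‖ₑ ^ 2 := by
  have h1 := (b.hasSum_inner_mul_inner x x).mapL Complex.reCLM
  have h2 : HasSum (fun i => ‖⟪b i, x⟫_ℂ‖ ^ 2) (‖x‖ ^ 2) := by
    convert h1 using 1
    · funext i
      have h3 : ⟪x, b i⟫_ℂ * ⟪b i, x⟫_ℂ = ((‖⟪b i, x⟫_ℂ‖ ^ 2 : ℝ) : ℂ) := by
        rw [← inner_conj_symm, mul_comm, Complex.mul_conj, Complex.normSq_eq_norm_sq]
      rw [h3]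
      exact (Complex.ofReal_re _).symm
    · rw [inner_self_eq_norm_sq_to_K]
      norm_cast
  have h3 : ∀ y : ℝ, ENNReal.ofReal (|y| ^ 2) = ‖y‖ₑ ^ 2 := by
    intro y
    rw [ENNReal.ofReal_pow (abs_nonneg _), ← Real.norm_eq_abs, ofReal_norm]
  have h4 := ENNReal.ofReal_tsum_of_nonneg (fun i => by positivity) h2.summable
  rw [h2.tsum_eq, ENNReal.ofReal_pow (norm_nonneg _), ofReal_norm] at h4
  rw [h4]
  refine tsum_congr fun i => ?_
  rw [ENNReal.ofReal_pow (norm_nonneg _), ofReal_norm]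

/-- The square of the Hilbert–Schmidt norm. -/
def hsSq (A : H →L[ℂ] H) : ℝ≥0∞ :=
  ∑' i, ‖A ((exists_hilbertBasis ℂ H).choose_spec.choose i)‖ₑ ^ 2

/-- By Parseval both sides are the sum of all squared matrix coefficients `|⟪b i, A (b j)⟫|²`,
summed in the two orders. -/
theorem hsSq_star (A : H →L[ℂ] H) : hsSq (star A) = hsSq A := by
  set b := (exists_hilbertBasis ℂ H).choose_spec.choose with hb
  have h1 : ∀ i, ‖(star A) (b i)‖ₑ ^ 2 = ∑' j, ‖⟪b i, A (b j)⟫_ℂ‖ₑ ^ 2 := by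
    intro i
    rw [← parseval_enorm b]
    refine tsum_congr fun j => ?_
    rw [ContinuousLinearMap.star_eq_adjoint, ContinuousLinearMap.adjoint_inner_right,
      ← inner_conj_symm, RCLike.enorm_conj]
  have h2 : ∀ j, ‖A (b j)‖ₑ ^ 2 = ∑' i, ‖⟪b i, A (b j)⟫_ℂ‖ₑ ^ 2 := fun j =>
    (parseval_enorm b _).symm
  rw [hsSq, hsSq, ← hb, tsum_congr h1, tsum_congr h2, ENNReal.tsum_comm]

theorem hsSq_mul_le (B A : H →L[ℂ] H) : hsSq (B * A) ≤ ‖B‖ₑ ^ 2 * hsSq A := by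
  rw [hsSq, hsSq, ← ENNReal.tsum_mul_left]
  refine ENNReal.tsum_le_tsum fun i => ?_
  rw [← mul_pow]
  gcongr
  exact B.le_opENorm _

theorem hsSq_mul_le_of_norm_le_one {B : H →L[ℂ] H} (hB : ‖B‖ ≤ 1) (A : H →L[ℂ] H) :
    hsSq (B * A) ≤ hsSq A := by
  refine (hsSq_mul_le B A).trans ?_
  have h : ‖B‖ₑ ≤ 1 := by
    rw [← ofReal_norm]
    exact ENNReal.ofReal_le_one.2 hB
  calc ‖B‖ₑ ^ 2 * hsSq A ≤ 1 ^ 2 * hsSq A := by gcongr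
    _ = hsSq A := by simp

theorem posTrace_star_mul (A : H →L[ℂ] H) : posTrace (star A * A) = hsSq A := by
  refine tsum_congr fun i => ?_
  rw [mul_apply_eq_comp, ContinuousLinearMap.star_eq_adjoint,
    ContinuousLinearMap.adjoint_inner_left, inner_self_eq_norm_sq, ENNReal.ofReal_pow
    (norm_nonneg _), ofReal_norm]

theorem posTrace_mul_star (A : H →L[ℂ] H) : posTrace (A * star A) = hsSq A := by
  have := posTrace_star_mul (star A)
  rwa [star_star, hsSq_star] at this

theorem posTrace_add {S T : H →L[ℂ] H} (hS : 0 ≤ S) (hT : 0 ≤ T) :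
    posTrace (S + T) = posTrace S + posTrace T := by
  rw [posTrace, posTrace, posTrace, ← ENNReal.tsum_add]
  refine tsum_congr fun i => ?_
  rw [add_apply, inner_add_left, map_add, ENNReal.ofReal_add]
  · exact ((ContinuousLinearMap.nonneg_iff_isPositive S).1 hS).re_inner_nonneg_left _
  · exact ((ContinuousLinearMap.nonneg_iff_isPositive T).1 hT).re_inner_nonneg_left _

theorem posTrace_smul {r : ℝ} (hr : 0 ≤ r) (T : H →L[ℂ] H) :
    posTrace ((r : ℂ) • T) = ENNReal.ofReal r * posTrace T := by
  rw [posTrace, posTrace, ← ENNReal.tsum_mul_left]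
  refine tsum_congr fun i => ?_
  rw [← ENNReal.ofReal_mul hr]
  congr 1
  change Complex.re ⟪(r : ℂ) • (T _), _⟫_ℂ = r * Complex.re _
  rw [inner_smul_left, Complex.conj_ofReal, Complex.re_ofReal_mul]

theorem posTrace_zero : posTrace (0 : H →L[ℂ] H) = 0 := by
  simp [posTrace]

end HilbertSchmidt

/-! ### Local traces as Hilbert–Schmidt norms -/

section LocalTrace

variable {M : Type*} [MetricSpace M] [SecondCountableTopology M] [MeasurableSpace M] [BorelSpace M]
  {Fm : Type*} [NormedAddCommGroup Fm] [NormedSpace ℂ Fm] [FiniteDimensional ℂ Fm]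
  {E : M → Type*} [∀ x, NormedAddCommGroup (E x)] [∀ x, InnerProductSpace ℂ (E x)]
  [TopologicalSpace (TotalSpace Fm E)] [FiberBundle Fm E] [VectorBundle ℂ Fm E]
  [IsHermitianBundle Fm E] {μ : Measure M}

theorem star_proj {S : Set M} (hS : MeasurableSet S) :
    star (proj Fm E μ S) = proj Fm E μ S := by
  refine ContinuousLinearMap.ext fun f => ext_inner_right ℂ fun g => ?_
  rw [ContinuousLinearMap.star_eq_adjoint, ContinuousLinearMap.adjoint_inner_left,
    inner_proj hS]

theorem opNorm_proj_le (S : Set M) : ‖proj Fm E μ S‖ ≤ 1 :=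
  ContinuousLinearMap.opNorm_le_bound _ zero_le_one fun f => by
    rw [one_mul]; exact norm_proj_le S f

theorem proj_mul_proj {S T : Set M} (hS : MeasurableSet S) (hT : MeasurableSet T) :
    proj Fm E μ S * proj Fm E μ T = proj Fm E μ (S ∩ T) :=
  ContinuousLinearMap.ext fun f => proj_proj hS hT f

theorem proj_of_null {S : Set M} (hS : MeasurableSet S) (h : μ S = 0) :
    proj Fm E μ S = 0 := by
  refine ContinuousLinearMap.ext fun f => ?_
  induction f using UniformSpace.Completion.induction_on with
  | hp => exact isClosed_eq (by fun_prop) (by fun_prop)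
  | ih s =>
    rw [proj_coe hS, zero_apply, ← norm_eq_zero, UniformSpace.Completion.norm_coe,
      ← sq_eq_zero_iff, SqInt.norm_sq]
    refine integral_eq_zero_of_ae ?_
    have h1 : ∀ᵐ x ∂μ, x ∉ S := measure_eq_zero_iff_ae_notMem.1 h
    filter_upwards [h1] with x hx
    rw [SqInt.indicator_of_notMem hS _ hx]
    simp

/-- The trace of `E_S C C⋆ E_S` becomes the squared Hilbert–Schmidt norm of `E_S C`, so an operator
inserted on the left of `C` can be controlled by its norm. -/
theorem localTrace_mul_star {S : Set M} (hS : MeasurableSet S) (C : L2 Fm E μ →L[ℂ] L2 Fm E μ) :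
    localTrace (C * star C) S = hsSq (proj Fm E μ S * C) := by
  rw [← posTrace_mul_star, star_mul, star_proj hS, localTrace]
  congr 1

theorem exists_eq_mul_star {T : L2 Fm E μ →L[ℂ] L2 Fm E μ} (hT : 0 ≤ T) :
    ∃ C : L2 Fm E μ →L[ℂ] L2 Fm E μ, T = C * star C :=
  ⟨CFC.sqrt T, by rw [star_sqrt, sqrt_mul_sqrt hT]⟩

theorem localTrace_add {S T : L2 Fm E μ →L[ℂ] L2 Fm E μ} (hS : 0 ≤ S) (hT : 0 ≤ T) {X : Set M}
    (hX : MeasurableSet X) : localTrace (S + T) X = localTrace S X + localTrace T X := by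
  have hsa : IsSelfAdjoint (proj Fm E μ X) := star_proj hX
  rw [localTrace, mul_add, add_mul,
    posTrace_add (hsa.conjugate_nonneg hS) (hsa.conjugate_nonneg hT)]
  rfl

theorem localTrace_smul {r : ℝ} (hr : 0 ≤ r) (T : L2 Fm E μ →L[ℂ] L2 Fm E μ) (X : Set M) :
    localTrace ((r : ℂ) • T) X = ENNReal.ofReal r * localTrace T X := by
  rw [localTrace, mul_smul_comm, smul_mul_assoc, posTrace_smul hr]
  rfl

theorem localTrace_zero (X : Set M) :
    localTrace (0 : L2 Fm E μ →L[ℂ] L2 Fm E μ) X = 0 := by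
  rw [localTrace, mul_zero, zero_mul, posTrace_zero]

theorem localTrace_of_null (T : L2 Fm E μ →L[ℂ] L2 Fm E μ) {X : Set M} (hX : MeasurableSet X)
    (h : μ X = 0) : localTrace T X = 0 := by
  rw [localTrace, proj_of_null hX h, zero_mul, zero_mul, posTrace_zero]

theorem hsSq_proj_mul_mono {S T : Set M} (hS : MeasurableSet S) (hT : MeasurableSet T)
    (hST : S ⊆ T) (C : L2 Fm E μ →L[ℂ] L2 Fm E μ) :
    hsSq (proj Fm E μ S * C) ≤ hsSq (proj Fm E μ T * C) := by
  have h : proj Fm E μ S * C = proj Fm E μ S * (proj Fm E μ T * C) := by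
    rw [← mul_assoc, proj_mul_proj hS hT, inter_eq_self_of_subset_left hST]
  rw [h]
  exact hsSq_mul_le_of_norm_le_one (opNorm_proj_le S) _

theorem proj_union {S T : Set M} (hS : MeasurableSet S) (hT : MeasurableSet T)
    (h : Disjoint S T) : proj Fm E μ (S ∪ T) = proj Fm E μ S + proj Fm E μ T := by
  refine ContinuousLinearMap.ext fun f => ?_
  have h1 := proj_add_compl hS (proj Fm E μ (S ∪ T) f)
  rw [proj_proj hS (hS.union hT), proj_proj hS.compl (hS.union hT),
    inter_eq_self_of_subset_left subset_union_left] at h1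
  have h2 : Sᶜ ∩ (S ∪ T) = T := by
    ext x
    simp only [mem_inter_iff, mem_compl_iff, mem_union]
    constructor
    · rintro ⟨h3, h4⟩; tauto
    · intro hx
      exact ⟨fun hx' => Set.disjoint_left.1 h hx' hx, Or.inr hx⟩
  rw [h2] at h1
  rw [← h1]; rfl

theorem enorm_proj_union_sq {S T : Set M} (hS : MeasurableSet S) (hT : MeasurableSet T)
    (h : Disjoint S T) (f : L2 Fm E μ) :
    ‖proj Fm E μ (S ∪ T) f‖ₑ ^ 2 = ‖proj Fm E μ S f‖ₑ ^ 2 + ‖proj Fm E μ T f‖ₑ ^ 2 := by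
  have h0 : ⟪proj Fm E μ S f, proj Fm E μ T f⟫_ℂ = 0 := by
    rw [inner_proj hS, proj_proj hS hT, Set.disjoint_iff_inter_eq_empty.1 h, proj_empty,
      inner_zero_right]
  have h1 := norm_add_sq_eq_norm_sq_add_norm_sq_of_inner_eq_zero _ _ h0
  rw [proj_union hS hT h, add_apply]
  have h2 := congrArg ENNReal.ofReal h1
  rw [ENNReal.ofReal_add (by positivity) (by positivity)] at h2
  simp only [← pow_two] at h2
  simpa only [ENNReal.ofReal_pow (norm_nonneg _), ofReal_norm] using h2

theorem hsSq_proj_mul_le_add {S S₁ S₂ : Set M} (hS : MeasurableSet S) (h₁ : MeasurableSet S₁)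
    (h₂ : MeasurableSet S₂) (h : S ⊆ S₁ ∪ S₂) (C : L2 Fm E μ →L[ℂ] L2 Fm E μ) :
    hsSq (proj Fm E μ S * C) ≤ hsSq (proj Fm E μ S₁ * C) + hsSq (proj Fm E μ S₂ * C) := by
  have h3 : hsSq (proj Fm E μ (S₁ ∪ (S₂ \ S₁)) * C)
      = hsSq (proj Fm E μ S₁ * C) + hsSq (proj Fm E μ (S₂ \ S₁) * C) := by
    rw [hsSq, hsSq, hsSq, ← ENNReal.tsum_add]
    exact tsum_congr fun i => enorm_proj_union_sq h₁ (h₂.diff h₁) disjoint_sdiff_right _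
  refine (hsSq_proj_mul_mono hS (h₁.union (h₂.diff h₁)) (by rwa [union_sdiff_self]) C).trans ?_
  rw [h3]
  gcongr
  exact hsSq_proj_mul_mono (h₂.diff h₁) h₂ sdiff_subset C

/-- If `f` vanishes on the open `(u+1)`-neighbourhood of `S`, then `V f` lives within distance `u`
of the complement of this neighbourhood, a set that misses `S`. The extra `1` makes the separation
strict. -/
theorem proj_mul_eq_of_propagation [SigmaCompactSpace M] {V : L2 Fm E μ →L[ℂ] L2 Fm E μ} {u : ℝ}
    (hu : 0 < u) (hV : ∀ K : Set M, IsCompact K → ∀ f : L2 Fm E μ,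
      SuppIn f K → SuppIn (V f) (Metric.cthickening u K))
    {S T : Set M} (hS : MeasurableSet S) (hT : MeasurableSet T)
    (hST : Metric.thickening (u + 1) S ⊆ T) :
    proj Fm E μ S * V = proj Fm E μ S * V * proj Fm E μ T := by
  refine ContinuousLinearMap.ext fun f => ?_
  simp only [mul_apply_eq_comp]
  have h1 := proj_add_compl hT f
  conv_lhs => rw [← h1, map_add, map_add]
  rw [add_eq_left]
  set C₀ := (Metric.thickening (u + 1) S)ᶜ with hC₀
  have hcl : IsClosed C₀ := Metric.isOpen_thickening.isClosed_compl
  have h2 : SuppIn (proj Fm E μ Tᶜ f) C₀ :=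
    (suppIn_proj hT.compl f).mono hT.compl hcl.measurableSet (compl_subset_compl.2 hST)
  have h3 := SuppIn.of_closed hV hcl h2
  have hm : MeasurableSet (Metric.cthickening u C₀) := Metric.isClosed_cthickening.measurableSet
  have hd : S ∩ Metric.cthickening u C₀ = ∅ := by
    rw [eq_empty_iff_forall_notMem]
    rintro x ⟨hx, hx2⟩
    rw [Metric.mem_cthickening_iff] at hx2
    have h3 : ENNReal.ofReal (u + 1) ≤ Metric.infEDist x C₀ := by
      rw [Metric.le_infEDist]
      intro y hy
      rw [mem_compl_iff, Metric.mem_thickening_iff_infEDist_lt, not_lt] at hy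
      rw [edist_comm]
      exact hy.trans (Metric.infEDist_le_edist_of_mem hx)
    have h4 : ENNReal.ofReal u < ENNReal.ofReal (u + 1) :=
      (ENNReal.ofReal_lt_ofReal_iff (by positivity)).2 (by linarith)
    exact absurd (h3.trans hx2) (not_le.2 h4)
  unfold SuppIn at h3
  rw [← h3, proj_proj hS hm, hd, proj_empty]

theorem hsSq_proj_mul_le_of_propagation [SigmaCompactSpace M]
    {V : L2 Fm E μ →L[ℂ] L2 Fm E μ} {u : ℝ} (hu : 0 < u) (hVn : ‖V‖ ≤ 1)
    (hV : ∀ K : Set M, IsCompact K → ∀ f : L2 Fm E μ,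
      SuppIn f K → SuppIn (V f) (Metric.cthickening u K))
    {S T : Set M} (hS : MeasurableSet S) (hT : MeasurableSet T)
    (hST : Metric.thickening (u + 1) S ⊆ T) (C : L2 Fm E μ →L[ℂ] L2 Fm E μ) :
    hsSq (proj Fm E μ S * (V * C)) ≤ hsSq (proj Fm E μ T * C) := by
  rw [← mul_assoc, proj_mul_eq_of_propagation hu hV hS hT hST, mul_assoc]
  refine hsSq_mul_le_of_norm_le_one ((norm_mul_le _ _).trans ?_) _
  exact mul_le_one₀ (opNorm_proj_le S) (norm_nonneg _) hVn

end LocalTrace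

/-! ### Generalized limits of real sequences -/

namespace GeneralizedLimit

variable (Lim : GeneralizedLimit)

theorem re_add {f g h : ℕ → ℝ} (hf : Memℓp (fun k => (f k : ℂ)) ⊤)
    (hg : Memℓp (fun k => (g k : ℂ)) ⊤) (hh : Memℓp (fun k => (h k : ℂ)) ⊤)
    (H : ∀ k, h k = f k + g k) :
    (Lim.toLinearMap ⟨_, hh⟩).re = (Lim.toLinearMap ⟨_, hf⟩).re + (Lim.toLinearMap ⟨_, hg⟩).re := by
  have : (⟨_, hh⟩ : lp (fun _ : ℕ => ℂ) ⊤) = ⟨_, hf⟩ + ⟨_, hg⟩ := by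
    refine Subtype.ext (funext fun k => ?_)
    change (h k : ℂ) = (f k : ℂ) + (g k : ℂ)
    rw [H, Complex.ofReal_add]
  rw [this, map_add, Complex.add_re]

theorem re_smul {f h : ℕ → ℝ} {r : ℝ} (hf : Memℓp (fun k => (f k : ℂ)) ⊤)
    (hh : Memℓp (fun k => (h k : ℂ)) ⊤) (H : ∀ k, h k = r * f k) :
    (Lim.toLinearMap ⟨_, hh⟩).re = r * (Lim.toLinearMap ⟨_, hf⟩).re := by
  have : (⟨_, hh⟩ : lp (fun _ : ℕ => ℂ) ⊤) = (r : ℂ) • ⟨_, hf⟩ := by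
    refine Subtype.ext (funext fun k => ?_)
    change (h k : ℂ) = (r : ℂ) * (f k : ℂ)
    rw [H, Complex.ofReal_mul]
  rw [this, map_smul, smul_eq_mul, Complex.re_ofReal_mul]

theorem re_nonneg {f : ℕ → ℝ} (hf : Memℓp (fun k => (f k : ℂ)) ⊤) (h : ∀ k, 0 ≤ f k) :
    0 ≤ (Lim.toLinearMap ⟨_, hf⟩).re := by
  have := Lim.map_nonneg ⟨_, hf⟩ fun k => by
    change (0 : ℂ) ≤ (f k : ℂ)
    exact_mod_cast h k
  exact (Complex.le_def.1 this).1

theorem re_eq_zero {f : ℕ → ℝ} (hf : Memℓp (fun k => (f k : ℂ)) ⊤)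
    (h : Tendsto f atTop (𝓝 0)) : (Lim.toLinearMap ⟨_, hf⟩).re = 0 := by
  rw [Lim.map_of_tendsto_zero ⟨_, hf⟩]
  · simp
  · change Tendsto (fun k => (f k : ℂ)) atTop (𝓝 0)
    rw [← Complex.ofReal_zero]
    exact (Complex.continuous_ofReal.tendsto 0).comp h

/-- The excess `max (f - g) 0` is eventually at most `|z|`, so it tends to `0` and is killed by the
limit; after adding it to `g` the inequality holds for all `k`, where positivity applies. -/
theorem re_le_re {f g z : ℕ → ℝ} (hf : Memℓp (fun k => (f k : ℂ)) ⊤)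
    (hg : Memℓp (fun k => (g k : ℂ)) ⊤) (hz : Tendsto z atTop (𝓝 0))
    (H : ∀ᶠ k in atTop, f k ≤ g k + z k) :
    (Lim.toLinearMap ⟨_, hf⟩).re ≤ (Lim.toLinearMap ⟨_, hg⟩).re := by
  have hw : Tendsto (fun k => max (f k - g k) 0) atTop (𝓝 0) := by
    have h1 : Tendsto (fun k => |z k|) atTop (𝓝 0) := by simpa using hz.abs
    refine tendsto_of_tendsto_of_tendsto_of_le_of_le' tendsto_const_nhds h1
      (Eventually.of_forall fun k => le_max_right _ _) ?_
    filter_upwards [H] with k hk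
    exact max_le (by linarith [le_abs_self (z k)]) (abs_nonneg _)
  have hwm : Memℓp (fun k => ((max (f k - g k) 0 : ℝ) : ℂ)) ⊤ := by
    refine memℓp_infty ?_
    have h1 : Tendsto (fun k => ‖((max (f k - g k) 0 : ℝ) : ℂ)‖) atTop (𝓝 0) := by
      simpa [Complex.norm_real] using! hw.abs
    exact h1.bddAbove_range
  have hgwm : Memℓp (fun k => ((g k + max (f k - g k) 0 : ℝ) : ℂ)) ⊤ := by
    have := hg.add hwm
    convert this using 1
    funext k
    push_cast; rfl
  have hdm : Memℓp (fun k => ((g k + max (f k - g k) 0 - f k : ℝ) : ℂ)) ⊤ := by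
    have := hgwm.sub hf
    convert this using 1
    funext k
    push_cast; rfl
  have h1 := Lim.re_add hg hwm hgwm fun _ => rfl
  have h2 := Lim.re_add hf hdm hgwm fun k => by ring
  have h3 := Lim.re_nonneg hdm fun k => by linarith [le_max_left (f k - g k) 0]
  have h4 := Lim.re_eq_zero hwm hw
  linarith

end GeneralizedLimit

/-! ### The cone of Roe and conjugation by operators of finite propagation -/

section RoeCone

variable {M : Type*} [MetricSpace M] [MeasurableSpace M] [BorelSpace M] [SecondCountableTopology M]
  {Fm : Type*} [NormedAddCommGroup Fm] [NormedSpace ℂ Fm] [FiniteDimensional ℂ Fm]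
  {E : M → Type*} [∀ x, NormedAddCommGroup (E x)] [∀ x, InnerProductSpace ℂ (E x)]
  [TopologicalSpace (TotalSpace Fm E)] [FiberBundle Fm E] [VectorBundle ℂ Fm E]
  [IsHermitianBundle Fm E] {μ : Measure M} (𝒦 : RegularExhaustion μ)

theorem innerPen_subset {K : Set M} (hK : IsClosed K) (r : ℝ) : innerPen K r ⊆ K := by
  refine closure_minimal ?_ hK
  rw [compl_subset_comm]
  exact Metric.self_subset_cthickening _

theorem measurableSet_innerPen (K : Set M) (r : ℝ) : MeasurableSet (innerPen K r) :=
  isClosed_closure.measurableSet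

theorem measurableSet_collar (K : Set M) (r₁ r₂ : ℝ) :
    MeasurableSet (Metric.cthickening r₁ K \ innerPen K r₂) :=
  Metric.isClosed_cthickening.measurableSet.diff (measurableSet_innerPen K r₂)

theorem RegularExhaustion.measurableSet (k : ℕ) : MeasurableSet (𝒦.K k) :=
  (𝒦.isCompact k).isClosed.measurableSet

/-- Enlarging a collar by `u` moves its outer and inner boundaries by `u` each. On the inner side, a
point outside `K(-r₂)` is within `r₂` of the complement of `K`, while every point of `K(-(r₂+u))` is
at distance at least `r₂ + u` from it. -/
theorem thickening_collar_subset (K : Set M) {r₁ r₂ u : ℝ} (hr₁ : 0 ≤ r₁) (hr₂ : 0 ≤ r₂)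
    (hu : 0 < u) :
    Metric.thickening u (Metric.cthickening r₁ K \ innerPen K r₂)
      ⊆ Metric.cthickening (r₁ + u) K \ innerPen K (r₂ + u) := by
  intro y hy
  obtain ⟨x, ⟨hx1, hx2⟩, hyx⟩ := Metric.mem_thickening_iff.1 hy
  have he : edist y x ≤ ENNReal.ofReal u := by
    rw [edist_dist]; exact ENNReal.ofReal_le_ofReal hyx.le
  have he' : edist y x < ENNReal.ofReal u := by
    rw [edist_dist]; exact (ENNReal.ofReal_lt_ofReal_iff hu).2 hyx
  constructor
  · rw [Metric.mem_cthickening_iff] at hx1 ⊢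
    calc Metric.infEDist y K ≤ Metric.infEDist x K + edist y x :=
          Metric.infEDist_le_infEDist_add_edist
      _ ≤ ENNReal.ofReal r₁ + ENNReal.ofReal u := add_le_add hx1 he
      _ = _ := (ENNReal.ofReal_add hr₁ hu.le).symm
  · intro hy'
    have h1 : x ∈ Metric.cthickening r₂ Kᶜ := by
      by_contra h
      exact hx2 (subset_closure h)
    rw [Metric.mem_cthickening_iff] at h1
    have h2 : Metric.infEDist y Kᶜ < ENNReal.ofReal (r₂ + u) := by
      rw [ENNReal.ofReal_add hr₂ hu.le]
      exact Metric.infEDist_le_infEDist_add_edist.trans_lt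
        (ENNReal.add_lt_add_of_le_of_lt (h1.trans_lt ENNReal.ofReal_lt_top).ne h1 he')
    have h3 : innerPen K (r₂ + u) ⊆ {z | ENNReal.ofReal (r₂ + u) ≤ Metric.infEDist z Kᶜ} := by
      refine closure_minimal ?_ (isClosed_le continuous_const Metric.continuous_infEDist)
      intro z hz
      rw [mem_compl_iff, Metric.mem_cthickening_iff, not_le] at hz
      exact hz.le
    exact absurd (h3 hy') (not_le.2 h2)

theorem cthickening_subset_union_collar {K : Set M} (hK : IsClosed K) (r : ℝ) :
    Metric.cthickening r K ⊆ K ∪ (Metric.cthickening r K \ innerPen K 1) := by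
  intro x hx
  by_cases h : x ∈ K
  · exact Or.inl h
  · exact Or.inr ⟨hx, fun h' => h (innerPen_subset hK 1 h')⟩

/-- If `K_k` had infinite volume, the ratio would be `∞`, or else `∞/∞`, which is `0` by convention;
both lie outside the neighbourhood `(0, 2)` of `1`. -/
theorem RegularExhaustion.eventually_lt_top :
    ∀ᶠ k in atTop, μ (𝒦.K k) < ⊤ := by
  have h1 := 𝒦.tendsto_ratio 1 one_pos
  have h2 : ∀ᶠ k in atTop, μ (Metric.cthickening 1 (𝒦.K k)) / μ (innerPen (𝒦.K k) 1)
      ∈ Ioo 0 2 := h1.eventually (Ioo_mem_nhds one_pos (by norm_num))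
  filter_upwards [h2] with k hk
  rw [lt_top_iff_ne_top]
  intro htop
  have h3 : μ (Metric.cthickening 1 (𝒦.K k)) = ⊤ :=
    top_le_iff.1 (htop ▸ measure_mono (Metric.self_subset_cthickening _))
  rw [h3] at hk
  by_cases h4 : μ (innerPen (𝒦.K k) 1) = ⊤
  · rw [h4] at hk; simp at hk
  · rw [ENNReal.top_div_of_ne_top h4] at hk
    exact absurd hk.2 (by simp)

theorem exists_nnreal_mul_ge {a m : ℝ≥0∞} (ha : a < ⊤) (h : m = 0 → a = 0) :
    ∃ c : ℝ≥0, a ≤ c * m := by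
  rcases eq_or_ne m 0 with h0 | h0
  · exact ⟨0, by simp [h h0]⟩
  · rcases eq_or_ne m ⊤ with h1 | h1
    · exact ⟨1, by simp [h1]⟩
    · have : a / m ≠ ⊤ := (ENNReal.div_lt_top ha.ne h0).ne
      refine ⟨(a / m).toNNReal, ?_⟩
      rw [ENNReal.coe_toNNReal this, ENNReal.div_mul_cancel h0 h1]

/-- The cone requires one constant for all `k`, whereas estimates by collars hold only for large
`k`; the remaining indices are finite in number. -/
theorem exists_bound_of_eventually {a m : ℕ → ℝ≥0∞} (h1 : ∀ k, ∃ c : ℝ≥0, a k ≤ c * m k) {c : ℝ≥0}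
    (h2 : ∀ᶠ k in atTop, a k ≤ c * m k) : ∃ c : ℝ≥0, 0 < c ∧ ∀ k, a k ≤ c * m k := by
  choose d hd using h1
  obtain ⟨N, hN⟩ := eventually_atTop.1 h2
  refine ⟨c + ∑ j ∈ Finset.range N, d j + 1, by positivity, fun k => ?_⟩
  rcases le_or_gt N k with hk | hk
  · refine (hN k hk).trans ?_
    gcongr
    rw [add_assoc]
    exact le_self_add
  · refine (hd k).trans ?_
    gcongr
    calc d k ≤ ∑ j ∈ Finset.range N, d j :=
          Finset.single_le_sum (fun _ _ => zero_le) (Finset.mem_range.2 hk)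
      _ ≤ _ := le_add_right le_add_self

variable {𝒦}

theorem MemRoeCone.ratio_le {T : L2 Fm E μ →L[ℂ] L2 Fm E μ} (hT : MemRoeCone 𝒦 T) :
    ∃ c : ℝ≥0, ∀ k, localTrace T (𝒦.K k) / μ (𝒦.K k) ≤ c := by
  obtain ⟨c, -, hc⟩ := hT.bounded
  exact ⟨c, fun k => ENNReal.div_le_of_le_mul (hc k)⟩

theorem MemRoeCone.ratio_ne_top {T : L2 Fm E μ →L[ℂ] L2 Fm E μ} (hT : MemRoeCone 𝒦 T) (k : ℕ) :
    localTrace T (𝒦.K k) / μ (𝒦.K k) ≠ ⊤ := by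
  obtain ⟨c, hc⟩ := hT.ratio_le
  exact ((hc k).trans_lt ENNReal.coe_lt_top).ne

theorem memRoeCone_zero : MemRoeCone 𝒦 (0 : L2 Fm E μ →L[ℂ] L2 Fm E μ) where
  isPositive := (ContinuousLinearMap.nonneg_iff_isPositive _).1 le_rfl
  locallyTraceClass C _ := by rw [localTrace_zero]; exact ENNReal.zero_lt_top
  bounded := ⟨1, one_pos, fun k => by rw [localTrace_zero]; exact zero_le⟩
  tendsto_boundary r₁ r₂ _ _ := by simp [localTrace_zero]

theorem MemRoeCone.add {S T : L2 Fm E μ →L[ℂ] L2 Fm E μ} (hS : MemRoeCone 𝒦 S)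
    (hT : MemRoeCone 𝒦 T) : MemRoeCone 𝒦 (S + T) := by
  have hS0 : 0 ≤ S := (ContinuousLinearMap.nonneg_iff_isPositive _).2 hS.isPositive
  have hT0 : 0 ≤ T := (ContinuousLinearMap.nonneg_iff_isPositive _).2 hT.isPositive
  refine ⟨hS.isPositive.add hT.isPositive, fun C hC => ?_, ?_, fun r₁ r₂ h₁ h₂ => ?_⟩
  · rw [localTrace_add hS0 hT0 hC.isClosed.measurableSet]
    exact ENNReal.add_lt_top.2 ⟨hS.locallyTraceClass C hC, hT.locallyTraceClass C hC⟩
  · obtain ⟨c, hc, hcS⟩ := hS.bounded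
    obtain ⟨d, hd, hdT⟩ := hT.bounded
    refine ⟨c + d, by positivity, fun k => ?_⟩
    rw [localTrace_add hS0 hT0 (𝒦.measurableSet k), ENNReal.coe_add, add_mul]
    exact add_le_add (hcS k) (hdT k)
  · have := (hS.tendsto_boundary r₁ r₂ h₁ h₂).add (hT.tendsto_boundary r₁ r₂ h₁ h₂)
    rw [add_zero] at this
    refine this.congr fun k => ?_
    rw [localTrace_add hS0 hT0 (measurableSet_collar _ _ _), ENNReal.add_div]

theorem localTrace_mono {S T : L2 Fm E μ →L[ℂ] L2 Fm E μ} (hS : 0 ≤ S) (hST : S ≤ T) {X : Set M}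
    (hX : MeasurableSet X) : localTrace S X ≤ localTrace T X := by
  have := localTrace_add hS (sub_nonneg.2 hST) hX
  rw [add_sub_cancel] at this
  rw [this]
  exact le_self_add

/-- The cone is hereditary; this makes `φ` additive even where it is infinite. -/
theorem MemRoeCone.of_le {S T : L2 Fm E μ →L[ℂ] L2 Fm E μ} (hT : MemRoeCone 𝒦 T) (hS : 0 ≤ S)
    (hST : S ≤ T) : MemRoeCone 𝒦 S := by
  refine ⟨(ContinuousLinearMap.nonneg_iff_isPositive _).1 hS, fun C hC => ?_, ?_,
    fun r₁ r₂ h₁ h₂ => ?_⟩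
  · exact (localTrace_mono hS hST hC.isClosed.measurableSet).trans_lt (hT.locallyTraceClass C hC)
  · obtain ⟨c, hc, hcT⟩ := hT.bounded
    exact ⟨c, hc, fun k => (localTrace_mono hS hST (𝒦.measurableSet k)).trans (hcT k)⟩
  · refine tendsto_of_tendsto_of_tendsto_of_le_of_le tendsto_const_nhds
      (hT.tendsto_boundary r₁ r₂ h₁ h₂) (fun _ => zero_le) fun k => ?_
    exact ENNReal.div_le_div_right (localTrace_mono hS hST (measurableSet_collar _ _ _)) _

theorem MemRoeCone.smul {T : L2 Fm E μ →L[ℂ] L2 Fm E μ} (hT : MemRoeCone 𝒦 T) {r : ℝ}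
    (hr : 0 < r) : MemRoeCone 𝒦 ((r : ℂ) • T) := by
  have hT0 : 0 ≤ T := (ContinuousLinearMap.nonneg_iff_isPositive _).2 hT.isPositive
  refine ⟨(ContinuousLinearMap.nonneg_iff_isPositive _).1 (coe_smul_nonneg hr.le hT0),
    fun C hC => ?_, ?_, fun r₁ r₂ h₁ h₂ => ?_⟩
  · rw [localTrace_smul hr.le]
    exact ENNReal.mul_lt_top ENNReal.ofReal_lt_top (hT.locallyTraceClass C hC)
  · obtain ⟨c, hc, hcT⟩ := hT.bounded
    refine ⟨r.toNNReal * c, mul_pos (Real.toNNReal_pos.2 hr) hc, fun k => ?_⟩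
    rw [localTrace_smul hr.le, ENNReal.coe_mul, mul_assoc]
    exact mul_le_mul_right (hcT k) _
  · have := ENNReal.Tendsto.const_mul (a := ENNReal.ofReal r) (hT.tendsto_boundary r₁ r₂ h₁ h₂)
      (Or.inr ENNReal.ofReal_ne_top)
    rw [mul_zero] at this
    refine this.congr fun k => ?_
    rw [localTrace_smul hr.le, mul_div_assoc]

/-- The mass of `VCC⋆V⋆` on a set is at most the mass of `CC⋆` on the `(u+1)`-neighbourhood of this
set. For `K_k` this neighbourhood is covered by `K_k` and a collar; for a collar it lies in a larger
collar, whose mass is still negligible. -/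
theorem MemRoeCone.conj [SigmaCompactSpace M] {V C : L2 Fm E μ →L[ℂ] L2 Fm E μ}
    (hC : MemRoeCone 𝒦 (C * star C)) {u : ℝ} (hu : 0 < u) (hVn : ‖V‖ ≤ 1)
    (hV : ∀ K : Set M, IsCompact K → ∀ f : L2 Fm E μ,
      SuppIn f K → SuppIn (V f) (Metric.cthickening u K)) :
    MemRoeCone 𝒦 (V * C * star (V * C)) ∧ ∀ k, localTrace (V * C * star (V * C)) (𝒦.K k)
      / μ (𝒦.K k) ≤ localTrace (C * star C) (𝒦.K k) / μ (𝒦.K k) + localTrace (C * star C)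
        (Metric.cthickening (u + 1) (𝒦.K k) \ innerPen (𝒦.K k) 1) / μ (𝒦.K k) := by
  have hcth : ∀ (r : ℝ) (K : Set M), MeasurableSet (Metric.cthickening r K) := fun r K =>
    Metric.isClosed_cthickening.measurableSet
  have hmain : ∀ k, localTrace (V * C * star (V * C)) (𝒦.K k) ≤ localTrace (C * star C) (𝒦.K k)
      + localTrace (C * star C) (Metric.cthickening (u + 1) (𝒦.K k) \ innerPen (𝒦.K k) 1) := by
    intro k
    rw [localTrace_mul_star (𝒦.measurableSet k), localTrace_mul_star (𝒦.measurableSet k),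
      localTrace_mul_star (measurableSet_collar _ _ _)]
    exact (hsSq_proj_mul_le_of_propagation hu hVn hV (𝒦.measurableSet k) (hcth (u + 1) _)
      (Metric.thickening_subset_cthickening _ _) C).trans
      (hsSq_proj_mul_le_add (hcth (u + 1) _) (𝒦.measurableSet k) (measurableSet_collar _ _ _)
      (cthickening_subset_union_collar (𝒦.isCompact k).isClosed _) C)
  have hloc : ∀ C₀ : Set M, IsCompact C₀ → localTrace (V * C * star (V * C)) C₀ < ⊤ := by
    intro C₀ hC₀
    rcases C₀.eq_empty_or_nonempty with rfl | ⟨x₀, hx₀⟩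
    · rw [localTrace_of_null _ MeasurableSet.empty measure_empty]
      exact ENNReal.zero_lt_top
    -- Chosen so that, as soon as `K_k` contains `x₀`, the `(u+1)`-neighbourhood of `C₀` lies in
    -- `K_k(r)`. The collar part has finite mass for large `k`, since its ratio to a finite volume
    -- is below `1`.
    set r : ℝ := Metric.diam C₀ + u + 2 with hr
    have hd : 0 ≤ Metric.diam C₀ := Metric.diam_nonneg
    have hr0 : 0 < r := by positivity
    have hx : ∀ᶠ k in atTop, x₀ ∈ 𝒦.K k := by
      have : x₀ ∈ ⋃ k, 𝒦.K k := by rw [𝒦.iUnion_eq]; trivial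
      obtain ⟨k₀, hk₀⟩ := mem_iUnion.1 this
      filter_upwards [eventually_ge_atTop k₀] with k hk
      exact 𝒦.monotone hk hk₀
    have hb := (hC.tendsto_boundary r 1 hr0 one_pos).eventually (gt_mem_nhds one_pos)
    obtain ⟨k, hk1, hk2, hk3⟩ := (hx.and (𝒦.eventually_lt_top.and hb)).exists
    have hsub : Metric.thickening (u + 1) C₀ ⊆ Metric.cthickening r (𝒦.K k) := by
      intro y hy
      obtain ⟨z, hz, hyz⟩ := Metric.mem_thickening_iff.1 hy
      refine Metric.mem_cthickening_of_dist_le y x₀ _ _ hk1 ?_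
      have h1 := Metric.dist_le_diam_of_mem hC₀.isBounded hz hx₀
      have h2 := dist_triangle y z x₀
      linarith
    rw [localTrace_mul_star hC₀.isClosed.measurableSet]
    refine (hsSq_proj_mul_le_of_propagation hu hVn hV hC₀.isClosed.measurableSet (hcth r _)
      hsub C).trans_lt ((hsSq_proj_mul_le_add (hcth r _) (𝒦.measurableSet k)
      (measurableSet_collar _ r 1) (cthickening_subset_union_collar (𝒦.isCompact k).isClosed _)
      C).trans_lt ?_)
    rw [← localTrace_mul_star (𝒦.measurableSet k), ← localTrace_mul_star (measurableSet_collar _ _ _)]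
    refine ENNReal.add_lt_top.2 ⟨hC.locallyTraceClass _ (𝒦.isCompact k), ?_⟩
    rw [lt_top_iff_ne_top]
    intro htop
    rw [htop, ENNReal.top_div_of_ne_top hk2.ne] at hk3
    exact absurd hk3 (by simp)
  refine ⟨⟨(ContinuousLinearMap.nonneg_iff_isPositive _).1 (mul_star_self_nonneg _), hloc, ?_,
    fun r₁ r₂ h₁ h₂ => ?_⟩, fun k => ?_⟩
  · obtain ⟨c, hc, hcT⟩ := hC.bounded
    -- For large `k` the mass of the collar is at most the volume of `K_k`, whence `c + 1`. For the
    -- other `k` the local trace is finite, and it vanishes when the volume does.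
    refine exists_bound_of_eventually (c := c + 1) (fun k => exists_nnreal_mul_ge
      (hloc _ (𝒦.isCompact k)) fun h => localTrace_of_null _ (𝒦.measurableSet k) h) ?_
    have hb := (hC.tendsto_boundary (u + 1) 1 (by positivity) one_pos).eventually
      (gt_mem_nhds one_pos)
    filter_upwards [hb] with k hk
    refine (hmain k).trans ?_
    rw [ENNReal.coe_add, add_mul]
    refine add_le_add (hcT k) ?_
    have := (ENNReal.div_le_iff_le_mul (Or.inr ENNReal.one_ne_top) (Or.inr one_ne_zero)).1 hk.le
    simpa using this
  · refine tendsto_of_tendsto_of_tendsto_of_le_of_le tendsto_const_nhds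
      (hC.tendsto_boundary (r₁ + (u + 1)) (r₂ + (u + 1)) (by positivity) (by positivity))
      (fun _ => zero_le) fun k => ?_
    refine ENNReal.div_le_div_right ?_ _
    rw [localTrace_mul_star (measurableSet_collar _ _ _),
      localTrace_mul_star (measurableSet_collar _ _ _)]
    exact hsSq_proj_mul_le_of_propagation hu hVn hV (measurableSet_collar _ _ _)
      (measurableSet_collar _ _ _) (thickening_collar_subset _ h₁.le h₂.le (by positivity)) C
  · rw [← ENNReal.add_div]
    exact ENNReal.div_le_div_right (hmain k) _

variable (Lim : GeneralizedLimit)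

theorem roeFunctional_of_mem {T : L2 Fm E μ →L[ℂ] L2 Fm E μ} (hT : MemRoeCone 𝒦 T) :
    roeFunctional 𝒦 Lim T = ENNReal.ofReal (Lim.toLinearMap ⟨_, hT.memℓp⟩).re := dif_pos hT

theorem roeFunctional_of_notMem {T : L2 Fm E μ →L[ℂ] L2 Fm E μ} (hT : ¬ MemRoeCone 𝒦 T) :
    roeFunctional 𝒦 Lim T = ⊤ := dif_neg hT

/-- Inside the cone the ratios are finite and add up. If one summand is outside, so is the sum, by
heredity, and both sides are infinite. -/
theorem isWeight_roeFunctional [SigmaCompactSpace M] :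
    IsWeight (roeOnAlmostLocal (Fm := Fm) (E := E) 𝒦 Lim) where
  map_zero := by
    change roeFunctional 𝒦 Lim 0 = 0
    rw [roeFunctional_of_mem Lim memRoeCone_zero, Lim.re_eq_zero, ENNReal.ofReal_zero]
    simp [localTrace_zero]
  map_add a b ha hb := by
    change roeFunctional 𝒦 Lim (a.1 + b.1) = roeFunctional 𝒦 Lim a.1 + roeFunctional 𝒦 Lim b.1
    have ha' : 0 ≤ a.1 := ha
    have hb' : 0 ≤ b.1 := hb
    generalize a.1 = S at ha' ⊢
    generalize b.1 = T at hb' ⊢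
    by_cases h1 : MemRoeCone 𝒦 S
    · by_cases h2 : MemRoeCone 𝒦 T
      · rw [roeFunctional_of_mem Lim h1, roeFunctional_of_mem Lim h2,
          roeFunctional_of_mem Lim (h1.add h2), ← ENNReal.ofReal_add
          (Lim.re_nonneg _ fun _ => ENNReal.toReal_nonneg)
          (Lim.re_nonneg _ fun _ => ENNReal.toReal_nonneg)]
        congr 1
        refine Lim.re_add _ _ _ fun k => ?_
        rw [localTrace_add ha' hb' (𝒦.measurableSet k), ENNReal.add_div,
          ENNReal.toReal_add (h1.ratio_ne_top k) (h2.ratio_ne_top k)]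
      · rw [roeFunctional_of_notMem Lim h2, add_top]
        exact roeFunctional_of_notMem Lim fun h =>
          h2 (h.of_le hb' (le_add_of_nonneg_left ha'))
    · rw [roeFunctional_of_notMem Lim h1, top_add]
      exact roeFunctional_of_notMem Lim fun h =>
        h1 (h.of_le ha' (le_add_of_nonneg_right hb'))
  map_smul r a hr ha := by
    change roeFunctional 𝒦 Lim ((r : ℂ) • a.1) = _ * roeFunctional 𝒦 Lim a.1
    generalize a.1 = T
    by_cases h1 : MemRoeCone 𝒦 T
    · rw [roeFunctional_of_mem Lim h1, roeFunctional_of_mem Lim (h1.smul hr),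
        ← ENNReal.ofReal_mul hr.le]
      congr 1
      refine Lim.re_smul _ _ fun k => ?_
      rw [localTrace_smul hr.le, mul_div_assoc, ENNReal.toReal_mul, ENNReal.toReal_ofReal hr.le]
    · rw [roeFunctional_of_notMem Lim h1, ENNReal.mul_top (by simpa using hr)]
      refine roeFunctional_of_notMem Lim fun h => h1 ?_
      have := h.smul (inv_pos.2 hr)
      rwa [smul_smul, ← Complex.ofReal_mul, inv_mul_cancel₀ hr.ne', Complex.ofReal_one,
        one_smul] at this

/-- By `MemRoeCone.conj` the ratios for `VCC⋆V⋆` exceed those for `CC⋆` by the relative mass of a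
collar, which tends to `0` and is not seen by the generalized limit. -/
theorem roeFunctional_conj_le [SigmaCompactSpace M] (v : almostLocal Fm E μ)
    (hv : v ∈ finitePropagationSet Fm E μ) (hvn : ‖v‖ ≤ 1) (a : almostLocal Fm E μ) (ha : 0 ≤ a) :
    roeOnAlmostLocal 𝒦 Lim (v * a * star v) ≤ roeOnAlmostLocal 𝒦 Lim a := by
  change roeFunctional 𝒦 Lim (v.1 * a.1 * star v.1) ≤ roeFunctional 𝒦 Lim a.1
  have ha' : 0 ≤ a.1 := ha
  have hvn' : ‖v.1‖ ≤ 1 := hvn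
  obtain ⟨u, hu, hV⟩ := hv
  obtain ⟨C, hC⟩ := exists_eq_mul_star ha'
  rw [hC]
  generalize v.1 = V at hvn' hV ⊢
  by_cases h1 : MemRoeCone 𝒦 (C * star C)
  · obtain ⟨h2, h3⟩ := h1.conj hu hvn' hV
    have e : V * (C * star C) * star V = V * C * star (V * C) := by
      rw [star_mul]; noncomm_ring
    rw [e, roeFunctional_of_mem Lim h1, roeFunctional_of_mem Lim h2]
    refine ENNReal.ofReal_le_ofReal ?_
    have hb := h1.tendsto_boundary (u + 1) 1 (by positivity) one_pos
    have hb' := (ENNReal.tendsto_toReal ENNReal.zero_ne_top).comp hb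
    rw [ENNReal.toReal_zero] at hb'
    refine Lim.re_le_re _ _ hb' ?_
    filter_upwards [hb.eventually (gt_mem_nhds one_pos)] with k hk
    have hk' := (hk.trans ENNReal.one_lt_top).ne
    rw [Function.comp_apply, ← ENNReal.toReal_add (h1.ratio_ne_top k) hk']
    exact ENNReal.toReal_mono (ENNReal.add_ne_top.2 ⟨h1.ratio_ne_top k, hk'⟩) (h3 k)
  · rw [roeFunctional_of_notMem Lim h1]
    exact le_top

/-- The functional of Roe vanishes on positive trace class operators, if the volume is infinite. -/
theorem roeFunctional_eq_zero (hμ : μ univ = ⊤) {C : L2 Fm E μ →L[ℂ] L2 Fm E μ}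
    (hC : hsSq C < ⊤) : roeFunctional 𝒦 Lim (C * star C) = 0 := by
  have hle : ∀ S : Set M, MeasurableSet S → localTrace (C * star C) S ≤ hsSq C := by
    intro S hS
    rw [localTrace_mul_star hS]
    exact hsSq_mul_le_of_norm_le_one (opNorm_proj_le S) C
  -- All local traces are bounded by `hsSq C`, so growing volumes send every ratio, collars
  -- included, to `0`.
  have hvol : Tendsto (fun k => μ (𝒦.K k)) atTop (𝓝 ⊤) := by
    have := tendsto_measure_iUnion_atTop (μ := μ) 𝒦.monotone
    rwa [𝒦.iUnion_eq, hμ] at this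
  have hzero : Tendsto (fun k => hsSq C / μ (𝒦.K k)) atTop (𝓝 0) := by
    have := ENNReal.Tendsto.const_div (a := hsSq C) hvol (Or.inr hC.ne)
    rwa [ENNReal.div_top] at this
  have hmem : MemRoeCone 𝒦 (C * star C) := by
    refine ⟨(ContinuousLinearMap.nonneg_iff_isPositive _).1 (mul_star_self_nonneg _),
      fun C₀ hC₀ => (hle C₀ hC₀.isClosed.measurableSet).trans_lt hC, ?_, fun r₁ r₂ _ _ => ?_⟩
    · refine exists_bound_of_eventually (c := 1) (fun k => exists_nnreal_mul_ge
        ((hle _ (𝒦.measurableSet k)).trans_lt hC)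
        fun h => localTrace_of_null _ (𝒦.measurableSet k) h) ?_
      filter_upwards [hvol.eventually (lt_mem_nhds hC)] with k hk
      rw [ENNReal.coe_one, one_mul]
      exact (hle _ (𝒦.measurableSet k)).trans hk.le
    · exact tendsto_of_tendsto_of_tendsto_of_le_of_le tendsto_const_nhds hzero
        (fun _ => zero_le) fun k => ENNReal.div_le_div_right (hle _ (measurableSet_collar _ _ _)) _
  rw [roeFunctional_of_mem Lim hmem, Lim.re_eq_zero, ENNReal.ofReal_zero]
  have h1 : Tendsto (fun k => localTrace (C * star C) (𝒦.K k) / μ (𝒦.K k)) atTop (𝓝 0) :=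
    tendsto_of_tendsto_of_tendsto_of_le_of_le tendsto_const_nhds hzero
      (fun _ => zero_le) fun k => ENNReal.div_le_div_right (hle _ (𝒦.measurableSet k)) _
  exact (ENNReal.tendsto_toReal ENNReal.zero_ne_top).comp h1

end RoeCone

/-! ### Compact operators -/

section Compact

variable {H : Type*} [NormedAddCommGroup H] [InnerProductSpace ℂ H] [CompleteSpace H]

/-- The image of the unit ball under `T` has a finite `ε`-net, so a contraction that is small on the
net is small on the whole image. It will be applied to `1 - P` for a finite-rank projection `P` and
to `1 - E_K` for a large compact set `K`. -/
theorem exists_finite_norm_mul_le {T : H →L[ℂ] H} (hT : IsCompactOperator T) {ε : ℝ} (hε : 0 < ε) :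
    ∃ t : Set H, t.Finite ∧ ∀ A : H →L[ℂ] H, ‖A‖ ≤ 1 → (∀ y ∈ t, ‖A y‖ ≤ ε) →
      ‖A * T‖ ≤ 2 * ε := by
  have hc : IsCompact (closure (T '' Metric.closedBall 0 1)) :=
    hT.isCompact_closure_image_closedBall (f := (T : H →ₗ[ℂ] H)) 1
  obtain ⟨t, -, htf, ht⟩ := hc.finite_cover_balls hε
  refine ⟨t, htf, fun A hA hAt => ContinuousLinearMap.opNorm_le_of_unit_norm (by positivity)
    fun x hx => ?_⟩
  have hx' : T x ∈ closure (T '' Metric.closedBall 0 1) :=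
    subset_closure ⟨x, by simp [hx], rfl⟩
  obtain ⟨y, hy, hxy⟩ := mem_iUnion₂.1 (ht hx')
  rw [Metric.mem_ball, dist_eq_norm] at hxy
  have h1 : (A * T) x = A (T x - y) + A y := by
    rw [← map_add, sub_add_cancel]
    rfl
  rw [h1]
  have h2 : ‖A (T x - y)‖ ≤ 1 * ε :=
    (A.le_opNorm _).trans (mul_le_mul hA hxy.le (norm_nonneg _) zero_le_one)
  linarith [norm_add_le (A (T x - y)) (A y), hAt y hy]

/-- The projection on the span of the net fixes the net, so its complement annihilates it. -/
theorem exists_finiteDimensional_norm_sub_le {T : H →L[ℂ] H} (hT : IsCompactOperator T) {ε : ℝ}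
    (hε : 0 < ε) : ∃ V : Submodule ℂ H, ∃ _ : FiniteDimensional ℂ V,
      ‖T - V.starProjection * T‖ ≤ ε := by
  obtain ⟨t, htf, ht⟩ := exists_finite_norm_mul_le hT (half_pos hε)
  have hfd : FiniteDimensional ℂ (Submodule.span ℂ t) := FiniteDimensional.span_of_finite ℂ htf
  refine ⟨Submodule.span ℂ t, hfd, ?_⟩
  have h := ht (1 - (Submodule.span ℂ t).starProjection) ?_ fun y hy => ?_
  · rwa [sub_mul, one_mul, mul_div_cancel₀ _ (two_ne_zero' ℝ)] at h
  · have := Submodule.starProjection_orthogonal' (𝕜 := ℂ) (Submodule.span ℂ t)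
    rw [← this]
    exact Submodule.starProjection_norm_le _
  · have h1 : (Submodule.span ℂ t).starProjection y = y :=
      Submodule.starProjection_eq_self_iff.2 (Submodule.subset_span hy)
    rw [sub_apply, one_apply_eq_self, h1, sub_self, norm_zero]
    positivity

theorem isCompactOperator_starProjection (V : Submodule ℂ H) [FiniteDimensional ℂ V] :
    IsCompactOperator (V.starProjection : H →L[ℂ] H) := by
  have : ProperSpace V := FiniteDimensional.proper ℂ V
  exact (isCompactOperator_of_locallyCompactSpace_rng V.subtypeL).comp_clm
    V.orthogonalProjectionOnto

/-- `T` is a norm limit of operators `P T` with `P` of finite rank, so `T⋆` is a norm limit of the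
compact operators `T⋆ P`. -/
theorem isCompactOperator_star {T : H →L[ℂ] H} (hT : IsCompactOperator T) :
    IsCompactOperator (star T : H →L[ℂ] H) := by
  have hcl : IsClosed {f : H →L[ℂ] H | IsCompactOperator f} := by
    exact isClosed_setOfPred_isCompactOperator
  have h : star T ∈ closure {f : H →L[ℂ] H | IsCompactOperator f} := by
    rw [Metric.mem_closure_iff]
    intro ε hε
    obtain ⟨V, hV, h⟩ := exists_finiteDimensional_norm_sub_le hT (half_pos hε)
    refine ⟨star T * V.starProjection, (isCompactOperator_starProjection V).clm_comp (star T), ?_⟩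
    rw [dist_eq_norm]
    have h2 : star T - star T * V.starProjection = star (T - V.starProjection * T) := by
      rw [star_sub, star_mul, (isSelfAdjoint_starProjection V).star_eq]
    rw [h2, norm_star]
    linarith
  rwa [hcl.closure_eq] at h

/-- Expanding in an orthonormal basis of `V` and exchanging the sums gives the sum of the squared
norms of the basis vectors, a finite sum. -/
theorem hsSq_starProjection_lt_top (V : Submodule ℂ H) [FiniteDimensional ℂ V] :
    hsSq (V.starProjection : H →L[ℂ] H) < ⊤ := by
  set b := (exists_hilbertBasis ℂ H).choose_spec.choose with hb
  let f := stdOrthonormalBasis ℂ V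
  have h1 : ∀ x : H, ‖V.starProjection x‖ₑ ^ 2 = ∑ j, ‖⟪((f j : V) : H), x⟫_ℂ‖ₑ ^ 2 := by
    intro x
    have h2 : ‖V.starProjection x‖ = ‖V.orthogonalProjectionOnto x‖ := rfl
    have h3 : ‖V.starProjection x‖ ^ 2 = ∑ j, ‖⟪((f j : V) : H), x⟫_ℂ‖ ^ 2 := by
      rw [h2, ← f.sum_sq_norm_inner_right]
      refine Finset.sum_congr rfl fun j _ => ?_
      rw [Submodule.inner_orthogonalProjectionOnto_eq_of_mem_left]
    rw [← ofReal_norm, ← ENNReal.ofReal_pow (norm_nonneg _), h3,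
      ENNReal.ofReal_sum_of_nonneg fun _ _ => by positivity]
    refine Finset.sum_congr rfl fun j _ => ?_
    rw [← ofReal_norm, ← ENNReal.ofReal_pow (norm_nonneg _)]
  have h4 : hsSq (V.starProjection : H →L[ℂ] H) = ∑ j, ‖((f j : V) : H)‖ₑ ^ 2 := by
    rw [hsSq]
    simp only [h1]
    rw [Summable.tsum_finsetSum fun _ _ => ENNReal.summable]
    refine Finset.sum_congr rfl fun j _ => ?_
    rw [← parseval_enorm b]
    refine tsum_congr fun i => ?_
    rw [← ofReal_norm, ← ofReal_norm, norm_inner_symm]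
  rw [h4]
  exact ENNReal.sum_lt_top.2 fun j _ => ENNReal.pow_lt_top enorm_lt_top

end Compact

/-! ### Compact operators are almost local and null -/

section CompactAlmostLocal

attribute [local instance] isClosed_almostLocal cstarAlgebra_almostLocal
  starOrderedRing_almostLocal

variable {M : Type*} [MetricSpace M] [SecondCountableTopology M] [MeasurableSpace M] [BorelSpace M]
  [SigmaCompactSpace M]
  {Fm : Type*} [NormedAddCommGroup Fm] [NormedSpace ℂ Fm] [FiniteDimensional ℂ Fm]
  {E : M → Type*} [∀ x, NormedAddCommGroup (E x)] [∀ x, InnerProductSpace ℂ (E x)]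
  [TopologicalSpace (TotalSpace Fm E)] [FiberBundle Fm E] [VectorBundle ℂ Fm E]
  [IsHermitianBundle Fm E] {μ : Measure M}

/-- Such an operator kills `f` when `K` misses the support. Otherwise its image lives in `K`, which
is within `diam K` of a common point; the `1` only makes the propagation positive. -/
theorem hasFinitePropagation_proj_mul_mul_proj {K : Set M} (hK : IsCompact K)
    (T : L2 Fm E μ →L[ℂ] L2 Fm E μ) :
    HasFinitePropagation (proj Fm E μ K * T * proj Fm E μ K) := by
  have hKm := hK.isClosed.measurableSet
  refine ⟨Metric.diam K + 1, by linarith [Metric.diam_nonneg (s := K)], fun C hC f hf => ?_⟩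
  have hf' : proj Fm E μ C f = f := hf
  by_cases h : (K ∩ C).Nonempty
  · obtain ⟨z, hzK, hzC⟩ := h
    refine SuppIn.mono hKm Metric.isClosed_cthickening.measurableSet (fun x hx => ?_)
      (suppIn_proj hKm _)
    refine Metric.mem_cthickening_of_dist_le x z _ _ hzC ?_
    linarith [Metric.dist_le_diam_of_mem hK.isBounded hx hzK]
  · have h0 : (proj Fm E μ K * T * proj Fm E μ K) f = 0 := by
      rw [mul_apply_eq_comp, ← hf', proj_proj hKm hC.isClosed.measurableSet,
        not_nonempty_iff_eq_empty.1 h, proj_empty, map_zero]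
    rw [SuppIn, h0, map_zero]

/-- The projections `E_K` tend strongly to `1` along an exhaustion; on the finite net attached to
`T` the convergence is uniform. -/
theorem exists_norm_proj_compl_mul_le {T : L2 Fm E μ →L[ℂ] L2 Fm E μ} (hT : IsCompactOperator T)
    {ε : ℝ} (hε : 0 < ε) :
    ∀ᶠ k in atTop, ‖T - proj Fm E μ (compactCovering M k) * T‖ ≤ 2 * ε := by
  have hm : ∀ k, MeasurableSet (compactCovering M k) := fun k =>
    (isCompact_compactCovering M k).isClosed.measurableSet
  obtain ⟨t, htf, ht⟩ := exists_finite_norm_mul_le hT hε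
  have h1 : ∀ᶠ k in atTop, ∀ y ∈ t, ‖y - proj Fm E μ (compactCovering M k) y‖ < ε := by
    rw [htf.eventually_all]
    intro y _
    have := tendsto_proj (μ := μ) (Fm := Fm) (E := E) hm
      (fun _ _ h => compactCovering_subset M h) (iUnion_compactCovering M) y
    filter_upwards [this.eventually (Metric.ball_mem_nhds y hε)] with k hk
    rwa [← dist_eq_norm, dist_comm]
  filter_upwards [h1] with k hk
  have h2 : ∀ f, (1 - proj Fm E μ (compactCovering M k)) f
      = proj Fm E μ (compactCovering M k)ᶜ f := fun f => by
    rw [sub_apply, one_apply_eq_self, sub_eq_iff_eq_add', proj_add_compl (hm k)]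
  have h := ht (1 - proj Fm E μ (compactCovering M k)) ?_ fun y hy => ?_
  · rwa [sub_mul, one_mul] at h
  · rw [show 1 - proj Fm E μ (compactCovering M k) = proj Fm E μ (compactCovering M k)ᶜ from
      ContinuousLinearMap.ext h2]
    exact opNorm_proj_le _
  · exact (hk y hy).le

/-- Cutting off on both sides: `T - PTP = (T - PT) + P(T - TP)`, where the second term is controlled
through the compact operator `T⋆`. -/
theorem mem_almostLocal_of_isCompactOperator {T : L2 Fm E μ →L[ℂ] L2 Fm E μ}
    (hT : IsCompactOperator T) : T ∈ almostLocal Fm E μ := by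
  change T ∈ closure {A | HasFinitePropagation A}
  rw [Metric.mem_closure_iff]
  intro ε hε
  obtain ⟨k, h1, h2⟩ := ((exists_norm_proj_compl_mul_le hT (ε := ε / 8) (by positivity)).and
    (exists_norm_proj_compl_mul_le (isCompactOperator_star hT) (ε := ε / 8) (by positivity))).exists
  set P := proj Fm E μ (compactCovering M k) with hP
  refine ⟨P * T * P, hasFinitePropagation_proj_mul_mul_proj (isCompact_compactCovering M k) T, ?_⟩
  have hsP : star P = P := star_proj (isCompact_compactCovering M k).isClosed.measurableSet
  have h3 : ‖T - T * P‖ ≤ 2 * (ε / 8) := by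
    rw [← norm_star, star_sub, star_mul, hsP]
    exact h2
  have h4 : T - P * T * P = (T - P * T) + P * (T - T * P) := by
    rw [mul_sub, ← mul_assoc]
    abel
  have h5 : ‖P * (T - T * P)‖ ≤ 1 * (2 * (ε / 8)) :=
    (norm_mul_le _ _).trans (mul_le_mul (opNorm_proj_le _) h3 (norm_nonneg _) zero_le_one)
  rw [dist_eq_norm, h4]
  linarith [norm_add_le (T - P * T) (P * (T - T * P))]

/-- For a finite-rank projection `P` with `PT` close to `T`, take `C = P T^{1/2}`: it is
Hilbert–Schmidt, and `C C⋆ = PTP` differs from `T` by at most `δ` in norm. -/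
theorem exists_hsSq_lt_top_le {H : Type*} [NormedAddCommGroup H] [InnerProductSpace ℂ H]
    [CompleteSpace H] {T : H →L[ℂ] H} (hT : IsCompactOperator T) (hT0 : 0 ≤ T) {δ : ℝ}
    (hδ : 0 < δ) : ∃ C : H →L[ℂ] H, hsSq C < ⊤ ∧ IsCompactOperator (C * star C : H →L[ℂ] H) ∧
      T ≤ C * star C + algebraMap ℝ _ δ := by
  obtain ⟨V, hV, h⟩ := exists_finiteDimensional_norm_sub_le hT (half_pos hδ)
  set P : H →L[ℂ] H := V.starProjection with hP
  have hsP : star P = P := (isSelfAdjoint_starProjection V).star_eq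
  have hTsa : star T = T := (IsSelfAdjoint.of_nonneg hT0).star_eq
  have e : P * CFC.sqrt T * star (P * CFC.sqrt T) = P * T * P := by
    rw [star_mul, star_sqrt, hsP]
    calc P * CFC.sqrt T * (CFC.sqrt T * P) = P * (CFC.sqrt T * CFC.sqrt T) * P := by
          simp only [mul_assoc]
      _ = _ := by rw [sqrt_mul_sqrt hT0]
  refine ⟨P * CFC.sqrt T, ?_, ?_, ?_⟩
  · rw [← hsSq_star, star_mul, star_sqrt, hsP]
    exact (hsSq_mul_le _ _).trans_lt
      (ENNReal.mul_lt_top (ENNReal.pow_lt_top enorm_lt_top) (hsSq_starProjection_lt_top V))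
  · rw [e]
    exact (isCompactOperator_starProjection V).clm_comp (P * T)
  · rw [e]
    have hsa : IsSelfAdjoint (P * T * P) := by
      rw [isSelfAdjoint_iff, star_mul, star_mul, hsP, hTsa, mul_assoc]
    refine (le_add_algebraMap_norm_sub (IsSelfAdjoint.of_nonneg hT0) hsa).trans ?_
    have h4 : T - P * T * P = (T - P * T) + P * (T - T * P) := by
      rw [mul_sub, ← mul_assoc]
      abel
    have h3 : ‖T - T * P‖ ≤ δ / 2 := by
      rw [← norm_star, star_sub, star_mul, hsP, hTsa]
      exact h
    have h5 : ‖P * (T - T * P)‖ ≤ 1 * (δ / 2) :=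
      (norm_mul_le _ _).trans (mul_le_mul (Submodule.starProjection_norm_le _) h3 (norm_nonneg _)
        zero_le_one)
    have h6 : ‖T - P * T * P‖ ≤ δ := by
      rw [h4]
      linarith [norm_add_le (T - P * T) (P * (T - T * P))]
    gcongr

/-- The theorem, for a measure `μ` of infinite total mass. -/
theorem roeTrace_properties (hμ : μ univ = ⊤) (𝒦 : RegularExhaustion μ) (Lim : GeneralizedLimit) :
    IsTrace (roeTrace Fm E 𝒦 Lim) ∧
      LowerSemicontinuousOn (roeTrace Fm E 𝒦 Lim) {T | 0 ≤ T} ∧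
      IsSemifinite (roeTrace Fm E 𝒦 Lim) ∧
      ∀ T : L2 Fm E μ →L[ℂ] L2 Fm E μ,
        IsCompactOperator T → ∃ hT : T ∈ almostLocal Fm E μ,
          (0 ≤ T → roeTrace Fm E 𝒦 Lim ⟨T, hT⟩ = 0) ∧
          ∃ hJ : (⟨T, hT⟩ : almostLocal Fm E μ) ∈ finiteSpan (roeTrace Fm E 𝒦 Lim),
            ∀ t : finiteSpan (roeTrace Fm E 𝒦 Lim) →ₗ[ℂ] ℂ,
              IsLinearExtension (roeTrace Fm E 𝒦 Lim) t → t ⟨⟨T, hT⟩, hJ⟩ = 0 := by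
  have hw := isWeight_roeFunctional (Fm := Fm) (E := E) (𝒦 := 𝒦) Lim
  have hc := roeFunctional_conj_le (Fm := Fm) (E := E) (𝒦 := 𝒦) Lim
  have hm := roeTrace_main (Fm := Fm) (E := E) 𝒦 Lim hw hc
  obtain ⟨h1, h2, h3, h4, h5⟩ := hm
  have key : ∀ (T : L2 Fm E μ →L[ℂ] L2 Fm E μ) (hT : T ∈ almostLocal Fm E μ),
      IsCompactOperator T → 0 ≤ T → roeTrace Fm E 𝒦 Lim ⟨T, hT⟩ = 0 := by
    intro T hT hTc hT0
    refine h4 ⟨T, hT⟩ hT0 fun δ hδ => ?_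
    obtain ⟨C, hC, hCc, hle⟩ := exists_hsSq_lt_top_le hTc hT0 hδ
    exact ⟨⟨C * star C, mem_almostLocal_of_isCompactOperator hCc⟩, mul_star_self_nonneg C, hle,
      roeFunctional_eq_zero Lim hμ hC⟩
  refine ⟨h1, h2, h3, fun T hT => ⟨mem_almostLocal_of_isCompactOperator hT, key T _ hT, ?_⟩⟩
  -- A general compact `T` is reached through the positive compact operator `T⋆T`, whose trace
  -- vanishes.
  refine h5 ⟨T, mem_almostLocal_of_isCompactOperator hT⟩ ?_
  exact key (star T * T) _ (hT.clm_comp (star T)) (star_mul_self_nonneg T)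

end CompactAlmostLocal

/-! ### Riemannian metrics on a vector space -/

section LocalGeometry

variable {V : Type*} [NormedAddCommGroup V] [NormedSpace ℝ V]

/-- The Euler–Lagrange expression of the energy of the metric `g`, at the position `y`, the velocity
`u` and the acceleration `a`, evaluated at `w`. -/
def energyForm (g : V → V →L[ℝ] V →L[ℝ] ℝ) (y u a w : V) : ℝ :=
  g y a w + fderiv ℝ g y u u w - (1 / 2) * fderiv ℝ g y w u u

theorem fderiv_apply_apply {g : V → V →L[ℝ] V →L[ℝ] ℝ} {y : V} (hg : DifferentiableAt ℝ g y)
    (u a b : V) : fderiv ℝ (fun z => g z a b) y u = fderiv ℝ g y u a b := by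
  have h := (hg.hasFDerivAt.clm_apply (hasFDerivAt_const a y)).clm_apply (hasFDerivAt_const b y)
  rw [h.fderiv]
  simp

set_option synthInstance.maxHeartbeats 200000 in
theorem fderiv_pullback {g g' : V → V →L[ℝ] V →L[ℝ] ℝ} {ψ : V → V} {y : V}
    (hψ : ContDiffAt ℝ 2 ψ y) (hg : DifferentiableAt ℝ g (ψ y)) (hg' : DifferentiableAt ℝ g' y)
    (h : ∀ᶠ z in 𝓝 y, ∀ a b, g' z a b = g (ψ z) (fderiv ℝ ψ z a) (fderiv ℝ ψ z b)) (u a b : V) :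
    fderiv ℝ g' y u a b = fderiv ℝ g (ψ y) (fderiv ℝ ψ y u) (fderiv ℝ ψ y a) (fderiv ℝ ψ y b)
      + g (ψ y) (fderiv ℝ (fderiv ℝ ψ) y u a) (fderiv ℝ ψ y b)
      + g (ψ y) (fderiv ℝ ψ y a) (fderiv ℝ (fderiv ℝ ψ) y u b) := by
  have hψ1 : HasFDerivAt ψ (fderiv ℝ ψ y) y := (hψ.differentiableAt (by norm_num)).hasFDerivAt
  have hψ2 : HasFDerivAt (fderiv ℝ ψ) (fderiv ℝ (fderiv ℝ ψ) y) y :=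
    ((hψ.fderiv_right (m := 1) (by norm_num)).differentiableAt (by norm_num)).hasFDerivAt
  have h0 : HasFDerivAt (fun z => g (ψ z)) ((fderiv ℝ g (ψ y)).comp (fderiv ℝ ψ y)) y :=
    HasFDerivAt.comp (g := g) y hg.hasFDerivAt hψ1
  have h1 := (h0.clm_apply (hψ2.clm_apply
    (hasFDerivAt_const a y))).clm_apply (hψ2.clm_apply (hasFDerivAt_const b y))
  rw [← fderiv_apply_apply hg', Filter.EventuallyEq.fderiv_eq (f := fun z =>
    g (ψ z) (fderiv ℝ ψ z a) (fderiv ℝ ψ z b)) (h.mono fun z hz => hz a b)]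
  rw [h1.fderiv]
  simp
  ring

/-- The Euler–Lagrange expression transforms as a covector: the second derivatives of the change of
coordinates cancel by their symmetry, except for the term absorbed in the acceleration. This makes
the geodesic equation independent of the chart, whereas `IsGeodesicAt` states it in the chart at the
moving point `γ t`. -/
theorem energyForm_pullback {g g' : V → V →L[ℝ] V →L[ℝ] ℝ} {ψ : V → V} {y : V}
    (hψ : ContDiffAt ℝ 2 ψ y) (hg : DifferentiableAt ℝ g (ψ y)) (hg' : DifferentiableAt ℝ g' y)
    (hs : ∀ a b, g (ψ y) a b = g (ψ y) b a)
    (h : ∀ᶠ z in 𝓝 y, ∀ a b, g' z a b = g (ψ z) (fderiv ℝ ψ z a) (fderiv ℝ ψ z b)) (u a w : V) :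
    energyForm g' y u a w = energyForm g (ψ y) (fderiv ℝ ψ y u)
      (fderiv ℝ ψ y a + fderiv ℝ (fderiv ℝ ψ) y u u) (fderiv ℝ ψ y w) := by
  have hsym : fderiv ℝ (fderiv ℝ ψ) y u w = fderiv ℝ (fderiv ℝ ψ) y w u :=
    (hψ.isSymmSndFDerivAt (by simp)).eq u w
  rw [energyForm, energyForm, fderiv_pullback hψ hg hg' h, fderiv_pullback hψ hg hg' h,
    h.self_of_nhds, map_add, add_apply, hsym, hs (fderiv ℝ ψ y u)]
  ring

/-- The curve `c` satisfies at `t` the Euler–Lagrange equation of the energy of `g`. -/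
def IsEnergyCriticalAt (g : V → V →L[ℝ] V →L[ℝ] ℝ) (c : ℝ → V) (t : ℝ) : Prop :=
  ∀ w, energyForm g (c t) (deriv c t) (deriv (deriv c) t) w = 0

theorem deriv_comp_eq {ψ : V → V} {c : ℝ → V} {t : ℝ} (hψ : DifferentiableAt ℝ ψ (c t))
    (hc : DifferentiableAt ℝ c t) : deriv (ψ ∘ c) t = fderiv ℝ ψ (c t) (deriv c t) :=
  (hψ.hasFDerivAt.comp_hasDerivAt t hc.hasDerivAt).deriv

theorem eventually_differentiableAt {W W' : Type*} [NormedAddCommGroup W] [NormedSpace ℝ W]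
    [NormedAddCommGroup W'] [NormedSpace ℝ W'] {f : W → W'} {x : W} {m : ℕ∞ω}
    (h : ContDiffAt ℝ m f x) (hm : 1 ≤ m) : ∀ᶠ z in 𝓝 x, DifferentiableAt ℝ f z := by
  have h1 : ContDiffAt ℝ 1 f x := h.of_le hm
  exact (h1.eventually (by simp)).mono fun z hz => hz.differentiableAt (by norm_num)

theorem deriv_deriv_comp_eq {ψ : V → V} {c : ℝ → V} {t : ℝ} (hψ : ContDiffAt ℝ 2 ψ (c t))
    (hc : ContDiffAt ℝ 2 c t) : deriv (deriv (ψ ∘ c)) t = fderiv ℝ ψ (c t) (deriv (deriv c) t)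
      + fderiv ℝ (fderiv ℝ ψ) (c t) (deriv c t) (deriv c t) := by
  have h1 : deriv (ψ ∘ c) =ᶠ[𝓝 t] fun s => fderiv ℝ ψ (c s) (deriv c s) := by
    filter_upwards [eventually_differentiableAt hc one_le_two,
      hc.continuousAt.eventually (eventually_differentiableAt hψ one_le_two)] with s hs hs'
    exact deriv_comp_eq hs' hs
  have hψ2 : HasFDerivAt (fderiv ℝ ψ) (fderiv ℝ (fderiv ℝ ψ) (c t)) (c t) :=
    ((hψ.fderiv_right (m := 1) (by norm_num)).differentiableAt (by norm_num)).hasFDerivAt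
  have hc1 : HasDerivAt c (deriv c t) t := (hc.differentiableAt (by norm_num)).hasDerivAt
  have hc2 : HasDerivAt (deriv c) (deriv (deriv c) t) t := by
    have h2 : ContDiffAt ℝ 1 (fderiv ℝ c) t := hc.fderiv_right (by norm_num)
    have h3 : DifferentiableAt ℝ (fun s => fderiv ℝ c s 1) t :=
      (h2.differentiableAt (by norm_num)).clm_apply (differentiableAt_const _)
    exact h3.hasDerivAt
  rw [h1.deriv_eq]
  have := ((hψ2.comp_hasDerivAt t hc1).clm_apply hc2).deriv
  rw [add_comm]
  exact this

theorem IsEnergyCriticalAt.comp {g g' : V → V →L[ℝ] V →L[ℝ] ℝ} {ψ : V → V} {c : ℝ → V} {t : ℝ}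
    (hc : ContDiffAt ℝ 2 c t) (hψ : ContDiffAt ℝ 2 ψ (c t)) (hg : DifferentiableAt ℝ g (ψ (c t)))
    (hg' : DifferentiableAt ℝ g' (c t)) (hs : ∀ a b, g (ψ (c t)) a b = g (ψ (c t)) b a)
    (h : ∀ᶠ z in 𝓝 (c t), ∀ a b, g' z a b = g (ψ z) (fderiv ℝ ψ z a) (fderiv ℝ ψ z b))
    (hsurj : Function.Surjective (fderiv ℝ ψ (c t))) (H : IsEnergyCriticalAt g' c t) :
    IsEnergyCriticalAt g (ψ ∘ c) t := by
  intro w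
  obtain ⟨w, rfl⟩ := hsurj w
  rw [deriv_comp_eq (hψ.differentiableAt (by norm_num)) (hc.differentiableAt (by norm_num)),
    deriv_deriv_comp_eq hψ hc, Function.comp_apply, ← energyForm_pullback hψ hg hg' hs h]
  exact H w

/-- `g` is a smooth Riemannian metric on the open set `U`, and `Γ` are its Christoffel symbols. -/
structure IsLeviCivitaOn (g : V → V →L[ℝ] V →L[ℝ] ℝ) (Γ : V → V →L[ℝ] V →L[ℝ] V) (U : Set V) :
    Prop where
  isOpen : IsOpen U
  contDiffOn_metric : ContDiffOn ℝ ∞ g U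
  contDiffOn_christoffel : ContDiffOn ℝ ∞ Γ U
  symm : ∀ y ∈ U, ∀ a b, g y a b = g y b a
  pos : ∀ y ∈ U, ∀ a, a ≠ 0 → 0 < g y a a
  koszul : ∀ y ∈ U, ∀ a b w, g y (Γ y a b) w
    = (1 / 2) * (fderiv ℝ g y a b w + fderiv ℝ g y b a w - fderiv ℝ g y w a b)

namespace IsLeviCivitaOn

variable {g : V → V →L[ℝ] V →L[ℝ] ℝ} {Γ : V → V →L[ℝ] V →L[ℝ] V} {U : Set V}
  (h : IsLeviCivitaOn g Γ U)
include h

theorem differentiableAt_metric {y : V} (hy : y ∈ U) : DifferentiableAt ℝ g y :=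
  (h.contDiffOn_metric.contDiffAt (h.isOpen.mem_nhds hy)).differentiableAt (by simp)

theorem differentiableAt_christoffel {y : V} (hy : y ∈ U) : DifferentiableAt ℝ Γ y :=
  (h.contDiffOn_christoffel.contDiffAt (h.isOpen.mem_nhds hy)).differentiableAt (by simp)

theorem nonneg {y : V} (hy : y ∈ U) (a : V) : 0 ≤ g y a a := by
  rcases eq_or_ne a 0 with rfl | ha
  · simp
  · exact (h.pos y hy a ha).le

theorem eq_zero_of_forall {y : V} (hy : y ∈ U) {a : V} (ha : ∀ w, g y a w = 0) : a = 0 := by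
  by_contra h0
  exact (h.pos y hy a h0).ne' (ha a)

/-- Cauchy–Schwarz for the metric, from the positivity of `g` on `g(b,b) a - g(a,b) b`. -/
theorem sq_le {y : V} (hy : y ∈ U) (a b : V) : g y a b ^ 2 ≤ g y a a * g y b b := by
  rcases eq_or_ne b 0 with rfl | hb
  · simp
  · have hb' := h.pos y hy b hb
    have h1 := h.nonneg hy (g y b b • a - g y a b • b)
    simp only [map_sub, map_smul, sub_apply, smul_apply,
      smul_eq_mul, h.symm y hy b a] at h1
    have h2 : 0 ≤ g y b b * (g y a a * g y b b - g y a b ^ 2) := by linarith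
    nlinarith [nonneg_of_mul_nonneg_right h2 hb']

theorem fderiv_symm {y : V} (hy : y ∈ U) (u a b : V) :
    fderiv ℝ g y u a b = fderiv ℝ g y u b a := by
  rw [← fderiv_apply_apply (h.differentiableAt_metric hy),
    ← fderiv_apply_apply (h.differentiableAt_metric hy)]
  congr 1
  refine Filter.EventuallyEq.fderiv_eq ?_
  filter_upwards [h.isOpen.mem_nhds hy] with z hz
  exact h.symm z hz a b

theorem fderiv_metric {y : V} (hy : y ∈ U) (u a b : V) :
    fderiv ℝ g y u a b = g y (Γ y u a) b + g y a (Γ y u b) := by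
  rw [h.symm y hy a, h.koszul y hy, h.koszul y hy, h.fderiv_symm hy u b a,
    h.fderiv_symm hy a u b, h.fderiv_symm hy b u a]
  have := h.fderiv_symm hy
  rw [this a b u, this b a u]
  ring

theorem christoffel_symm {y : V} (hy : y ∈ U) (a b : V) : Γ y a b = Γ y b a := by
  rw [← sub_eq_zero]
  refine h.eq_zero_of_forall hy fun w => ?_
  rw [map_sub, sub_apply, h.koszul y hy, h.koszul y hy, h.fderiv_symm hy w a b]
  ring

theorem energyForm_eq {y : V} (hy : y ∈ U) (u a w : V) :
    energyForm g y u a w = g y (a + Γ y u u) w := by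
  rw [map_add, add_apply, h.koszul y hy, energyForm]
  ring

theorem isEnergyCriticalAt_iff {c : ℝ → V} {t : ℝ} (hy : c t ∈ U) :
    IsEnergyCriticalAt g c t ↔ deriv (deriv c) t + Γ (c t) (deriv c t) (deriv c t) = 0 := by
  refine ⟨fun H => h.eq_zero_of_forall hy fun w => ?_, fun H w => ?_⟩
  · rw [← h.energyForm_eq hy]
    exact H w
  · rw [h.energyForm_eq hy, H, map_zero, zero_apply]

/-- The Levi-Civita connection is compatible with the metric. -/
theorem hasDerivAt_metric {c X Y : ℝ → V} {t : ℝ} {c' X' Y' : V} (hy : c t ∈ U)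
    (hc : HasDerivAt c c' t) (hX : HasDerivAt X X' t) (hY : HasDerivAt Y Y' t) :
    HasDerivAt (fun s => g (c s) (X s) (Y s))
      (g (c t) (X' + Γ (c t) c' (X t)) (Y t) + g (c t) (X t) (Y' + Γ (c t) c' (Y t))) t := by
  have h0 : HasDerivAt (fun s => g (c s)) (fderiv ℝ g (c t) c') t :=
    HasFDerivAt.comp_hasDerivAt (l := g) t (h.differentiableAt_metric hy).hasFDerivAt hc
  have h1 := (h0.clm_apply hX).clm_apply hY
  refine h1.congr_deriv ?_
  simp only [add_apply, map_add, h.fderiv_metric hy]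
  ring

/-- Two geodesics with the same position and velocity at `t` agree on the right of `t`. -/
theorem eventuallyEq_of_geodesic {c₁ c₂ : ℝ → V} {t : ℝ} (hy : c₁ t ∈ U)
    (h₁ : ContDiffAt ℝ 2 c₁ t) (h₂ : ContDiffAt ℝ 2 c₂ t)
    (e₁ : ∀ᶠ s in 𝓝[≥] t, deriv (deriv c₁) s + Γ (c₁ s) (deriv c₁ s) (deriv c₁ s) = 0)
    (e₂ : ∀ᶠ s in 𝓝[≥] t, deriv (deriv c₂) s + Γ (c₂ s) (deriv c₂ s) (deriv c₂ s) = 0)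
    (h0 : c₁ t = c₂ t) (h0' : deriv c₁ t = deriv c₂ t) : c₁ =ᶠ[𝓝[≥] t] c₂ := by
  -- The geodesic equation as a first-order system. `F` is locally Lipschitz, so uniqueness for
  -- differential equations applies; one-sided neighbourhoods suffice, and geodesics are only known
  -- on a closed interval.
  let F : V × V → V × V := fun z => (z.2, -Γ z.1 z.2 z.2)
  have hF : ContDiffAt ℝ 1 F (c₁ t, deriv c₁ t) := by
    have hΓ : ContDiffAt ℝ 1 Γ (c₁ t) :=
      (h.contDiffOn_christoffel.contDiffAt (h.isOpen.mem_nhds hy)).of_le (by simp)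
    have hΓ' : ContDiffAt ℝ 1 (fun z : V × V => Γ z.1) (c₁ t, deriv c₁ t) :=
      ContDiffAt.comp (c₁ t, deriv c₁ t) hΓ contDiffAt_fst
    exact contDiffAt_snd.prodMk ((hΓ'.clm_apply contDiffAt_snd).clm_apply contDiffAt_snd).neg
  obtain ⟨K, s, hs, hK⟩ := hF.exists_lipschitzOnWith
  have key : ∀ c : ℝ → V, ContDiffAt ℝ 2 c t → c t = c₁ t → deriv c t = deriv c₁ t →
      (∀ᶠ s in 𝓝[≥] t, deriv (deriv c) s + Γ (c s) (deriv c s) (deriv c s) = 0) →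
      ∀ᶠ τ in 𝓝[≥] t, HasDerivAt (fun τ => (c τ, deriv c τ)) (F (c τ, deriv c τ)) τ ∧
        (c τ, deriv c τ) ∈ s := by
    intro c hc ht ht' he
    have hd : ContDiffAt ℝ 1 (deriv c) t := by
      have h2 : ContDiffAt ℝ 1 (fderiv ℝ c) t := hc.fderiv_right (by norm_num)
      exact h2.clm_apply contDiffAt_const
    have hcont : ContinuousAt (fun τ => (c τ, deriv c τ)) t :=
      hc.continuousAt.prodMk hd.continuousAt
    have hs' : s ∈ 𝓝 ((c t, deriv c t) : V × V) := by rwa [ht, ht']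
    filter_upwards [he, (eventually_differentiableAt hc one_le_two).filter_mono
      nhdsWithin_le_nhds, (eventually_differentiableAt hd le_rfl).filter_mono nhdsWithin_le_nhds,
      (hcont.eventually hs').filter_mono nhdsWithin_le_nhds] with τ h1 h2 h3 h4
    refine ⟨?_, h4⟩
    have h5 : deriv (deriv c) τ = -Γ (c τ) (deriv c τ) (deriv c τ) := eq_neg_of_add_eq_zero_left h1
    have := h2.hasDerivAt.prodMk h3.hasDerivAt
    rwa [h5] at this
  obtain ⟨b, hb, hbs⟩ := mem_nhdsGE_iff_exists_Icc_subset.1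
    ((key c₁ h₁ rfl rfl e₁).and (key c₂ h₂ h0.symm h0'.symm e₂))
  have hE := ODE_solution_unique_of_mem_Icc_right (v := fun _ => F) (s := fun _ => s) (K := K)
    (a := t) (b := b) (fun _ _ => hK)
    (fun τ hτ => (hbs hτ).1.1.continuousAt.continuousWithinAt)
    (fun τ hτ => (hbs (Ico_subset_Icc_self hτ)).1.1.hasDerivWithinAt)
    (fun τ hτ => (hbs (Ico_subset_Icc_self hτ)).1.2)
    (fun τ hτ => (hbs hτ).2.1.continuousAt.continuousWithinAt)
    (fun τ hτ => (hbs (Ico_subset_Icc_self hτ)).2.1.hasDerivWithinAt)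
    (fun τ hτ => (hbs (Ico_subset_Icc_self hτ)).2.2) (by simp only [h0, h0'])
  filter_upwards [Icc_mem_nhdsGE hb] with τ hτ
  exact congrArg Prod.fst (hE hτ)

end IsLeviCivitaOn

/-- The curvature `R(a, b) c` of the connection with Christoffel symbols `Γ`. -/
def curvatureForm (Γ : V → V →L[ℝ] V →L[ℝ] V) (y a b c : V) : V :=
  fderiv ℝ Γ y a b c - fderiv ℝ Γ y b a c + (Γ y a (Γ y b c) - Γ y b (Γ y a c))

end LocalGeometry

/-! ### Jacobi fields -/

section Jacobi

theorem two_le_infty : (2 : ℕ∞ω) ≤ ((⊤ : ℕ∞) : ℕ∞ω) := by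
  change ((2 : ℕ∞) : ℕ∞ω) ≤ _
  exact WithTop.coe_le_coe.2 le_top

variable {V : Type*} [NormedAddCommGroup V] [NormedSpace ℝ V]

namespace IsLeviCivitaOn

variable {g : V → V →L[ℝ] V →L[ℝ] ℝ} {Γ : V → V →L[ℝ] V →L[ℝ] V} {U : Set V}
  (h : IsLeviCivitaOn g Γ U)
include h

-- With `DJ = J' + Γ(c', J)`, compatibility with the metric gives `(|J|²)' = 2⟨DJ, J⟩` and `(|J|²)''
-- = 2(|DJ|² + ⟨D²J, J⟩)`; the linearized geodesic equation `hjac` amounts to `D²J = R(c', J)c'`.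
set_option synthInstance.maxHeartbeats 200000 in
theorem hasDerivAt_norm_sq_jacobi {c c₁ J J₁ : ℝ → V} {t : ℝ} {c₂ J₂ : V} (hU : c t ∈ U)
    (hc : ∀ᶠ s in 𝓝 t, HasDerivAt c (c₁ s) s) (hJ : ∀ᶠ s in 𝓝 t, HasDerivAt J (J₁ s) s)
    (hc₁ : HasDerivAt c₁ c₂ t) (hJ₁ : HasDerivAt J₁ J₂ t)
    (hgeo : c₂ + Γ (c t) (c₁ t) (c₁ t) = 0)
    (hjac : J₂ + fderiv ℝ Γ (c t) (J t) (c₁ t) (c₁ t) + (2 : ℝ) • Γ (c t) (c₁ t) (J₁ t) = 0) :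
    (∀ᶠ s in 𝓝 t, HasDerivAt (fun s => g (c s) (J s) (J s))
      (2 * g (c s) (J₁ s + Γ (c s) (c₁ s) (J s)) (J s)) s) ∧
    HasDerivAt (fun s => 2 * g (c s) (J₁ s + Γ (c s) (c₁ s) (J s)) (J s))
      (2 * (g (c t) (J₁ t + Γ (c t) (c₁ t) (J t)) (J₁ t + Γ (c t) (c₁ t) (J t))
        + g (c t) (curvatureForm Γ (c t) (c₁ t) (J t) (c₁ t)) (J t))) t := by
  have hc0 := hc.self_of_nhds
  have hJ0 := hJ.self_of_nhds
  constructor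
  · filter_upwards [hc, hJ, hc0.continuousAt.eventually (h.isOpen.mem_nhds hU)] with s h1 h2 h3
    refine (h.hasDerivAt_metric h3 h1 h2 h2).congr_deriv ?_
    rw [h.symm _ h3 (J s)]
    ring
  · have hΓ : HasDerivAt (fun s => Γ (c s)) (fderiv ℝ Γ (c t) (c₁ t)) t :=
      HasFDerivAt.comp_hasDerivAt (l := Γ) t (h.differentiableAt_christoffel hU).hasFDerivAt hc0
    have hD := hJ₁.add ((hΓ.clm_apply hc₁).clm_apply hJ0)
    refine ((h.hasDerivAt_metric hU hc0 hD hJ0).const_mul 2).congr_deriv ?_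
    have e : J₂ + ((fderiv ℝ Γ (c t) (c₁ t) (c₁ t) + Γ (c t) c₂) (J t)
        + Γ (c t) (c₁ t) (J₁ t)) + Γ (c t) (c₁ t) (J₁ t + Γ (c t) (c₁ t) (J t))
        = curvatureForm Γ (c t) (c₁ t) (J t) (c₁ t) := by
      rw [eq_neg_of_add_eq_zero_left hgeo, curvatureForm, add_apply, map_neg, neg_apply, map_add,
        h.christoffel_symm hU (J t) (c₁ t), h.christoffel_symm hU (J t)]
      have hs : fderiv ℝ Γ (c t) (c₁ t) (c₁ t) (J t) = fderiv ℝ Γ (c t) (c₁ t) (J t) (c₁ t) := by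
        have h1 : ∀ a b, HasDerivAt (fun s => Γ (c s) a b) (fderiv ℝ Γ (c t) (c₁ t) a b) t := by
          intro a b
          have := (hΓ.clm_apply (hasDerivAt_const t a)).clm_apply (hasDerivAt_const t b)
          simpa using this
        refine (h1 _ _).unique ((h1 _ _).congr_of_eventuallyEq ?_)
        filter_upwards [hc0.continuousAt.eventually (h.isOpen.mem_nhds hU)] with s hs
        exact h.christoffel_symm hs _ _
      rw [hs]
      have hj := hjac
      rw [add_assoc, two_smul] at hj
      rw [eq_neg_of_add_eq_zero_left hj]
      abel
    simp only [Pi.add_apply]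
    rw [← e, add_comm (g (c t) _ (J t))]

-- The rays of `Ψ` are geodesics, so differentiating their equation at `t v` in the direction `w`
-- gives the Jacobi equation for `J(t) = dΨ(t v)(t w)`.
set_option synthInstance.maxHeartbeats 200000 in
theorem jacobi_equation {Ψ : V → V} {v : V} {t : ℝ} (ht : 0 < t)
    (hΨ : ContDiffAt ℝ ∞ Ψ (t • v)) (hU : Ψ (t • v) ∈ U)
    (hgeo : ∀ᶠ y in 𝓝 (t • v), fderiv ℝ (fderiv ℝ Ψ) y y y
      + Γ (Ψ y) (fderiv ℝ Ψ y y) (fderiv ℝ Ψ y y) = 0) (w : V) :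
    fderiv ℝ (fderiv ℝ (fderiv ℝ Ψ)) (t • v) v v (t • w)
      + (2 : ℝ) • fderiv ℝ (fderiv ℝ Ψ) (t • v) v w
      + fderiv ℝ Γ (Ψ (t • v)) (fderiv ℝ Ψ (t • v) (t • w)) (fderiv ℝ Ψ (t • v) v)
        (fderiv ℝ Ψ (t • v) v)
      + (2 : ℝ) • Γ (Ψ (t • v)) (fderiv ℝ Ψ (t • v) v)
        (fderiv ℝ (fderiv ℝ Ψ) (t • v) v (t • w) + fderiv ℝ Ψ (t • v) w) = 0 := by
  have hΨ1 : ContDiffAt ℝ ∞ (fderiv ℝ Ψ) (t • v) := hΨ.fderiv_right (by simp)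
  have hΨ2 : ContDiffAt ℝ ∞ (fderiv ℝ (fderiv ℝ Ψ)) (t • v) := hΨ1.fderiv_right (by simp)
  have hray : ∀ u : V, ∀ s : ℝ, HasDerivAt (fun s : ℝ => s • u) u s := fun u s => by
    simpa using (hasDerivAt_id s).smul_const u
  obtain ⟨D, hD⟩ : ∃ D, D = fderiv ℝ (fderiv ℝ (fderiv ℝ Ψ)) (t • v) := ⟨_, rfl⟩
  have hcont : ContinuousAt (fun s : ℝ => s • v) t := (hray v t).continuousAt
  have hd2 : HasDerivAt (fun s : ℝ => fderiv ℝ (fderiv ℝ Ψ) (s • v)) (D v) t := by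
    rw [hD]
    exact HasFDerivAt.comp_hasDerivAt (l := fderiv ℝ (fderiv ℝ Ψ)) t
      (hΨ2.differentiableAt (by simp)).hasFDerivAt (hray v t)
  have hsymm : ∀ a b, fderiv ℝ (fderiv ℝ Ψ) (t • v) a b = fderiv ℝ (fderiv ℝ Ψ) (t • v) b a :=
    fun a b => ((hΨ.of_le two_le_infty).isSymmSndFDerivAt (by simp)).eq a b
  have hD1 : ∀ a b, D a b = D b a := by
    intro a b
    rw [hD]
    exact ((hΨ1.of_le two_le_infty).isSymmSndFDerivAt (by simp)).eq a b
  have hD2 : ∀ a b, D v a b = D v b a := by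
    intro a b
    have h1 : ∀ a b, HasDerivAt (fun s : ℝ => fderiv ℝ (fderiv ℝ Ψ) (s • v) a b) (D v a b) t := by
      intro a b
      have := (hd2.clm_apply (hasDerivAt_const t a)).clm_apply (hasDerivAt_const t b)
      simpa using this
    refine (h1 a b).unique ((h1 b a).congr_of_eventuallyEq ?_)
    have h2 : ∀ᶠ y in 𝓝 (t • v), ContDiffAt ℝ 2 Ψ y :=
      (hΨ.of_le two_le_infty).eventually (by simp)
    filter_upwards [hcont.eventually h2] with s hs
    exact (hs.isSymmSndFDerivAt (by simp)).eq a b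
  rw [← hD]
  have hl : HasDerivAt (fun τ : ℝ => t • v + τ • w) w 0 := by
    simpa using (hray w 0).const_add (t • v)
  have e0 : t • v + (0 : ℝ) • w = t • v := by simp
  have hΨl : HasDerivAt (fun τ : ℝ => Ψ (t • v + τ • w)) (fderiv ℝ Ψ (t • v) w) 0 := by
    refine HasFDerivAt.comp_hasDerivAt (l := Ψ) 0 ?_ hl
    rw [e0]
    exact (hΨ.differentiableAt (by simp)).hasFDerivAt
  have hΨl1 : HasDerivAt (fun τ : ℝ => fderiv ℝ Ψ (t • v + τ • w))
      (fderiv ℝ (fderiv ℝ Ψ) (t • v) w) 0 := by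
    refine HasFDerivAt.comp_hasDerivAt (l := fderiv ℝ Ψ) 0 ?_ hl
    rw [e0]
    exact (hΨ1.differentiableAt (by simp)).hasFDerivAt
  have hΨl2 : HasDerivAt (fun τ : ℝ => fderiv ℝ (fderiv ℝ Ψ) (t • v + τ • w)) (D w) 0 := by
    refine HasFDerivAt.comp_hasDerivAt (l := fderiv ℝ (fderiv ℝ Ψ)) 0 ?_ hl
    rw [e0, hD]
    exact (hΨ2.differentiableAt (by simp)).hasFDerivAt
  have hΓl : HasDerivAt (fun τ : ℝ => Γ (Ψ (t • v + τ • w)))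
      (fderiv ℝ Γ (Ψ (t • v)) (fderiv ℝ Ψ (t • v) w)) 0 := by
    refine HasFDerivAt.comp_hasDerivAt (l := Γ) 0 ?_ hΨl
    rw [e0]
    exact (h.differentiableAt_christoffel hU).hasFDerivAt
  have hX := hΨl1.clm_apply hl
  have hE := ((hΨl2.clm_apply hl).clm_apply hl).add ((hΓl.clm_apply hX).clm_apply hX)
  have hE0 := hE.unique ((hasDerivAt_const (0 : ℝ) (0 : V)).congr_of_eventuallyEq (by
    have hlc : ContinuousAt (fun τ : ℝ => t • v + τ • w) 0 := hl.continuousAt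
    have := hlc.eventually (p := fun y => fderiv ℝ (fderiv ℝ Ψ) y y y
      + Γ (Ψ y) (fderiv ℝ Ψ y y) (fderiv ℝ Ψ y y) = 0) (by simpa using hgeo)
    exact this))
  rw [e0] at hE0
  simp only [map_smul, smul_apply, map_add, add_apply, h.christoffel_symm hU _ (fderiv ℝ Ψ
    (t • v) v), hsymm w v, hD1 w v, hD2 w v] at hE0
  -- By bilinearity and the symmetry of second and third derivatives, the differentiated equation is
  -- `t` times the desired expression.
  have hE1 : t • (D v v (t • w) + (2 : ℝ) • fderiv ℝ (fderiv ℝ Ψ) (t • v) v w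
      + fderiv ℝ Γ (Ψ (t • v)) (fderiv ℝ Ψ (t • v) (t • w)) (fderiv ℝ Ψ (t • v) v)
        (fderiv ℝ Ψ (t • v) v)
      + (2 : ℝ) • Γ (Ψ (t • v)) (fderiv ℝ Ψ (t • v) v)
        (fderiv ℝ (fderiv ℝ Ψ) (t • v) v (t • w) + fderiv ℝ Ψ (t • v) w)) = 0 := by
    rw [← hE0]
    simp only [map_smul, smul_apply, map_add]
    module
  exact (smul_eq_zero.1 hE1).resolve_left ht.ne'

set_option synthInstance.maxHeartbeats 200000 in
/-- The differential inequality for the square of the norm of a Jacobi field, along a ray of the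
exponential map `Ψ`. -/
theorem jacobi_inequality {Ψ : V → V} {v w : V} {t : ℝ} (ht : 0 < t)
    (hΨ : ContDiffAt ℝ ∞ Ψ (t • v)) (hU : Ψ (t • v) ∈ U)
    (hgeo : ∀ᶠ y in 𝓝 (t • v), fderiv ℝ (fderiv ℝ Ψ) y y y
      + Γ (Ψ y) (fderiv ℝ Ψ y y) (fderiv ℝ Ψ y y) = 0) {f : ℝ → ℝ}
    (hf : ∀ᶠ s in 𝓝 t, f s = g (Ψ (s • v)) (fderiv ℝ Ψ (s • v) (s • w))
      (fderiv ℝ Ψ (s • v) (s • w))) :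
    (∀ᶠ s in 𝓝 t, DifferentiableAt ℝ f s) ∧ DifferentiableAt ℝ (deriv f) t ∧
      4 * f t * g (Ψ (t • v)) (curvatureForm Γ (Ψ (t • v)) (fderiv ℝ Ψ (t • v) v)
        (fderiv ℝ Ψ (t • v) (t • w)) (fderiv ℝ Ψ (t • v) v)) (fderiv ℝ Ψ (t • v) (t • w))
        ≤ 2 * f t * deriv (deriv f) t - deriv f t ^ 2 := by
  have hΨ1 : ContDiffAt ℝ ∞ (fderiv ℝ Ψ) (t • v) := hΨ.fderiv_right (by simp)
  have hΨ2 : ContDiffAt ℝ ∞ (fderiv ℝ (fderiv ℝ Ψ)) (t • v) := hΨ1.fderiv_right (by simp)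
  have hray : ∀ s : ℝ, HasDerivAt (fun s : ℝ => s • v) v s := fun s => by
    simpa using (hasDerivAt_id s).smul_const v
  have hrayw : ∀ s : ℝ, HasDerivAt (fun s : ℝ => s • w) w s := fun s => by
    simpa using (hasDerivAt_id s).smul_const w
  have hcont : ContinuousAt (fun s : ℝ => s • v) t := (hray t).continuousAt
  let c : ℝ → V := fun s => Ψ (s • v)
  let c₁ : ℝ → V := fun s => fderiv ℝ Ψ (s • v) v
  let c₂ : ℝ → V := fun s => fderiv ℝ (fderiv ℝ Ψ) (s • v) v v
  let J : ℝ → V := fun s => fderiv ℝ Ψ (s • v) (s • w)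
  let J₁ : ℝ → V := fun s => fderiv ℝ (fderiv ℝ Ψ) (s • v) v (s • w) + fderiv ℝ Ψ (s • v) w
  have hd0 : ∀ᶠ s in 𝓝 t, DifferentiableAt ℝ Ψ (s • v) :=
    hcont.eventually (eventually_differentiableAt hΨ (by simp))
  have hd1 : ∀ᶠ s in 𝓝 t, HasDerivAt (fun s : ℝ => fderiv ℝ Ψ (s • v))
      (fderiv ℝ (fderiv ℝ Ψ) (s • v) v) s := by
    filter_upwards [hcont.eventually (eventually_differentiableAt hΨ1 (by simp))] with s hs
    exact HasFDerivAt.comp_hasDerivAt (l := fderiv ℝ Ψ) s hs.hasFDerivAt (hray s)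
  have hd2 : HasDerivAt (fun s : ℝ => fderiv ℝ (fderiv ℝ Ψ) (s • v))
      (fderiv ℝ (fderiv ℝ (fderiv ℝ Ψ)) (t • v) v) t :=
    HasFDerivAt.comp_hasDerivAt (l := fderiv ℝ (fderiv ℝ Ψ)) t
      (hΨ2.differentiableAt (by simp)).hasFDerivAt (hray t)
  have hc : ∀ᶠ s in 𝓝 t, HasDerivAt c (c₁ s) s := by
    filter_upwards [hd0] with s hs
    exact hs.hasFDerivAt.comp_hasDerivAt s (hray s)
  have hJ : ∀ᶠ s in 𝓝 t, HasDerivAt J (J₁ s) s := by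
    filter_upwards [hd1] with s hs
    exact hs.clm_apply (hrayw s)
  have hc₁ : HasDerivAt c₁ (c₂ t) t := by
    have := hd1.self_of_nhds.clm_apply (hasDerivAt_const t v)
    simpa using this
  have hJ₁ : HasDerivAt J₁
      (fderiv ℝ (fderiv ℝ (fderiv ℝ Ψ)) (t • v) v v (t • w) + (2 : ℝ) • fderiv ℝ (fderiv ℝ Ψ) (t • v) v w) t := by
    have h1 := ((hd2.clm_apply (hasDerivAt_const t v)).clm_apply (hrayw t)).add
      (hd1.self_of_nhds.clm_apply (hasDerivAt_const t w))
    refine h1.congr_deriv ?_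
    simp only [map_zero, add_zero, two_smul]
    abel
  have hy := hgeo.self_of_nhds
  have ht' : t ≠ 0 := ht.ne'
  have hg2 : c₂ t + Γ (c t) (c₁ t) (c₁ t) = 0 := by
    simp only [map_smul, smul_apply, ← smul_add, smul_eq_zero, ht', false_or] at hy
    exact hy
  have hjac :
      fderiv ℝ (fderiv ℝ (fderiv ℝ Ψ)) (t • v) v v (t • w) + (2 : ℝ) • fderiv ℝ (fderiv ℝ Ψ) (t • v) v w
      + fderiv ℝ Γ (c t) (J t) (c₁ t) (c₁ t) + (2 : ℝ) • Γ (c t) (c₁ t) (J₁ t) = 0 := by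
    exact h.jacobi_equation ht hΨ hU hgeo w
  obtain ⟨h1, h2⟩ := h.hasDerivAt_norm_sq_jacobi (c := c) (J := J) hU hc hJ hc₁ hJ₁ hg2 hjac
  have hf1 : ∀ᶠ s in 𝓝 t, HasDerivAt f (2 * g (c s) (J₁ s + Γ (c s) (c₁ s) (J s)) (J s)) s := by
    filter_upwards [h1, hf.eventually_nhds] with s hs hs'
    exact hs.congr_of_eventuallyEq hs'
  have hf2 := h2.congr_of_eventuallyEq (hf1.mono fun s hs => hs.deriv)
  refine ⟨hf1.mono fun s hs => hs.differentiableAt, hf2.differentiableAt, ?_⟩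
  rw [hf2.deriv, hf1.self_of_nhds.deriv, hf.self_of_nhds]
  -- Cauchy–Schwarz makes the terms in `DJ` contribute nonnegatively to `2 f f'' - f'²`. This
  -- expression equals `4 a³ a''` for `a = √f`, so it encodes the second-order inequality for `|J|`
  -- without a square root.
  have h3 := h.sq_le (y := c t) hU (J₁ t + Γ (c t) (c₁ t) (J t)) (J t)
  change 4 * g (c t) (J t) (J t) * g (c t) (curvatureForm Γ (c t) (c₁ t) (J t) (c₁ t)) (J t) ≤
    2 * g (c t) (J t) (J t) * _ - _
  nlinarith [h3]

end IsLeviCivitaOn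

end Jacobi

/-- A Sturm comparison. For `a = √f` the hypothesis reads `a'' ≥ -K a` with `K ≤ 1/2`, and `φ(t) = t
- t³/2` satisfies `φ'' = -3t`, which is below `-φ/2`. So `a/φ` is nondecreasing from its limit `m`
at `0`, and `φ(1) = 1/2` gives `a(1) ≥ m/2`. -/
theorem sq_div_four_le_of_jacobi {f : ℝ → ℝ} {K m : ℝ} (hK : K ≤ 1 / 2) (hm : 0 ≤ m)
    (hf : ∀ t ∈ Ioc (0 : ℝ) 1, DifferentiableAt ℝ f t)
    (hf' : ∀ t ∈ Ioc (0 : ℝ) 1, DifferentiableAt ℝ (deriv f) t)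
    (hpos : ∀ t ∈ Ioc (0 : ℝ) 1, 0 < f t)
    (hineq : ∀ t ∈ Ioc (0 : ℝ) 1, -(4 * K * f t ^ 2) ≤ 2 * f t * deriv (deriv f) t - deriv f t ^ 2)
    (hlim : Tendsto (fun t => f t / t ^ 2) (𝓝[>] 0) (𝓝 (m ^ 2))) : m ^ 2 / 4 ≤ f 1 := by
  let a : ℝ → ℝ := fun t => √(f t)
  let φ : ℝ → ℝ := fun t => t - t ^ 3 / 2
  -- The Wronskian `a'φ - aφ'`, the numerator of `(a/φ)'`. Its derivative `a''φ - aφ''` is at least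
  -- `-at/2 + 3at ≥ 0`.
  let W : ℝ → ℝ := fun t => deriv f t / (2 * a t) * φ t - a t * (1 - 3 * t ^ 2 / 2)
  let b : ℝ → ℝ := fun t => a t / φ t
  have ha : ∀ t ∈ Ioc (0 : ℝ) 1, 0 < a t := fun t ht => Real.sqrt_pos.2 (hpos t ht)
  have hsq : ∀ t ∈ Ioc (0 : ℝ) 1, a t ^ 2 = f t := fun t ht => Real.sq_sqrt (hpos t ht).le
  have hφ : ∀ t ∈ Ioc (0 : ℝ) 1, 0 < φ t := fun t ht => by
    have h1 : t ^ 2 ≤ 1 := pow_le_one₀ ht.1.le ht.2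
    have h2 : φ t = t * (1 - t ^ 2 / 2) := by ring
    rw [h2]
    exact mul_pos ht.1 (by linarith)
  have hφt : ∀ t ∈ Ioc (0 : ℝ) 1, φ t ≤ t := fun t ht => by
    have : 0 < t ^ 3 := pow_pos ht.1 3
    change t - t ^ 3 / 2 ≤ t
    linarith
  have hφd : ∀ t, HasDerivAt φ (1 - 3 * t ^ 2 / 2) t := fun t => by
    have := (hasDerivAt_id t).sub ((hasDerivAt_pow 3 t).div_const 2)
    refine this.congr_deriv ?_
    norm_num
  have had : ∀ t ∈ Ioc (0 : ℝ) 1, HasDerivAt a (deriv f t / (2 * a t)) t := fun t ht =>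
    (hf t ht).hasDerivAt.sqrt (hpos t ht).ne'
  have hbd : ∀ t ∈ Ioc (0 : ℝ) 1, HasDerivAt b (W t / φ t ^ 2) t := fun t ht =>
    (had t ht).div (hφd t) (hφ t ht).ne'
  have hWd : ∀ t ∈ Ioc (0 : ℝ) 1, ∃ W', 0 ≤ W' ∧ HasDerivAt W W' t := by
    intro t ht
    have h0 := ha t ht
    have h1 := ((((hf' t ht).hasDerivAt.div ((had t ht).const_mul 2) (by positivity)).mul
      (hφd t)).sub ((had t ht).mul (((hasDerivAt_pow 2 t).const_mul 3).div_const 2 |>.const_sub 1)))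
    refine ⟨_, ?_, h1⟩
    have h2 := hineq t ht
    rw [← hsq t ht] at h2
    have h3 : (deriv (deriv f) t * (2 * a t) - deriv f t * (2 * (deriv f t / (2 * a t))))
        / (2 * a t) ^ 2 = (2 * a t ^ 2 * deriv (deriv f) t - deriv f t ^ 2) / (4 * a t ^ 3) := by
      field_simp
      ring
    have h4 : -K * a t ≤ (2 * a t ^ 2 * deriv (deriv f) t - deriv f t ^ 2) / (4 * a t ^ 3) := by
      rw [le_div_iff₀ (by positivity)]
      calc -K * a t * (4 * a t ^ 3) = -(4 * K * (a t ^ 2) ^ 2) := by ring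
        _ ≤ _ := h2
    rw [h3]
    have h5 : -(1 / 2) * a t * t ≤
        (2 * a t ^ 2 * deriv (deriv f) t - deriv f t ^ 2) / (4 * a t ^ 3) * φ t := by
      have h6 : -(1 / 2) * a t ≤ -K * a t := by nlinarith
      have h7 : -(1 / 2) * a t * t ≤ -(1 / 2) * a t * φ t := by nlinarith [hφt t ht]
      refine h7.trans (mul_le_mul_of_nonneg_right (h6.trans h4) (hφ t ht).le)
    have h8 : 0 < a t * t := mul_pos h0 ht.1
    norm_num
    nlinarith
  have hWmono : MonotoneOn W (Ioc 0 1) := by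
    refine monotoneOn_of_deriv_nonneg (convex_Ioc 0 1) (fun t ht => ?_) (fun t ht => ?_)
      fun t ht => ?_
    · obtain ⟨W', -, h⟩ := hWd t ht
      exact h.continuousAt.continuousWithinAt
    · rw [interior_Ioc] at ht
      obtain ⟨W', -, h⟩ := hWd t ⟨ht.1, ht.2.le⟩
      exact h.differentiableAt.differentiableWithinAt
    · rw [interior_Ioc] at ht
      obtain ⟨W', h', h⟩ := hWd t ⟨ht.1, ht.2.le⟩
      rwa [h.deriv]
  have hIoc : ∀ᶠ t in 𝓝[>] (0 : ℝ), t ∈ Ioc (0 : ℝ) 1 := Ioc_mem_nhdsGT one_pos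
  have hblim : Tendsto b (𝓝[>] 0) (𝓝 m) := by
    have h1 : Tendsto (fun t : ℝ => 1 - t ^ 2 / 2) (𝓝[>] 0) (𝓝 (1 - 0 ^ 2 / 2)) :=
      (Continuous.tendsto (by fun_prop) 0).mono_left nhdsWithin_le_nhds
    have h2 := (hlim.sqrt).div h1 (by norm_num)
    rw [Real.sqrt_sq hm] at h2
    norm_num at h2
    refine h2.congr' ?_
    filter_upwards [hIoc] with t ht
    have h3 := ht.1
    change √(f t / t ^ 2) / (1 - t ^ 2 / 2) = a t / φ t
    rw [Real.sqrt_div (hpos t ht).le, Real.sqrt_sq h3.le, div_div]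
    congr 1
    change _ = t - t ^ 3 / 2
    ring
  -- If `W t₁ = -c < 0`, monotonicity gives `(a/φ)' ≤ -c/φ² ≤ -c/t²` on `(0, t₁]`, so `a/φ` would
  -- blow up like `c/t` at `0` instead of tending to `m`.
  have hW0 : ∀ t ∈ Ioc (0 : ℝ) 1, 0 ≤ W t := by
    intro t₁ ht₁
    by_contra hneg
    rw [not_le] at hneg
    set c := -W t₁ with hc
    have hc0 : 0 < c := by linarith
    have hanti : AntitoneOn (fun t => b t - c * t⁻¹) (Ioc 0 t₁) := by
      have hd : ∀ t ∈ Ioc 0 t₁, HasDerivAt (fun t => b t - c * t⁻¹)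
          (W t / φ t ^ 2 - c * -(t ^ 2)⁻¹) t := fun t ht =>
        (hbd t ⟨ht.1, ht.2.trans ht₁.2⟩).sub ((hasDerivAt_inv ht.1.ne').const_mul c)
      refine antitoneOn_of_deriv_nonpos (convex_Ioc 0 t₁)
        (fun t ht => (hd t ht).continuousAt.continuousWithinAt) (fun t ht => ?_) fun t ht => ?_
      · rw [interior_Ioc] at ht
        exact (hd t ⟨ht.1, ht.2.le⟩).differentiableAt.differentiableWithinAt
      · rw [interior_Ioc] at ht
        have ht' : t ∈ Ioc (0 : ℝ) 1 := ⟨ht.1, ht.2.le.trans ht₁.2⟩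
        rw [(hd t ⟨ht.1, ht.2.le⟩).deriv]
        have h1 : W t ≤ -c := by rw [hc, neg_neg]; exact hWmono ht' ht₁ ht.2.le
        have h2 : W t / φ t ^ 2 ≤ -c / φ t ^ 2 :=
          div_le_div_of_nonneg_right h1 (sq_nonneg _)
        have h3 : c / t ^ 2 ≤ c / φ t ^ 2 :=
          div_le_div_of_nonneg_left hc0.le (pow_pos (hφ t ht') 2)
            (pow_le_pow_left₀ (hφ t ht').le (hφt t ht') 2)
        rw [neg_div] at h2
        rw [div_eq_mul_inv] at h3
        linarith
    have hev : ∀ᶠ t in 𝓝[>] (0 : ℝ), c * t⁻¹ ≤ (m + 1) - (b t₁ - c * t₁⁻¹) := by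
      filter_upwards [Ioc_mem_nhdsGT ht₁.1, hblim.eventually (gt_mem_nhds (lt_add_one m))]
        with t ht hbt
      have := hanti ht ⟨ht₁.1, le_rfl⟩ ht.2
      simp only at this
      linarith
    have hinf : Tendsto (fun t : ℝ => c * t⁻¹) (𝓝[>] 0) atTop :=
      tendsto_inv_nhdsGT_zero.const_mul_atTop hc0
    obtain ⟨t, h1, h2⟩ := (hev.and (hinf.eventually
      (eventually_gt_atTop ((m + 1) - (b t₁ - c * t₁⁻¹))))).exists
    linarith
  have hbmono : MonotoneOn b (Ioc 0 1) := by
    refine monotoneOn_of_deriv_nonneg (convex_Ioc 0 1)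
      (fun t ht => (hbd t ht).continuousAt.continuousWithinAt) (fun t ht => ?_) fun t ht => ?_
    · rw [interior_Ioc] at ht
      exact (hbd t ⟨ht.1, ht.2.le⟩).differentiableAt.differentiableWithinAt
    · rw [interior_Ioc] at ht
      rw [(hbd t ⟨ht.1, ht.2.le⟩).deriv]
      exact div_nonneg (hW0 t ⟨ht.1, ht.2.le⟩) (sq_nonneg _)
  have hb1 : m ≤ b 1 := le_of_tendsto hblim (hIoc.mono fun t ht =>
    hbmono ht ⟨one_pos, le_rfl⟩ ht.2)
  have h1 : b 1 = 2 * a 1 := by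
    change a 1 / (1 - 1 ^ 3 / 2) = _
    norm_num
    ring
  rw [← hsq 1 ⟨one_pos, le_rfl⟩]
  nlinarith [ha 1 ⟨one_pos, le_rfl⟩]
-- The metric, the connection and the curvature of a chart as multilinear maps
section ChartMetric

set_option maxSynthPendingDepth 4


theorem contDiffOn_smul_const {W F : Type*} [NormedAddCommGroup W] [NormedSpace ℝ W]
    [NormedAddCommGroup F] [NormedSpace ℝ F] {f : W → ℝ} {s : Set W} {m : ℕ∞ω}
    (hf : ContDiffOn ℝ m f s) (B : F) : ContDiffOn ℝ m (fun y => f y • B) s :=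
  hf.smul contDiffOn_const

theorem map_sum_smul {V F ι : Type*} [NormedAddCommGroup V] [NormedSpace ℝ V]
    [NormedAddCommGroup F] [NormedSpace ℝ F] [Fintype ι] (L : V →L[ℝ] F) (e : ι → V) (a : ι → ℝ) :
    L (∑ i, a i • e i) = ∑ i, a i • L (e i) := by
  simp

theorem sum_smul_apply {V F ι : Type*} [NormedAddCommGroup V] [NormedSpace ℝ V]
    [NormedAddCommGroup F] [NormedSpace ℝ F] [Fintype ι] (L : ι → V →L[ℝ] F) (v : V) (a : ι → ℝ) :
    (∑ i, a i • L i) v = ∑ i, a i • L i v := by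
  simp

theorem bilinear_sum {V F ι : Type*} [NormedAddCommGroup V] [NormedSpace ℝ V]
    [NormedAddCommGroup F] [NormedSpace ℝ F] [Fintype ι]
    (A : V →L[ℝ] V →L[ℝ] F) (e : ι → V) (b w : ι → ℝ) :
    A (∑ j, b j • e j) (∑ l, w l • e l) = ∑ j, ∑ l, (b j * w l) • A (e j) (e l) := by
  rw [map_sum_smul A, sum_smul_apply]
  refine Finset.sum_congr rfl fun j _ => ?_
  rw [map_sum_smul, Finset.smul_sum]
  simp only [smul_smul]

theorem trilinear_sum {V F ι : Type*} [NormedAddCommGroup V] [NormedSpace ℝ V]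
    [NormedAddCommGroup F] [NormedSpace ℝ F] [Fintype ι]
    (A : V →L[ℝ] V →L[ℝ] V →L[ℝ] F) (e : ι → V) (a b w : ι → ℝ) :
    A (∑ i, a i • e i) (∑ j, b j • e j) (∑ l, w l • e l)
      = ∑ i, ∑ j, ∑ l, (a i * b j * w l) • A (e i) (e j) (e l) := by
  obtain ⟨x, hx⟩ : ∃ x, x = ∑ j, b j • e j := ⟨_, rfl⟩
  obtain ⟨y, hy⟩ : ∃ y, y = ∑ l, w l • e l := ⟨_, rfl⟩
  have h : IsLinearMap ℝ fun u => A u x y :=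
    ⟨fun u v => by simp only [map_add, add_apply], fun r u => by simp only [map_smul, smul_apply]⟩
  have h1 : A (∑ i, a i • e i) x y = ∑ i, a i • A (e i) x y := by
    have := map_sum (h.mk' _) (fun i => a i • e i) Finset.univ
    simp only [map_smul] at this
    exact this
  rw [← hx, ← hy, h1]
  refine Finset.sum_congr rfl fun i _ => ?_
  rw [hx, hy, bilinear_sum, Finset.smul_sum]
  simp only [Finset.smul_sum, smul_smul, mul_assoc]

variable {n : ℕ} {M : Type*} [TopologicalSpace M] [ChartedSpace (EuclideanSpace ℝ (Fin n)) M]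
  [IsManifold (𝓡 n) ∞ M]
  [RiemannianBundle (fun x : M => TangentSpace (𝓡 n) x)]
  [IsContMDiffRiemannianBundle (𝓡 n) ∞ (EuclideanSpace ℝ (Fin n))
      (fun x : M => TangentSpace (𝓡 n) x)]

local notation "E" => EuclideanSpace ℝ (Fin n)

theorem eq_sum_single (a : E) : a = ∑ i, a i • EuclideanSpace.single i (1 : ℝ) := by
  ext j
  simp [Pi.single_apply]

/-- The coordinate field is the image of a constant field under the tangent map of the inverse
chart, hence a smooth section along it. -/
theorem contMDiffOn_coordField (p : M) (i : Fin n) :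
    ContMDiffOn 𝓘(ℝ, E) (𝓡 n).tangent ∞
      (fun y : E => (⟨(extChartAt (𝓡 n) p).symm y, coordField n p i y⟩ : TangentBundle (𝓡 n) M))
      (extChartAt (𝓡 n) p).target := by
  have hO : IsOpen (extChartAt (𝓡 n) p).target := isOpen_extChartAt_target p
  have h1 : ContMDiffOn 𝓘(ℝ, E) (𝓡 n) ∞ (extChartAt (𝓡 n) p).symm (extChartAt (𝓡 n) p).target :=
    contMDiffOn_extChartAt_symm p
  have h2 := h1.contMDiffOn_tangentMapWithin (m := ∞) (by simp) hO.uniqueMDiffOn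
  have h3 : ContMDiffOn 𝓘(ℝ, E) 𝓘(ℝ, E).tangent ∞
      (fun y : E => (⟨y, EuclideanSpace.single i 1⟩ : TangentBundle 𝓘(ℝ, E) E))
      (extChartAt (𝓡 n) p).target :=
    contMDiffOn_vectorSpace_iff_contDiffOn.2 contDiffOn_const
  refine (h2.comp h3 fun y hy => hy).congr fun y hy => ?_
  simp only [Function.comp_apply, tangentMapWithin, coordField]
  rw [mfderivWithin_of_isOpen hO hy]

theorem contDiffOn_gram (p : M) (i j : Fin n) :
    ContDiffOn ℝ ∞ (fun y => gram n p y i j) (extChartAt (𝓡 n) p).target := by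
  rw [← contMDiffOn_iff_contDiffOn]
  exact ContMDiffOn.inner_bundle (contMDiffOn_coordField p i) (contMDiffOn_coordField p j)

/-- The metric in the chart at `p`. -/
def chartMetric (p : M) (y : E) : E →L[ℝ] E →L[ℝ] ℝ :=
  ∑ i, ∑ j, gram n p y i j • (EuclideanSpace.proj i : E →L[ℝ] ℝ).smulRight
    (EuclideanSpace.proj j : E →L[ℝ] ℝ)

theorem chartMetric_apply (p : M) (y a b : E) :
    chartMetric p y a b = ∑ i, ∑ j, gram n p y i j * (a i * b j) := by
  simp [chartMetric]

theorem chartMetric_eq_inner (p : M) (y a b : E) :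
    chartMetric p y a b = ⟪(mfderiv 𝓘(ℝ, E) (𝓡 n) (extChartAt (𝓡 n) p).symm y a :
      TangentSpace (𝓡 n) ((extChartAt (𝓡 n) p).symm y)),
      mfderiv 𝓘(ℝ, E) (𝓡 n) (extChartAt (𝓡 n) p).symm y b⟫_ℝ := by
  have h : ∀ a : E, (mfderiv 𝓘(ℝ, E) (𝓡 n) (extChartAt (𝓡 n) p).symm y a :
      TangentSpace (𝓡 n) ((extChartAt (𝓡 n) p).symm y)) = ∑ i, a i • coordField n p i y := by
    intro a
    let L : E →L[ℝ] TangentSpace (𝓡 n) ((extChartAt (𝓡 n) p).symm y) :=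
      mfderiv 𝓘(ℝ, E) (𝓡 n) (extChartAt (𝓡 n) p).symm y
    change L a = ∑ i, a i • L (EuclideanSpace.single i (1 : ℝ))
    conv_lhs => rw [eq_sum_single a, map_sum]
    exact Finset.sum_congr rfl fun i _ => L.map_smul _ _
  rw [h a, h b, chartMetric_apply]
  rw [sum_inner]
  refine Finset.sum_congr rfl fun i _ => ?_
  rw [inner_sum]
  refine Finset.sum_congr rfl fun j _ => ?_
  rw [real_inner_smul_left, real_inner_smul_right]
  change ⟪coordField n p i y, coordField n p j y⟫_ℝ * _ = _
  ring

theorem mfderiv_extChartAt_symm_injective (p : M) {y : E} (hy : y ∈ (extChartAt (𝓡 n) p).target) :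
    Function.Injective (mfderiv 𝓘(ℝ, E) (𝓡 n) (extChartAt (𝓡 n) p).symm y) := by
  have h := isInvertible_mfderivWithin_extChartAt_symm (I := 𝓡 n) hy
  have h1 : mfderivWithin 𝓘(ℝ, E) (𝓡 n) (extChartAt (𝓡 n) p).symm (range (𝓡 n)) y
      = mfderiv 𝓘(ℝ, E) (𝓡 n) (extChartAt (𝓡 n) p).symm y := by
    rw [ModelWithCorners.range_eq_univ, mfderivWithin_univ]
  rw [← h1]
  exact h.injective

theorem chartMetric_symm (p : M) (y a b : E) : chartMetric p y a b = chartMetric p y b a := by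
  rw [chartMetric_eq_inner, chartMetric_eq_inner, real_inner_comm]

theorem chartMetric_pos (p : M) {y : E} (hy : y ∈ (extChartAt (𝓡 n) p).target) {a : E}
    (ha : a ≠ 0) : 0 < chartMetric p y a a := by
  rw [chartMetric_eq_inner]
  refine real_inner_self_pos.2 fun h => ha ?_
  refine mfderiv_extChartAt_symm_injective p hy ?_
  exact h.trans (ContinuousLinearMap.map_zero _).symm

theorem contDiffOn_chartMetric (p : M) :
    ContDiffOn ℝ ∞ (chartMetric p) (extChartAt (𝓡 n) p).target := by
  refine ContDiffOn.sum fun i _ => ContDiffOn.sum fun j _ => ?_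
  exact contDiffOn_smul_const (contDiffOn_gram p i j) _

theorem chartMetric_single (p : M) (y : E) (i j : Fin n) :
    chartMetric p y (EuclideanSpace.single i 1) (EuclideanSpace.single j 1) = gram n p y i j := by
  rw [chartMetric_eq_inner]
  rfl

theorem chartMetric_eq_dotProduct (p : M) (y a b : E) :
    chartMetric p y a b = WithLp.ofLp a ⬝ᵥ (gram n p y).mulVec (WithLp.ofLp b) := by
  rw [chartMetric_apply]
  simp only [dotProduct, Matrix.mulVec, Finset.mul_sum]
  refine Finset.sum_congr rfl fun i _ => Finset.sum_congr rfl fun j _ => ?_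
  ring

theorem posDef_gram (p : M) {y : E} (hy : y ∈ (extChartAt (𝓡 n) p).target) :
    (gram n p y).PosDef := by
  refine Matrix.PosDef.of_dotProduct_mulVec_pos ?_ fun a ha => ?_
  · ext i j
    change ⟪coordField n p j y, coordField n p i y⟫_ℝ = ⟪coordField n p i y, coordField n p j y⟫_ℝ
    rw [real_inner_comm]
  · have h := chartMetric_pos p hy (a := WithLp.toLp 2 a) (by simpa using ha)
    rw [chartMetric_eq_dotProduct] at h
    simpa using h

theorem contDiffOn_det {W : Type*} [NormedAddCommGroup W] [NormedSpace ℝ W] {ι : Type*} [Fintype ι]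
    [DecidableEq ι] {A : W → Matrix ι ι ℝ} {s : Set W} {m : ℕ∞ω}
    (hA : ∀ i j, ContDiffOn ℝ m (fun y => A y i j) s) : ContDiffOn ℝ m (fun y => (A y).det) s := by
  simp only [Matrix.det_apply]
  refine ContDiffOn.sum fun σ _ => ?_
  exact (contDiffOn_prod fun i _ => hA _ _).const_smul _

theorem contDiffOn_matrix_inv {W : Type*} [NormedAddCommGroup W] [NormedSpace ℝ W] {ι : Type*}
    [Fintype ι] [DecidableEq ι] {A : W → Matrix ι ι ℝ} {s : Set W} {m : ℕ∞ω}
    (hA : ∀ i j, ContDiffOn ℝ m (fun y => A y i j) s) (h0 : ∀ y ∈ s, (A y).det ≠ 0) (i j : ι) :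
    ContDiffOn ℝ m (fun y => (A y)⁻¹ i j) s := by
  simp only [Matrix.inv_def, Matrix.smul_apply, smul_eq_mul, Ring.inverse_eq_inv',
    Matrix.adjugate_apply]
  refine ((contDiffOn_det hA).inv h0).mul (contDiffOn_det fun k l => ?_)
  by_cases hk : k = j
  · subst hk
    simp only [Matrix.updateRow_self]
    exact contDiffOn_const
  · simp only [Matrix.updateRow_ne hk]
    exact hA k l

theorem contDiffOn_pderiv {f : E → ℝ} {s : Set E} (hs : IsOpen s) (hf : ContDiffOn ℝ ∞ f s)
    (i : Fin n) : ContDiffOn ℝ ∞ (pderiv n i f) s :=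
  (hf.fderiv_of_isOpen hs (by simp)).clm_apply contDiffOn_const

theorem contDiffOn_christoffel (p : M) (k i j : Fin n) :
    ContDiffOn ℝ ∞ (christoffel n p k i j) (extChartAt (𝓡 n) p).target := by
  have hO : IsOpen (extChartAt (𝓡 n) p).target := isOpen_extChartAt_target p
  refine contDiffOn_const.mul (ContDiffOn.sum fun l _ => ContDiffOn.mul ?_ ?_)
  · exact contDiffOn_matrix_inv (contDiffOn_gram p) (fun y hy => (posDef_gram p hy).det_pos.ne') k l
  · exact ((contDiffOn_pderiv hO (contDiffOn_gram p j l) i).add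
      (contDiffOn_pderiv hO (contDiffOn_gram p i l) j)).sub
      (contDiffOn_pderiv hO (contDiffOn_gram p i j) l)

/-- The Christoffel symbols of the chart at `p`, as a bilinear map. -/
def chartChristoffel (p : M) (y : E) : E →L[ℝ] E →L[ℝ] E :=
  ∑ k, ∑ i, ∑ j, christoffel n p k i j y • (EuclideanSpace.proj i : E →L[ℝ] ℝ).smulRight
    ((EuclideanSpace.proj j : E →L[ℝ] ℝ).smulRight (EuclideanSpace.single k (1 : ℝ)))

theorem chartChristoffel_apply (p : M) (y a b : E) (k : Fin n) :
    chartChristoffel p y a b k = ∑ i, ∑ j, christoffel n p k i j y * a i * b j := by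
  simp [chartChristoffel, Pi.single_apply, mul_assoc]

theorem contDiffOn_chartChristoffel (p : M) :
    ContDiffOn ℝ ∞ (chartChristoffel p) (extChartAt (𝓡 n) p).target := by
  refine ContDiffOn.sum fun k _ => ContDiffOn.sum fun i _ => ContDiffOn.sum fun j _ => ?_
  exact contDiffOn_smul_const (contDiffOn_christoffel p k i j) _

theorem fderiv_chartMetric_single (p : M) {y : E} (hy : y ∈ (extChartAt (𝓡 n) p).target)
    (i j l : Fin n) :
    fderiv ℝ (chartMetric p) y (EuclideanSpace.single i 1) (EuclideanSpace.single j 1)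
      (EuclideanSpace.single l 1) = pderiv n i (fun z => gram n p z j l) y := by
  have hO : IsOpen (extChartAt (𝓡 n) p).target := isOpen_extChartAt_target p
  have hd : DifferentiableAt ℝ (chartMetric p) y :=
    ((contDiffOn_chartMetric p).contDiffAt (hO.mem_nhds hy)).differentiableAt (by simp)
  rw [← fderiv_apply_apply hd]
  simp only [chartMetric_single]
  rfl

/-- Lowering the upper index cancels the inverse Gram matrix in the definition of `Γ`; this is the
Koszul formula on coordinate vectors. -/
theorem gram_mul_christoffel (p : M) {y : E} (hy : y ∈ (extChartAt (𝓡 n) p).target)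
    (i j l : Fin n) :
    ∑ k, gram n p y k l * christoffel n p k i j y = (1 / 2) *
      (pderiv n i (fun z => gram n p z j l) y + pderiv n j (fun z => gram n p z i l) y
      - pderiv n l (fun z => gram n p z i j) y) := by
  set S : Fin n → ℝ := fun l => pderiv n i (fun z => gram n p z j l) y
    + pderiv n j (fun z => gram n p z i l) y - pderiv n l (fun z => gram n p z i j) y with hS
  have hpd := posDef_gram p hy
  have hdet : IsUnit (gram n p y).det := hpd.det_pos.ne'.isUnit
  have h1 : ∀ k, christoffel n p k i j y = (1 / 2) * (gram n p y)⁻¹.mulVec S k := fun k => rfl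
  have hsym : ∀ k, gram n p y k l = gram n p y l k := fun k => by
    rw [← chartMetric_single, ← chartMetric_single, chartMetric_symm]
  calc ∑ k, gram n p y k l * christoffel n p k i j y
      = (1 / 2) * (gram n p y).mulVec ((gram n p y)⁻¹.mulVec S) l := by
        rw [Matrix.mulVec, dotProduct, Finset.mul_sum]
        refine Finset.sum_congr rfl fun k _ => ?_
        rw [h1, hsym]
        ring
    _ = (1 / 2) * S l := by
        rw [Matrix.mulVec_mulVec, Matrix.mul_nonsing_inv _ hdet, Matrix.one_mulVec]

theorem trilinear_apply {F : Type*} [NormedAddCommGroup F] [NormedSpace ℝ F]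
    (A : E →L[ℝ] E →L[ℝ] E →L[ℝ] F) (a b w : E) :
    A a b w = ∑ i, ∑ j, ∑ l, (a i * b j * w l) • A (EuclideanSpace.single i 1)
      (EuclideanSpace.single j 1) (EuclideanSpace.single l 1) := by
  conv_lhs => rw [eq_sum_single a, eq_sum_single b, eq_sum_single w]
  exact trilinear_sum A _ _ _ _

theorem fderiv_chartMetric_apply (p : M) {y : E} (hy : y ∈ (extChartAt (𝓡 n) p).target)
    (a b w : E) : fderiv ℝ (chartMetric p) y a b w = ∑ i, ∑ j, ∑ l,
      (a i * b j * w l) * pderiv n i (fun z => gram n p z j l) y := by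
  rw [trilinear_apply]
  simp only [fderiv_chartMetric_single p hy, smul_eq_mul]

theorem isLeviCivitaOn_chart (p : M) :
    IsLeviCivitaOn (chartMetric p) (chartChristoffel p) (extChartAt (𝓡 n) p).target where
  isOpen := isOpen_extChartAt_target p
  contDiffOn_metric := contDiffOn_chartMetric p
  contDiffOn_christoffel := contDiffOn_chartChristoffel p
  symm y _ a b := chartMetric_symm p y a b
  pos y hy a ha := chartMetric_pos p hy ha
  koszul y hy a b w := by
    have h1 := fderiv_chartMetric_apply p hy a b w
    have h2 := fderiv_chartMetric_apply p hy b a w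
    have h3 := fderiv_chartMetric_apply p hy w a b
    have h4 : ∀ f : Fin n → Fin n → Fin n → ℝ,
        ∑ i, ∑ j, ∑ l, f i j l = ∑ x : Fin n × Fin n × Fin n, f x.1 x.2.1 x.2.2 := fun f => by
      simp only [Fintype.sum_prod_type]
    have h2' : fderiv ℝ (chartMetric p) y b a w = ∑ i, ∑ j, ∑ l,
        (a i * b j * w l) * pderiv n j (fun z => gram n p z i l) y := by
      rw [h2, Finset.sum_comm]
      refine Finset.sum_congr rfl fun i _ => Finset.sum_congr rfl fun j _ =>
        Finset.sum_congr rfl fun l _ => ?_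
      ring
    have h3' : fderiv ℝ (chartMetric p) y w a b = ∑ i, ∑ j, ∑ l,
        (a i * b j * w l) * pderiv n l (fun z => gram n p z i j) y := by
      rw [h3, Finset.sum_comm]
      refine Finset.sum_congr rfl fun i _ => ?_
      rw [Finset.sum_comm]
      refine Finset.sum_congr rfl fun j _ => Finset.sum_congr rfl fun l _ => ?_
      ring
    have h5 : chartMetric p y (chartChristoffel p y a b) w = ∑ i, ∑ j, ∑ l,
        (∑ k, gram n p y k l * christoffel n p k i j y) * (a i * b j * w l) := by
      rw [chartMetric_apply]
      simp only [chartChristoffel_apply, Finset.sum_mul, Finset.mul_sum]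
      rw [Finset.sum_comm]
      rw [Finset.sum_congr rfl fun l _ => Finset.sum_comm]
      rw [Finset.sum_comm]
      refine Finset.sum_congr rfl fun i _ => ?_
      rw [Finset.sum_congr rfl fun l _ => Finset.sum_comm]
      rw [Finset.sum_comm]
      refine Finset.sum_congr rfl fun j _ => Finset.sum_congr rfl fun l _ =>
        Finset.sum_congr rfl fun k _ => ?_
      ring
    rw [h5, h1, h2', h3']
    simp only [gram_mul_christoffel p hy, h4]
    rw [← Finset.sum_add_distrib, ← Finset.sum_sub_distrib, Finset.mul_sum]
    refine Finset.sum_congr rfl fun x _ => ?_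
    ring


theorem fderiv_chartChristoffel_apply (p : M) {y : E} (hy : y ∈ (extChartAt (𝓡 n) p).target)
    (a b c : E) (l : Fin n) : fderiv ℝ (chartChristoffel p) y a b c l = ∑ i, ∑ j, ∑ k,
      pderiv n i (christoffel n p l j k) y * (a i * b j * c k) := by
  have hO : IsOpen (extChartAt (𝓡 n) p).target := isOpen_extChartAt_target p
  have hd : DifferentiableAt ℝ (chartChristoffel p) y :=
    ((contDiffOn_chartChristoffel p).contDiffAt (hO.mem_nhds hy)).differentiableAt (by simp)
  have h1 : ∀ i j k : Fin n, fderiv ℝ (chartChristoffel p) y (EuclideanSpace.single i 1)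
      (EuclideanSpace.single j 1) (EuclideanSpace.single k 1) l
      = pderiv n i (christoffel n p l j k) y := by
    intro i j k
    have h2 := (EuclideanSpace.proj l : E →L[ℝ] ℝ).hasFDerivAt.comp y
      ((hd.hasFDerivAt.clm_apply (hasFDerivAt_const (EuclideanSpace.single j (1 : ℝ)) y)).clm_apply
        (hasFDerivAt_const (EuclideanSpace.single k (1 : ℝ)) y))
    have h3 : (⇑(EuclideanSpace.proj l : E →L[ℝ] ℝ) ∘ fun z =>
        chartChristoffel p z (EuclideanSpace.single j (1 : ℝ)) (EuclideanSpace.single k (1 : ℝ)))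
        = christoffel n p l j k := by
      funext z
      change chartChristoffel p z (EuclideanSpace.single j (1 : ℝ)) (EuclideanSpace.single k 1) l = _
      rw [chartChristoffel_apply]
      simp
    rw [h3] at h2
    rw [pderiv, h2.fderiv]
    simp
  rw [trilinear_apply]
  simp only [WithLp.ofLp_sum, Finset.sum_apply, WithLp.ofLp_smul, Pi.smul_apply, smul_eq_mul, h1]
  refine Finset.sum_congr rfl fun i _ => Finset.sum_congr rfl fun j _ =>
    Finset.sum_congr rfl fun k _ => ?_
  ring

theorem sum₃_swap (f : Fin n → Fin n → Fin n → ℝ) :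
    ∑ i, ∑ j, ∑ k, f i j k = ∑ i, ∑ j, ∑ k, f j i k := Finset.sum_comm

theorem sum₄_rotate (f : Fin n → Fin n → Fin n → Fin n → ℝ) :
    ∑ i, ∑ j, ∑ k, ∑ l, f i j k l = ∑ l, ∑ i, ∑ j, ∑ k, f i j k l :=
  ((Finset.sum_congr rfl fun _ _ => (Finset.sum_congr rfl fun _ _ => Finset.sum_comm).trans
    Finset.sum_comm).trans Finset.sum_comm)

theorem sum_fin_four (f : (Fin 4 → Fin n) → ℝ) :
    ∑ I, f I = ∑ i, ∑ j, ∑ k, ∑ l, f ![i, j, k, l] := by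
  let e : (Fin 4 → Fin n) ≃ Fin n × Fin n × Fin n × Fin n :=
    { toFun := fun I => (I 0, I 1, I 2, I 3)
      invFun := fun x => ![x.1, x.2.1, x.2.2.1, x.2.2.2]
      left_inv := fun I => by
        funext a
        fin_cases a <;> rfl
      right_inv := fun x => rfl }
  rw [Fintype.sum_equiv e f (fun x => f (e.symm x)) fun I => by rw [e.symm_apply_apply]]
  simp only [Fintype.sum_prod_type]
  rfl

theorem christoffel_christoffel_apply (p : M) (y a b c : E) (l : Fin n) :
    chartChristoffel p y a (chartChristoffel p y b c) l = ∑ i, ∑ j, ∑ k,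
      (∑ m, christoffel n p m j k y * christoffel n p l i m y) * (a i * b j * c k) := by
  simp only [chartChristoffel_apply, Finset.mul_sum, Finset.sum_mul]
  refine Finset.sum_congr rfl fun i _ => ?_
  rw [Finset.sum_comm]
  refine Finset.sum_congr rfl fun j _ => ?_
  rw [Finset.sum_comm]
  refine Finset.sum_congr rfl fun k _ => Finset.sum_congr rfl fun m _ => ?_
  ring

theorem curvatureForm_chart_apply (p : M) {y : E} (hy : y ∈ (extChartAt (𝓡 n) p).target)
    (a b c : E) (l : Fin n) : curvatureForm (chartChristoffel p) y a b c l
      = ∑ i, ∑ j, ∑ k, riemannUp n p l i j k y * (a i * b j * c k) := by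
  change fderiv ℝ (chartChristoffel p) y a b c l - fderiv ℝ (chartChristoffel p) y b a c l
    + (chartChristoffel p y a (chartChristoffel p y b c) l
      - chartChristoffel p y b (chartChristoffel p y a c) l) = _
  rw [fderiv_chartChristoffel_apply p hy, fderiv_chartChristoffel_apply p hy,
    christoffel_christoffel_apply, christoffel_christoffel_apply,
    sum₃_swap fun i j k => pderiv n i (christoffel n p l j k) y * (b i * a j * c k),
    sum₃_swap fun i j k => (∑ m, christoffel n p m j k y * christoffel n p l i m y)
      * (b i * a j * c k)]
  simp only [← Finset.sum_sub_distrib, ← Finset.sum_add_distrib]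
  refine Finset.sum_congr rfl fun i _ => Finset.sum_congr rfl fun j _ =>
    Finset.sum_congr rfl fun k _ => ?_
  rw [riemannUp, Finset.sum_sub_distrib]
  ring

theorem chartMetric_curvatureForm (p : M) {y : E} (hy : y ∈ (extChartAt (𝓡 n) p).target)
    (a b c d : E) : chartMetric p y (curvatureForm (chartChristoffel p) y a b c) d
      = ∑ i, ∑ j, ∑ k, ∑ l, riemann n p i j k l y * (a i * b j * c k * d l) := by
  have hs : ∀ m l, gram n p y m l = gram n p y l m := fun m l => by
    rw [← chartMetric_single, ← chartMetric_single, chartMetric_symm]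
  rw [chartMetric_apply]
  simp only [curvatureForm_chart_apply p hy, riemann, Finset.sum_mul, Finset.mul_sum]
  conv_lhs => rw [Finset.sum_comm]
  conv_rhs => rw [sum₄_rotate]
  refine Finset.sum_congr rfl fun l _ => ?_
  conv_rhs => rw [sum₄_rotate]
  refine Finset.sum_congr rfl fun m _ => Finset.sum_congr rfl fun i _ =>
    Finset.sum_congr rfl fun j _ => Finset.sum_congr rfl fun k _ => ?_
  rw [hs]
  ring

-- With `G = BᵀB` and `C = B⁻¹`, components are taken in an orthonormal frame: the norm becomes the
-- plain sum of squares of the components `S K`, and the estimate is Cauchy–Schwarz over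
-- multi-indices.
open scoped MatrixOrder in
theorem sum_mul_prod_sq_le {r : ℕ} {G : Matrix (Fin n) (Fin n) ℝ} (hG : G.PosDef)
    (T : (Fin r → Fin n) → ℝ) (x : Fin r → Fin n → ℝ) :
    (∑ I, T I * ∏ a, x a (I a)) ^ 2 ≤
      (∑ I : Fin r → Fin n, ∑ J : Fin r → Fin n, (∏ a, G⁻¹ (I a) (J a)) * T I * T J)
        * ∏ a, (x a ⬝ᵥ G.mulVec (x a)) := by
  obtain ⟨B, hB⟩ : ∃ B : Matrix (Fin n) (Fin n) ℝ, G = B.transpose * B := by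
    obtain ⟨X, hX, -, h⟩ := CFC.exists_sqrt_of_isSelfAdjoint_of_quasispectrumRestricts
      (show IsSelfAdjoint G from hG.isHermitian)
      (QuasispectrumRestricts.nnreal_of_nonneg hG.posSemidef.nonneg)
    exact ⟨X, by rw [← h]; exact congrArg (· * X) hX.star_eq.symm⟩
  have hdet : IsUnit B.det := by
    have h1 := hG.det_pos
    rw [hB, Matrix.det_mul] at h1
    exact (right_ne_zero_of_mul h1.ne').isUnit
  set C := B⁻¹ with hC
  have hGi : ∀ i j, G⁻¹ i j = ∑ k, C i k * C j k := by
    intro i j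
    rw [hB, Matrix.mul_inv_rev, ← Matrix.transpose_nonsing_inv, ← hC]
    rfl
  set ξ : Fin r → Fin n → ℝ := fun a => B.mulVec (x a) with hξ
  have hx : ∀ a i, x a i = ∑ k, C i k * ξ a k := by
    intro a i
    have : x a = C.mulVec (B.mulVec (x a)) := by
      rw [Matrix.mulVec_mulVec, hC, Matrix.nonsing_inv_mul _ hdet, Matrix.one_mulVec]
    conv_lhs => rw [this]
    rfl
  have hq : ∀ a, x a ⬝ᵥ G.mulVec (x a) = ∑ k, ξ a k ^ 2 := by
    intro a
    rw [hB, ← Matrix.mulVec_mulVec, Matrix.dotProduct_mulVec, Matrix.vecMul_transpose]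
    simp only [dotProduct, hξ, sq]
  let S : (Fin r → Fin n) → ℝ := fun K => ∑ I, T I * ∏ a, C (I a) (K a)
  have h1 : ∑ I, T I * ∏ a, x a (I a) = ∑ K : Fin r → Fin n, S K * ∏ a, ξ a (K a) := by
    simp only [hx, Finset.prod_univ_sum, Fintype.piFinset_univ, S, Finset.sum_mul, Finset.mul_sum]
    rw [Finset.sum_comm]
    refine Finset.sum_congr rfl fun K _ => Finset.sum_congr rfl fun I _ => ?_
    rw [Finset.prod_mul_distrib]
    ring
  have h2 : ∑ I : Fin r → Fin n, ∑ J : Fin r → Fin n, (∏ a, G⁻¹ (I a) (J a)) * T I * T J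
      = ∑ K, S K ^ 2 := by
    simp only [hGi, Finset.prod_univ_sum, Fintype.piFinset_univ, S, sq, Finset.sum_mul,
      Finset.mul_sum]
    rw [Finset.sum_congr rfl fun I _ => Finset.sum_comm, Finset.sum_comm]
    refine Finset.sum_congr rfl fun K _ => ?_
    rw [Finset.sum_comm]
    refine Finset.sum_congr rfl fun J _ => Finset.sum_congr rfl fun I _ => ?_
    rw [Finset.prod_mul_distrib]
    ring
  have h3 : ∏ a, (x a ⬝ᵥ G.mulVec (x a)) = ∑ K : Fin r → Fin n, (∏ a, ξ a (K a)) ^ 2 := by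
    simp only [hq, Finset.prod_univ_sum, Fintype.piFinset_univ, Finset.prod_pow]
  rw [h1, h2, h3]
  exact Finset.sum_mul_sq_le_sq_mul_sq _ _ _

/-- The tensor norm bounds the curvature tensor evaluated on the four vectors `a, b, a, b`. -/
theorem curvature_sq_le (p : M) {y : E} (hy : y ∈ (extChartAt (𝓡 n) p).target) (a b : E) :
    chartMetric p y (curvatureForm (chartChristoffel p) y a b a) b ^ 2 ≤
      tensorNormSq n p (curvDeriv n p 0) y * (chartMetric p y a a * chartMetric p y b b) ^ 2 := by
  let x : Fin 4 → E := ![a, b, a, b]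
  have h := sum_mul_prod_sq_le (posDef_gram p hy) (r := 4) (fun J => curvDeriv n p 0 J y)
    fun i => WithLp.ofLp (x i)
  have h1 : ∏ i : Fin 4, (WithLp.ofLp (x i) ⬝ᵥ (gram n p y).mulVec (WithLp.ofLp (x i)))
      = (chartMetric p y a a * chartMetric p y b b) ^ 2 := by
    rw [Fin.prod_univ_four, chartMetric_eq_dotProduct, chartMetric_eq_dotProduct]
    change (a.ofLp ⬝ᵥ (gram n p y).mulVec a.ofLp) * (b.ofLp ⬝ᵥ (gram n p y).mulVec b.ofLp) *
      (a.ofLp ⬝ᵥ (gram n p y).mulVec a.ofLp) * (b.ofLp ⬝ᵥ (gram n p y).mulVec b.ofLp) = _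
    ring
  have h2 : ∑ I : Fin 4 → Fin n, curvDeriv n p 0 I y * ∏ i, (x i) (I i)
      = chartMetric p y (curvatureForm (chartChristoffel p) y a b a) b := by
    rw [chartMetric_curvatureForm p hy, sum_fin_four]
    refine Finset.sum_congr rfl fun i _ => Finset.sum_congr rfl fun j _ =>
      Finset.sum_congr rfl fun k _ => Finset.sum_congr rfl fun l _ => ?_
    rw [Fin.prod_univ_four]
    rfl
  rw [h1, h2] at h
  exact h

end ChartMetric

/-! ### Geodesics -/

section Geodesics

set_option maxSynthPendingDepth 4

variable {n : ℕ} {M : Type*} [TopologicalSpace M] [ChartedSpace (EuclideanSpace ℝ (Fin n)) M]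
  [IsManifold (𝓡 n) ∞ M]
  [RiemannianBundle (fun x : M => TangentSpace (𝓡 n) x)]
  [IsContMDiffRiemannianBundle (𝓡 n) ∞ (EuclideanSpace ℝ (Fin n))
      (fun x : M => TangentSpace (𝓡 n) x)]

local notation "E" => EuclideanSpace ℝ (Fin n)

/-- All tangent spaces are the model space as types, but their inner products depend on the base
point; this transports an inner product along an equality of points. -/
theorem inner_congr_base {x y : M} (h : x = y) (u v : E) :
    @inner ℝ (TangentSpace (𝓡 n) x) _ u v = @inner ℝ (TangentSpace (𝓡 n) y) _ u v := by
  subst h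
  rfl

variable {W : Type*} [NormedAddCommGroup W] [NormedSpace ℝ W]

theorem contDiffAt_extChartAt_comp {f : W → M} {z : W} {p : M}
    (hf : ContMDiffAt 𝓘(ℝ, W) (𝓡 n) ∞ f z) (hp : f z ∈ (extChartAt (𝓡 n) p).source) :
    ContDiffAt ℝ ∞ (extChartAt (𝓡 n) p ∘ f) z := by
  rw [← contMDiffAt_iff_contDiffAt]
  refine ContMDiffAt.comp z ?_ hf
  exact contMDiffAt_extChartAt' (by rwa [extChartAt_source] at hp)

theorem eventually_mem_source {f : W → M} {z : W} {p : M}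
    (hf : ContMDiffAt 𝓘(ℝ, W) (𝓡 n) ∞ f z) (hp : f z ∈ (extChartAt (𝓡 n) p).source) :
    ∀ᶠ w in 𝓝 z, f w ∈ (extChartAt (𝓡 n) p).source :=
  hf.continuousAt.eventually ((isOpen_extChartAt_source p).mem_nhds hp)

theorem mfderiv_eq_comp_extChartAt {f : W → M} {z : W} {p : M}
    (hf : ContMDiffAt 𝓘(ℝ, W) (𝓡 n) ∞ f z) (hp : f z ∈ (extChartAt (𝓡 n) p).source) (a : W) :
    (mfderiv 𝓘(ℝ, W) (𝓡 n) f z a : E) = mfderiv 𝓘(ℝ, E) (𝓡 n) (extChartAt (𝓡 n) p).symm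
      (extChartAt (𝓡 n) p (f z)) (fderiv ℝ (extChartAt (𝓡 n) p ∘ f) z a) := by
  have h1 : f =ᶠ[𝓝 z] (extChartAt (𝓡 n) p).symm ∘ (extChartAt (𝓡 n) p ∘ f) := by
    filter_upwards [eventually_mem_source hf hp] with w hw
    exact ((extChartAt (𝓡 n) p).left_inv hw).symm
  have hy : extChartAt (𝓡 n) p (f z) ∈ (extChartAt (𝓡 n) p).target :=
    (extChartAt (𝓡 n) p).map_source hp
  have h2 : MDifferentiableAt 𝓘(ℝ, E) (𝓡 n) (extChartAt (𝓡 n) p).symm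
      (extChartAt (𝓡 n) p (f z)) := by
    have := mdifferentiableWithinAt_extChartAt_symm (I := 𝓡 n) hy
    rwa [ModelWithCorners.range_eq_univ, mdifferentiableWithinAt_univ] at this
  have h3 : MDifferentiableAt 𝓘(ℝ, W) 𝓘(ℝ, E) (extChartAt (𝓡 n) p ∘ f) z :=
    ((contDiffAt_extChartAt_comp hf hp).differentiableAt (by simp)).mdifferentiableAt
  have h4 := h1.mfderiv_eq (I := 𝓘(ℝ, W)) (I' := 𝓡 n)
  have h5 := mfderiv_comp (I := 𝓘(ℝ, W)) (I' := 𝓘(ℝ, E)) (I'' := 𝓡 n) z h2 h3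
  have h6 := congrArg (fun L : W →L[ℝ] E => L a) (h4.trans h5)
  rw [mfderiv_eq_fderiv] at h6
  exact h6

theorem inner_mfderiv_eq_chartMetric {f : W → M} {z : W} {p : M}
    (hf : ContMDiffAt 𝓘(ℝ, W) (𝓡 n) ∞ f z) (hp : f z ∈ (extChartAt (𝓡 n) p).source) (a b : W) :
    ⟪(mfderiv 𝓘(ℝ, W) (𝓡 n) f z a : TangentSpace (𝓡 n) (f z)), mfderiv 𝓘(ℝ, W) (𝓡 n) f z b⟫_ℝ
      = chartMetric p (extChartAt (𝓡 n) p (f z)) (fderiv ℝ (extChartAt (𝓡 n) p ∘ f) z a)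
        (fderiv ℝ (extChartAt (𝓡 n) p ∘ f) z b) := by
  rw [chartMetric_eq_inner]
  have h := inner_congr_base ((extChartAt (𝓡 n) p).left_inv hp).symm
    (mfderiv 𝓘(ℝ, W) (𝓡 n) f z a : E) (mfderiv 𝓘(ℝ, W) (𝓡 n) f z b : E)
  refine h.trans ?_
  rw [mfderiv_eq_comp_extChartAt hf hp, mfderiv_eq_comp_extChartAt hf hp]

theorem contMDiffAt_extChartAt_symm (q : M) {y : E} (hy : y ∈ (extChartAt (𝓡 n) q).target) :
    ContMDiffAt 𝓘(ℝ, E) (𝓡 n) ∞ (extChartAt (𝓡 n) q).symm y :=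
  (contMDiffOn_extChartAt_symm q).contMDiffAt ((isOpen_extChartAt_target q).mem_nhds hy)

/-- The metrics of two charts are related by the change of coordinates. -/
theorem chartMetric_change (p q : M) {y : E} (hy : y ∈ (extChartAt (𝓡 n) q).target)
    (hp : (extChartAt (𝓡 n) q).symm y ∈ (extChartAt (𝓡 n) p).source) (a b : E) :
    chartMetric q y a b = chartMetric p ((extChartAt (𝓡 n) p ∘ (extChartAt (𝓡 n) q).symm) y)
      (fderiv ℝ (extChartAt (𝓡 n) p ∘ (extChartAt (𝓡 n) q).symm) y a)
      (fderiv ℝ (extChartAt (𝓡 n) p ∘ (extChartAt (𝓡 n) q).symm) y b) := by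
  rw [chartMetric_eq_inner, inner_mfderiv_eq_chartMetric (contMDiffAt_extChartAt_symm q hy) hp]
  rfl

/-- The change of coordinates pulls back a metric to a definite one, so its derivative is injective,
hence surjective by equality of dimensions. -/
theorem surjective_fderiv_change (p q : M) {y : E} (hy : y ∈ (extChartAt (𝓡 n) q).target)
    (hp : (extChartAt (𝓡 n) q).symm y ∈ (extChartAt (𝓡 n) p).source) :
    Function.Surjective (fderiv ℝ (extChartAt (𝓡 n) p ∘ (extChartAt (𝓡 n) q).symm) y) := by
  set L := fderiv ℝ (extChartAt (𝓡 n) p ∘ (extChartAt (𝓡 n) q).symm) y with hL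
  have hinj : Function.Injective (L : E →ₗ[ℝ] E) := by
    rw [injective_iff_map_eq_zero]
    intro a ha
    by_contra h0
    have h1 := chartMetric_pos q hy h0
    rw [chartMetric_change p q hy hp] at h1
    have ha' : L a = 0 := ha
    rw [← hL, ha', map_zero] at h1
    exact lt_irrefl _ h1
  exact LinearMap.injective_iff_surjective.1 hinj

theorem IsEnergyCriticalAt.congr {g : E → E →L[ℝ] E →L[ℝ] ℝ} {c₁ c₂ : ℝ → E} {t : ℝ}
    (h : c₁ =ᶠ[𝓝 t] c₂) (H : IsEnergyCriticalAt g c₁ t) : IsEnergyCriticalAt g c₂ t := by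
  intro w
  rw [← h.eq_of_nhds, ← h.deriv_eq, ← h.deriv.deriv_eq]
  exact H w

/-- The geodesic equation in an arbitrary chart. -/
theorem IsGeodesicAt.isEnergyCriticalAt {γ : ℝ → M} {t : ℝ} (hγ : IsGeodesicAt n γ t) {p : M}
    (hp : γ t ∈ (extChartAt (𝓡 n) p).source) :
    IsEnergyCriticalAt (chartMetric p) (extChartAt (𝓡 n) p ∘ γ) t := by
  obtain ⟨hs, hg⟩ := hγ
  set q := γ t with hq
  have hqs : γ t ∈ (extChartAt (𝓡 n) q).source := mem_extChartAt_source q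
  set c : ℝ → E := extChartAt (𝓡 n) q ∘ γ with hc
  have hct : c t ∈ (extChartAt (𝓡 n) q).target := (extChartAt (𝓡 n) q).map_source hqs
  have hsymm : (extChartAt (𝓡 n) q).symm (c t) = γ t := (extChartAt (𝓡 n) q).left_inv hqs
  have hcd : ContDiffAt ℝ ∞ c t := contDiffAt_extChartAt_comp hs hqs
  have h1 : IsEnergyCriticalAt (chartMetric q) c t := by
    rw [(isLeviCivitaOn_chart q).isEnergyCriticalAt_iff hct]
    ext k
    have h2 := hg k
    change deriv (deriv c) t k + chartChristoffel q (c t) (deriv c t) (deriv c t) k = 0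
    rw [chartChristoffel_apply]
    exact h2
  set ψ : E → E := extChartAt (𝓡 n) p ∘ (extChartAt (𝓡 n) q).symm with hψ
  have hps : (extChartAt (𝓡 n) q).symm (c t) ∈ (extChartAt (𝓡 n) p).source := by rwa [hsymm]
  have hψd : ContDiffAt ℝ ∞ ψ (c t) :=
    contDiffAt_extChartAt_comp (contMDiffAt_extChartAt_symm q hct) hps
  have hψt : ψ (c t) ∈ (extChartAt (𝓡 n) p).target := (extChartAt (𝓡 n) p).map_source hps
  have h2 : IsEnergyCriticalAt (chartMetric p) (ψ ∘ c) t := by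
    refine h1.comp (hcd.of_le two_le_infty) (hψd.of_le two_le_infty)
      ((isLeviCivitaOn_chart p).differentiableAt_metric hψt)
      ((isLeviCivitaOn_chart q).differentiableAt_metric hct)
      (fun a b => chartMetric_symm p _ a b) ?_ (surjective_fderiv_change p q hct hps)
    filter_upwards [(isOpen_extChartAt_target q).mem_nhds hct,
      eventually_mem_source (contMDiffAt_extChartAt_symm q hct) hps] with z hz hz' a b
    exact chartMetric_change p q hz hz' a b
  refine h2.congr ?_
  filter_upwards [eventually_mem_source hs hqs] with s hs'
  change extChartAt (𝓡 n) p ((extChartAt (𝓡 n) q).symm (extChartAt (𝓡 n) q (γ s))) = _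
  rw [(extChartAt (𝓡 n) q).left_inv hs']
  rfl

theorem IsGeodesicAt.deriv_deriv_add_eq_zero {γ : ℝ → M} {t : ℝ} (hγ : IsGeodesicAt n γ t) {p : M}
    (hp : γ t ∈ (extChartAt (𝓡 n) p).source) :
    deriv (deriv (extChartAt (𝓡 n) p ∘ γ)) t
      + chartChristoffel p ((extChartAt (𝓡 n) p ∘ γ) t) (deriv (extChartAt (𝓡 n) p ∘ γ) t)
        (deriv (extChartAt (𝓡 n) p ∘ γ) t) = 0 :=
  ((isLeviCivitaOn_chart p).isEnergyCriticalAt_iff ((extChartAt (𝓡 n) p).map_source hp)).1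
    (hγ.isEnergyCriticalAt hp)

end Geodesics

/-! ### The exponential map -/

section Exponential

set_option maxSynthPendingDepth 4

variable {n : ℕ} {M : Type*} [TopologicalSpace M] [T2Space M]
  [ChartedSpace (EuclideanSpace ℝ (Fin n)) M] [IsManifold (𝓡 n) ∞ M]
  [RiemannianBundle (fun x : M => TangentSpace (𝓡 n) x)]
  [IsContMDiffRiemannianBundle (𝓡 n) ∞ (EuclideanSpace ℝ (Fin n))
      (fun x : M => TangentSpace (𝓡 n) x)]

local notation "E" => EuclideanSpace ℝ (Fin n)

/-- Continuous induction on `[0, 1]`: the set of times up to which the curves agree is closed, and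
local uniqueness for the geodesic equation, in the chart at the common point, extends it to the
right. -/
theorem eqOn_of_isGeodesicAt {γ₁ γ₂ : ℝ → M} (h₁ : ∀ t ∈ Icc (0 : ℝ) 1, IsGeodesicAt n γ₁ t)
    (h₂ : ∀ t ∈ Icc (0 : ℝ) 1, IsGeodesicAt n γ₂ t) (h0 : γ₁ 0 = γ₂ 0)
    (h0' : deriv (extChartAt (𝓡 n) (γ₁ 0) ∘ γ₁) 0 = deriv (extChartAt (𝓡 n) (γ₁ 0) ∘ γ₂) 0) :
    EqOn γ₁ γ₂ (Icc 0 1) := by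
  have hc : ∀ γ : ℝ → M, (∀ t ∈ Icc (0 : ℝ) 1, IsGeodesicAt n γ t) → ContinuousOn γ (Icc 0 1) :=
    fun γ h t ht => (h t ht).1.continuousAt.continuousWithinAt
  let S : Set ℝ := {t | ∀ s ∈ Icc 0 t, γ₁ s = γ₂ s}
  have hcl : IsClosed (S ∩ Icc 0 1) := by
    have hclosed : IsClosed {t | t ∈ Icc (0 : ℝ) 1 ∧ γ₁ t = γ₂ t} :=
      ((hc γ₁ h₁).prodMk (hc γ₂ h₂)).preimage_isClosed_of_isClosed isClosed_Icc
        isClosed_diagonal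
    refine isClosed_of_closure_subset fun t ht => ?_
    have ht1 : t ∈ Icc (0 : ℝ) 1 :=
      closure_minimal inter_subset_right isClosed_Icc ht
    refine ⟨fun s hs => ?_, ht1⟩
    rcases hs.2.eq_or_lt with rfl | hlt
    · have : s ∈ {t | t ∈ Icc (0 : ℝ) 1 ∧ γ₁ t = γ₂ t} :=
        closure_minimal (show S ∩ Icc 0 1 ⊆ {t | t ∈ Icc (0 : ℝ) 1 ∧ γ₁ t = γ₂ t} from
          fun τ hτ => ⟨hτ.2, hτ.1 τ ⟨hτ.2.1, le_rfl⟩⟩) hclosed ht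
      exact this.2
    · obtain ⟨τ, hτ, hτS⟩ := mem_closure_iff.1 ht (Ioi s) isOpen_Ioi hlt
      exact hτS.1 s ⟨hs.1, le_of_lt hτ⟩
  have hsub : Icc (0 : ℝ) 1 ⊆ S := by
    refine hcl.Icc_subset_of_forall_exists_gt (fun s hs => ?_) fun t ht y hy => ?_
    · rw [le_antisymm hs.2 hs.1, h0]
    · have htI : t ∈ Icc (0 : ℝ) 1 := Ico_subset_Icc_self ht.2
      have heq : γ₁ t = γ₂ t := ht.1 t ⟨htI.1, le_rfl⟩
      set p := γ₁ t with hp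
      have hp1 : γ₁ t ∈ (extChartAt (𝓡 n) p).source := mem_extChartAt_source p
      have hp2 : γ₂ t ∈ (extChartAt (𝓡 n) p).source := by rw [← heq]; exact mem_extChartAt_source p
      have hd1 := contDiffAt_extChartAt_comp (h₁ t htI).1 hp1
      have hd2 := contDiffAt_extChartAt_comp (h₂ t htI).1 hp2
      have hge : Icc t 1 ∈ 𝓝[≥] t := Icc_mem_nhdsGE ht.2.2
      have hev : ∀ γ : ℝ → M, (∀ t ∈ Icc (0 : ℝ) 1, IsGeodesicAt n γ t) →
          γ t ∈ (extChartAt (𝓡 n) p).source → ∀ᶠ s in 𝓝[≥] t,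
          deriv (deriv (extChartAt (𝓡 n) p ∘ γ)) s + chartChristoffel p
            ((extChartAt (𝓡 n) p ∘ γ) s) (deriv (extChartAt (𝓡 n) p ∘ γ) s)
            (deriv (extChartAt (𝓡 n) p ∘ γ) s) = 0 := by
        intro γ h hγ
        filter_upwards [hge, (eventually_mem_source (h t htI).1 hγ).filter_mono
          nhdsWithin_le_nhds] with s hs hs'
        exact (h s ⟨htI.1.trans hs.1, hs.2⟩).deriv_deriv_add_eq_zero hs'
      -- Equality of velocities is a hypothesis at `0`; at a later time the curves agree on the
      -- left, and a left derivative determines the velocity.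
      have hder : deriv (extChartAt (𝓡 n) p ∘ γ₁) t = deriv (extChartAt (𝓡 n) p ∘ γ₂) t := by
        rcases htI.1.eq_or_lt with h | h
        · subst h
          exact h0'
        · have hu : UniqueDiffWithinAt ℝ (Icc 0 t) t := uniqueDiffOn_Icc h t ⟨h.le, le_rfl⟩
          have e1 := (hd1.differentiableAt (by simp)).hasDerivAt.hasDerivWithinAt (s := Icc 0 t)
          have e2 := (hd2.differentiableAt (by simp)).hasDerivAt.hasDerivWithinAt (s := Icc 0 t)
          exact hu.eq_deriv _ e1 (e2.congr (fun s hs => congrArg _ (ht.1 s hs))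
            (congrArg _ heq))
      have hE := (isLeviCivitaOn_chart p).eventuallyEq_of_geodesic
        ((extChartAt (𝓡 n) p).map_source hp1) (hd1.of_le two_le_infty) (hd2.of_le two_le_infty)
        (hev γ₁ h₁ hp1) (hev γ₂ h₂ hp2) (congrArg _ heq) hder
      have hE' : ∀ᶠ s in 𝓝[≥] t, γ₁ s = γ₂ s := by
        filter_upwards [hE, (eventually_mem_source (h₁ t htI).1 hp1).filter_mono
          nhdsWithin_le_nhds, (eventually_mem_source (h₂ t htI).1 hp2).filter_mono
          nhdsWithin_le_nhds] with s h1 h2 h3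
        exact (extChartAt (𝓡 n) p).injOn h2 h3 h1
      obtain ⟨b, hb, hbs⟩ := mem_nhdsGE_iff_exists_Icc_subset.1 hE'
      refine ⟨min b y, fun s hs => ?_, lt_min hb hy, min_le_right _ _⟩
      rcases le_total s t with h | h
      · exact ht.1 s ⟨hs.1, h⟩
      · exact hbs ⟨h, hs.2.trans (min_le_left _ _)⟩
  exact fun t ht => hsub ht t ⟨ht.1, le_rfl⟩

/-- Both terms of the geodesic equation are homogeneous of degree two under a linear change of time.
-/
theorem IsGeodesicAt.comp_mul {γ : ℝ → M} {s t : ℝ} (h : IsGeodesicAt n γ (s * t)) :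
    IsGeodesicAt n (fun τ => γ (s * τ)) t := by
  obtain ⟨h1, h2⟩ := h
  refine ⟨ContMDiffAt.comp (I' := 𝓘(ℝ, ℝ)) t h1
    (contDiff_const.mul contDiff_id).contMDiff.contMDiffAt, fun k => ?_⟩
  set c : ℝ → E := fun τ => extChartAt (𝓡 n) (γ (s * t)) (γ τ) with hc
  have e1 : deriv (fun τ => extChartAt (𝓡 n) (γ (s * t)) (γ (s * τ))) = fun τ =>
      s • deriv c (s * τ) := funext fun τ => deriv_comp_mul_left s c τ
  have e2 : deriv (fun τ => s • deriv c (s * τ)) t = s • (s • deriv (deriv c) (s * t)) := by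
    rw [deriv_fun_const_smul_field]
    exact congrArg _ (deriv_comp_mul_left s (deriv c) t)
  have h3 := h2 k
  simp only at h3
  simp only
  rw [e1, e2]
  simp only [PiLp.smul_apply, smul_eq_mul]
  have h4 : ∀ (a b : ℝ) (G : Fin n → Fin n → ℝ) (u : Fin n → ℝ),
      a + ∑ i, ∑ j, G i j * u i * u j = 0 →
      b * (b * a) + ∑ i, ∑ j, G i j * (b * u i) * (b * u j) = 0 := by
    intro a b G u h
    rw [← mul_zero (b * b), ← h, mul_add, Finset.mul_sum]
    simp only [Finset.mul_sum]
    congr 1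
    · ring
    · refine Finset.sum_congr rfl fun i _ => Finset.sum_congr rfl fun j _ => ?_
      ring
  exact h4 _ s _ _ h3

theorem deriv_extChartAt_comp {γ : ℝ → M} {t : ℝ} {p : M}
    (h : ContMDiffAt 𝓘(ℝ, ℝ) (𝓡 n) ∞ γ t) (hp : γ t ∈ (extChartAt (𝓡 n) p).source) :
    deriv (extChartAt (𝓡 n) p ∘ γ) t = (mfderiv (𝓡 n) 𝓘(ℝ, E) (extChartAt (𝓡 n) p) (γ t)
      (mfderiv 𝓘(ℝ, ℝ) (𝓡 n) γ t (1 : ℝ)) : E) := by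
  have h1 := mfderiv_comp (I := 𝓘(ℝ, ℝ)) (I' := 𝓡 n) (I'' := 𝓘(ℝ, E)) t
    (mdifferentiableAt_extChartAt (by rwa [extChartAt_source] at hp)) (h.mdifferentiableAt (by simp))
  have h2 := congrArg (fun L : ℝ →L[ℝ] E => L 1) h1
  rw [mfderiv_eq_fderiv] at h2
  exact h2

/-- The derivative at `x` of the chart at `x` is the identity, so the initial velocity can be read
in this chart, without dependent types. -/
theorem IsExp.exists_geodesic {x y : M} {v : TangentSpace (𝓡 n) x} (h : IsExp n x v y) :
    ∃ γ : ℝ → M, (∀ t ∈ Icc (0 : ℝ) 1, IsGeodesicAt n γ t) ∧ γ 0 = x ∧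
      deriv (extChartAt (𝓡 n) x ∘ γ) 0 = (v : E) ∧ γ 1 = y := by
  obtain ⟨γ, h1, h2, h3⟩ := h
  have h0 : γ 0 = x := congrArg TotalSpace.proj h2
  refine ⟨γ, h1, h0, ?_, h3⟩
  have h4 := congrArg (fun q : TangentBundle (𝓡 n) M =>
    (mfderiv (𝓡 n) 𝓘(ℝ, E) (extChartAt (𝓡 n) x) q.1 q.2 : E)) h2
  simp only at h4
  rw [deriv_extChartAt_comp (h1 0 ⟨le_rfl, zero_le_one⟩).1
    (by rw [h0]; exact mem_extChartAt_source x)]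
  refine h4.trans ?_
  rw [mfderiv_extChartAt_self]
  rfl

end Exponential

/-! ### Normal coordinates -/

section NormalCoordinates

set_option maxSynthPendingDepth 4

variable {n : ℕ} {M : Type*} [TopologicalSpace M]
  [ChartedSpace (EuclideanSpace ℝ (Fin n)) M] [IsManifold (𝓡 n) ∞ M]
  [RiemannianBundle (fun x : M => TangentSpace (𝓡 n) x)]
  [IsContMDiffRiemannianBundle (𝓡 n) ∞ (EuclideanSpace ℝ (Fin n))
      (fun x : M => TangentSpace (𝓡 n) x)]

local notation "E" => EuclideanSpace ℝ (Fin n)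

/-- The map `F = exp_x ∘ L`, with `L : ℝⁿ → T_x M` a linear isometry, is a system of normal
coordinates at `x` on the ball of radius `r`. -/
structure IsNormalChart (x : M) (L : E ≃ₗᵢ[ℝ] TangentSpace (𝓡 n) x) (F : E → M) (r : ℝ) :
    Prop where
  contMDiffOn : ContMDiffOn 𝓘(ℝ, E) (𝓡 n) ∞ F (Metric.ball 0 r)
  injOn : InjOn F (Metric.ball 0 r)
  injective_mfderiv : ∀ v ∈ Metric.ball (0 : E) r,
    Function.Injective (mfderiv 𝓘(ℝ, E) (𝓡 n) F v)
  isOpen_image : ∀ U ⊆ Metric.ball (0 : E) r, IsOpen U → IsOpen (F '' U)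
  isExp : ∀ v ∈ Metric.ball (0 : E) r, IsExp n x (L v) (F v)

theorem exists_linearIsometryEquiv_tangentSpace (x : M) :
    Nonempty (E ≃ₗᵢ[ℝ] TangentSpace (𝓡 n) x) := by
  have h : Module.finrank ℝ (TangentSpace (𝓡 n) x) = n :=
    (finrank_euclideanSpace_fin (𝕜 := ℝ) (n := n) :)
  have : FiniteDimensional ℝ (TangentSpace (𝓡 n) x) :=
    inferInstanceAs (FiniteDimensional ℝ E)
  exact ⟨((stdOrthonormalBasis ℝ (TangentSpace (𝓡 n) x)).reindex (finCongr h)).repr.symm⟩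

/-- Any `r` strictly below the infimum of the injectivity radii lies, at each `x`, below a radius on
which `exp_x` is a diffeomorphism. This map is composed with an isometry onto `T_x M` and
restricted; its derivative is injective by the chain rule with the inverse. -/
theorem BoundedGeometry.exists_isNormalChart (hM : BoundedGeometry n M) :
    ∃ r : ℝ, 0 < r ∧ ∀ x : M, ∃ L F, IsNormalChart (n := n) x L F r := by
  obtain ⟨r, hr, hrM⟩ : ∃ r : ℝ, 0 < r ∧ ∀ x : M, ENNReal.ofReal r < injRadius n x := by
    obtain ⟨c, hc0, hc⟩ := exists_between hM.injRadius_pos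
    refine ⟨c.toReal, ENNReal.toReal_pos hc0.ne' hc.ne_top, fun x => ?_⟩
    rw [ENNReal.ofReal_toReal hc.ne_top]
    exact hc.trans_le (iInf_le _ x)
  refine ⟨r, hr, fun x => ?_⟩
  obtain ⟨ρ, ⟨Φ, hΦs, hΦ, hΦ', hexp⟩, hρ⟩ := lt_sSup_iff.1 (hrM x)
  obtain ⟨L⟩ := exists_linearIsometryEquiv_tangentSpace (n := n) x
  have hmem : ∀ v ∈ Metric.ball (0 : E) r, L v ∈ Φ.source := by
    intro v hv
    rw [hΦs, mem_ofPred_eq, ← ofReal_norm, L.norm_map]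
    refine lt_of_le_of_lt (ENNReal.ofReal_le_ofReal ?_) hρ
    exact (mem_ball_zero_iff.1 hv).le
  have hL : ContMDiff 𝓘(ℝ, E) 𝓘(ℝ, TangentSpace (𝓡 n) x) ∞ L :=
    L.toContinuousLinearEquiv.contDiff.contMDiff
  have hL' : ContMDiff 𝓘(ℝ, TangentSpace (𝓡 n) x) 𝓘(ℝ, E) ∞ L.symm :=
    L.symm.toContinuousLinearEquiv.contDiff.contMDiff
  have hsm : ContMDiffOn 𝓘(ℝ, E) (𝓡 n) ∞ (Φ ∘ L) (Metric.ball 0 r) :=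
    hΦ.comp hL.contMDiffOn hmem
  refine ⟨L, Φ ∘ L, hsm, ?_, ?_, ?_, fun v hv => hexp _ (hmem v hv)⟩
  · intro v hv w hw h
    exact L.injective (Φ.injOn (hmem v hv) (hmem w hw) h)
  · intro v hv
    have hnv : Metric.ball (0 : E) r ∈ 𝓝 v := Metric.isOpen_ball.mem_nhds hv
    have h1 : MDifferentiableAt 𝓘(ℝ, E) (𝓡 n) (Φ ∘ L) v :=
      (hsm.contMDiffAt hnv).mdifferentiableAt (by simp)
    have h2 : MDifferentiableAt (𝓡 n) 𝓘(ℝ, E) (L.symm ∘ Φ.symm) ((Φ ∘ L) v) :=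
      (hL'.comp_contMDiffOn hΦ').contMDiffAt
        (Φ.open_target.mem_nhds (Φ.map_source (hmem v hv))) |>.mdifferentiableAt (by simp)
    have h3 := mfderiv_comp v h2 h1
    have h4 : (L.symm ∘ Φ.symm) ∘ (Φ ∘ L) =ᶠ[𝓝 v] id := by
      filter_upwards [hnv] with w hw
      simp [Φ.left_inv (hmem w hw)]
    rw [h4.mfderiv_eq, mfderiv_id] at h3
    intro a b hab
    have h5 := fun a => congrArg (fun A : E →L[ℝ] E => A a) h3
    have ha := h5 a
    have hb := h5 b
    exact ha.trans ((congrArg (fun z => mfderiv (𝓡 n) 𝓘(ℝ, E) (L.symm ∘ Φ.symm) ((Φ ∘ L) v) z)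
      hab).trans hb.symm)
  · intro U hU hUo
    rw [image_comp]
    refine Φ.isOpen_image_of_subset_source (L.toHomeomorph.isOpenMap U hUo) ?_
    rintro _ ⟨v, hv, rfl⟩
    exact hmem v (hU hv)

namespace IsNormalChart

variable {x : M} {L : EuclideanSpace ℝ (Fin n) ≃ₗᵢ[ℝ] TangentSpace (𝓡 n) x}
  {F : EuclideanSpace ℝ (Fin n) → M} {r : ℝ}
  (h : IsNormalChart x L F r)
include h

theorem contMDiffAt {v : E} (hv : v ∈ Metric.ball (0 : E) r) : ContMDiffAt 𝓘(ℝ, E) (𝓡 n) ∞ F v :=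
  h.contMDiffOn.contMDiffAt (Metric.isOpen_ball.mem_nhds hv)

theorem smul_mem {v : E} (hv : v ∈ Metric.ball (0 : E) r) {t : ℝ} (ht : t ∈ Icc (0 : ℝ) 1) :
    t • v ∈ Metric.ball (0 : E) r := by
  rw [mem_ball_zero_iff] at *
  rw [norm_smul, Real.norm_of_nonneg ht.1]
  exact (mul_le_of_le_one_left (norm_nonneg _) ht.2).trans_lt hv

/-- The rays through the origin are geodesics in normal coordinates. -/
theorem exists_geodesic [T2Space M] {v : E} (hv : v ∈ Metric.ball (0 : E) r) :
    ∃ γ : ℝ → M, (∀ t ∈ Icc (0 : ℝ) 1, IsGeodesicAt n γ t) ∧ γ 0 = x ∧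
      deriv (extChartAt (𝓡 n) x ∘ γ) 0 = (L v : E) ∧ ∀ t ∈ Icc (0 : ℝ) 1, γ t = F (t • v) := by
  obtain ⟨γ, h1, h2, h3, -⟩ := (h.isExp v hv).exists_geodesic
  refine ⟨γ, h1, h2, h3, fun s hs => ?_⟩
  obtain ⟨δ, k1, k2, k3, k4⟩ := (h.isExp _ (h.smul_mem hv hs)).exists_geodesic
  -- `F(s v)` is only known as the end point of a geodesic `δ` with initial velocity `s v`; by
  -- uniqueness this is the initial piece of `γ` run at speed `s`.
  have key : EqOn δ (fun τ => γ (s * τ)) (Icc 0 1) := by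
    refine eqOn_of_isGeodesicAt k1 (fun t ht => (h1 (s * t)
      ⟨mul_nonneg hs.1 ht.1, mul_le_one₀ hs.2 ht.1 ht.2⟩).comp_mul) (by simp [k2, h2]) ?_
    rw [k2, k3]
    have h4 := deriv_comp_mul_left s (extChartAt (𝓡 n) x ∘ γ) 0
    rw [mul_zero, h3] at h4
    exact (L.map_smul s v).trans h4.symm
  have := key ⟨zero_le_one, le_rfl⟩
  simp only [mul_one] at this
  rw [← this, k4]

theorem map_zero [T2Space M] (hr : 0 < r) : F 0 = x := by
  obtain ⟨γ, -, h2, -, h4⟩ := h.exists_geodesic (Metric.mem_ball_self hr)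
  rw [← h2, h4 0 ⟨le_rfl, zero_le_one⟩, smul_zero]

theorem contDiffAt {v : E} (hv : v ∈ Metric.ball (0 : E) r) {p : M}
    (hp : F v ∈ (extChartAt (𝓡 n) p).source) : ContDiffAt ℝ ∞ (extChartAt (𝓡 n) p ∘ F) v :=
  contDiffAt_extChartAt_comp (h.contMDiffAt hv) hp

theorem hasFDerivAt {v : E} (hv : v ∈ Metric.ball (0 : E) r) {p : M}
    (hp : F v ∈ (extChartAt (𝓡 n) p).source) : HasFDerivAt (extChartAt (𝓡 n) p ∘ F)
      (fderiv ℝ (extChartAt (𝓡 n) p ∘ F) v) v :=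
  ((h.contDiffAt hv hp).differentiableAt (by simp)).hasFDerivAt

theorem fderiv_zero [T2Space M] (hr : 0 < r) (v : E) :
    fderiv ℝ (extChartAt (𝓡 n) x ∘ F) 0 v = (L v : E) := by
  have key : ∀ v ∈ Metric.ball (0 : E) r, fderiv ℝ (extChartAt (𝓡 n) x ∘ F) 0 v = (L v : E) := by
    intro v hv
    obtain ⟨γ, h1, h2, h3, h4⟩ := h.exists_geodesic hv
    have hx : F 0 ∈ (extChartAt (𝓡 n) x).source := by
      rw [h.map_zero hr]; exact mem_extChartAt_source x
    have hd := h.hasFDerivAt (Metric.mem_ball_self hr) hx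
    have e1 : HasDerivAt (fun t : ℝ => (extChartAt (𝓡 n) x ∘ F) (t • v))
        (fderiv ℝ (extChartAt (𝓡 n) x ∘ F) 0 v) 0 := by
      have hs : HasDerivAt (fun t : ℝ => t • v) v 0 := by
        simpa using (hasDerivAt_id (0 : ℝ)).smul_const v
      have hd' : HasFDerivAt (extChartAt (𝓡 n) x ∘ F) (fderiv ℝ (extChartAt (𝓡 n) x ∘ F) 0)
          ((0 : ℝ) • v) := by rwa [zero_smul]
      exact hd'.comp_hasDerivAt 0 hs
    have e2 : HasDerivAt (extChartAt (𝓡 n) x ∘ γ) (L v : E) 0 := by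
      rw [← h3]
      refine ((contDiffAt_extChartAt_comp (h1 0 ⟨le_rfl, zero_le_one⟩).1 ?_).differentiableAt
        (by simp)).hasDerivAt
      rw [h2]; exact mem_extChartAt_source x
    have hu : UniqueDiffWithinAt ℝ (Icc (0 : ℝ) 1) 0 :=
      uniqueDiffOn_Icc zero_lt_one 0 ⟨le_rfl, zero_le_one⟩
    exact hu.eq_deriv _ e1.hasDerivWithinAt (e2.hasDerivWithinAt.congr
      (fun s hs => congrArg _ (h4 s hs).symm) (congrArg _ (h4 0 ⟨le_rfl, zero_le_one⟩).symm))
  have hlim : Tendsto (fun t : ℝ => t • v) (𝓝 0) (𝓝 0) := by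
    have : Continuous fun t : ℝ => t • v := by fun_prop
    simpa using this.tendsto 0
  obtain ⟨t, ht, ht0⟩ := ((hlim.eventually (Metric.ball_mem_nhds 0 hr)).filter_mono
    nhdsWithin_le_nhds |>.and (self_mem_nhdsWithin (s := Ioi (0 : ℝ)))).exists
  have h5 := key _ ht
  rw [_root_.map_smul] at h5
  have h6 : (L (t • v) : E) = t • (L v : E) := L.map_smul t v
  rw [h6] at h5
  exact smul_right_injective E (ne_of_gt ht0) h5

/-- The geodesic equation for the rays, in an arbitrary chart. -/
theorem geodesic_equation [T2Space M] {y : E} (hy : y ∈ Metric.ball (0 : E) r) {p : M}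
    (hp : F y ∈ (extChartAt (𝓡 n) p).source) :
    fderiv ℝ (fderiv ℝ (extChartAt (𝓡 n) p ∘ F)) y y y
      + chartChristoffel p ((extChartAt (𝓡 n) p ∘ F) y) (fderiv ℝ (extChartAt (𝓡 n) p ∘ F) y y)
        (fderiv ℝ (extChartAt (𝓡 n) p ∘ F) y y) = 0 := by
  set Ψ := extChartAt (𝓡 n) p ∘ F with hΨ
  -- The ray is prolonged beyond `y`, so that `y` is reached at the interior time `c⁻¹` of `[0, 1]`,
  -- where two-sided derivatives are available.
  obtain ⟨c, hc1, hc⟩ : ∃ c : ℝ, 1 < c ∧ c • y ∈ Metric.ball (0 : E) r := by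
    have hlim : Tendsto (fun t : ℝ => t • y) (𝓝 1) (𝓝 y) := by
      have : Continuous fun t : ℝ => t • y := by fun_prop
      simpa using this.tendsto 1
    obtain ⟨t, ht, ht0⟩ := ((hlim.eventually (Metric.isOpen_ball.mem_nhds hy)).filter_mono
      nhdsWithin_le_nhds |>.and (self_mem_nhdsWithin (s := Ioi (1 : ℝ)))).exists
    exact ⟨t, ht0, ht⟩
  have hc0 : 0 < c := zero_lt_one.trans hc1
  obtain ⟨γ, h1, -, -, h4⟩ := h.exists_geodesic hc
  have ht : c⁻¹ ∈ Ioo (0 : ℝ) 1 := ⟨inv_pos.2 hc0, inv_lt_one_of_one_lt₀ hc1⟩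
  have hyc : c⁻¹ • c • y = y := inv_smul_smul₀ hc0.ne' y
  have hγp : γ c⁻¹ ∈ (extChartAt (𝓡 n) p).source := by
    rw [h4 _ (Ioo_subset_Icc_self ht), hyc]; exact hp
  have hgeo := (h1 _ (Ioo_subset_Icc_self ht)).deriv_deriv_add_eq_zero hγp
  have hev : extChartAt (𝓡 n) p ∘ γ =ᶠ[𝓝 c⁻¹] Ψ ∘ fun t : ℝ => t • c • y := by
    filter_upwards [isOpen_Ioo.mem_nhds ht] with s hs
    exact congrArg (extChartAt (𝓡 n) p) (h4 s (Ioo_subset_Icc_self hs))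
  have hs : ∀ t : ℝ, HasDerivAt (fun t : ℝ => t • c • y) (c • y) t := fun t => by
    simpa using (hasDerivAt_id t).smul_const (c • y)
  have hs' : deriv (fun t : ℝ => t • c • y) = fun _ => c • y := funext fun t => (hs t).deriv
  have hΨd : ContDiffAt ℝ ∞ Ψ (c⁻¹ • c • y) := by rw [hyc]; exact h.contDiffAt hy hp
  have hsd : ContDiffAt ℝ 2 (fun t : ℝ => t • c • y) c⁻¹ := by fun_prop
  rw [hev.deriv_eq, hev.deriv.deriv_eq, hev.eq_of_nhds,
    deriv_comp_eq (hΨd.differentiableAt (by simp)) (hs _).differentiableAt,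
    deriv_deriv_comp_eq (hΨd.of_le two_le_infty) hsd, hs', Function.comp_apply, hyc] at hgeo
  simp only [deriv_const', _root_.map_zero, zero_add, _root_.map_smul,
    smul_apply] at hgeo
  rw [← smul_add, ← smul_add] at hgeo
  exact (smul_eq_zero.1 ((smul_eq_zero.1 hgeo).resolve_left hc0.ne')).resolve_left hc0.ne'

end IsNormalChart

end NormalCoordinates

/-! ### The metric in normal coordinates -/

section NormalMetric

set_option maxSynthPendingDepth 4

variable {n : ℕ} {M : Type*} [TopologicalSpace M]
  [ChartedSpace (EuclideanSpace ℝ (Fin n)) M] [IsManifold (𝓡 n) ∞ M]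
  [RiemannianBundle (fun x : M => TangentSpace (𝓡 n) x)]
  [IsContMDiffRiemannianBundle (𝓡 n) ∞ (EuclideanSpace ℝ (Fin n))
      (fun x : M => TangentSpace (𝓡 n) x)]

local notation "E" => EuclideanSpace ℝ (Fin n)

theorem hasDerivAt_clm_apply_const {V W : Type*} [NormedAddCommGroup V] [NormedSpace ℝ V]
    [NormedAddCommGroup W] [NormedSpace ℝ W] {A : ℝ → V →L[ℝ] W} {A' : V →L[ℝ] W} {t : ℝ}
    (h : HasDerivAt A A' t) (v : V) : HasDerivAt (fun s => A s v) (A' v) t := by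
  simpa using h.clm_apply (hasDerivAt_const t v)

/-- A geodesic has constant speed, by compatibility of the connection with the metric. -/
theorem IsLeviCivitaOn.hasDerivAt_radial {V : Type*} [NormedAddCommGroup V] [NormedSpace ℝ V]
    {g : V → V →L[ℝ] V →L[ℝ] ℝ} {Γ : V → V →L[ℝ] V →L[ℝ] V} {U : Set V}
    (h : IsLeviCivitaOn g Γ U) {Ψ : V → V} {v : V} {t : ℝ} (ht : t ≠ 0)
    (hΨ : ContDiffAt ℝ ∞ Ψ (t • v)) (hU : Ψ (t • v) ∈ U)
    (hgeo : fderiv ℝ (fderiv ℝ Ψ) (t • v) (t • v) (t • v)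
      + Γ (Ψ (t • v)) (fderiv ℝ Ψ (t • v) (t • v)) (fderiv ℝ Ψ (t • v) (t • v)) = 0) :
    HasDerivAt (fun s : ℝ => g (Ψ (s • v)) (fderiv ℝ Ψ (s • v) v) (fderiv ℝ Ψ (s • v) v)) 0 t := by
  have hs : HasDerivAt (fun s : ℝ => s • v) v t := by
    simpa using (hasDerivAt_id' t).smul_const v
  have hc : HasDerivAt (fun s : ℝ => Ψ (s • v)) (fderiv ℝ Ψ (t • v) v) t :=
    HasFDerivAt.comp_hasDerivAt (l := Ψ) t (hΨ.differentiableAt (by simp)).hasFDerivAt hs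
  have h1 : HasFDerivAt (fderiv ℝ Ψ) (fderiv ℝ (fderiv ℝ Ψ) (t • v)) (t • v) :=
    ((hΨ.fderiv_right (m := ∞) (by simp)).differentiableAt (by simp)).hasFDerivAt
  have hX₀ : HasDerivAt (fun s : ℝ => fderiv ℝ Ψ (s • v)) (fderiv ℝ (fderiv ℝ Ψ) (t • v) v) t :=
    HasFDerivAt.comp_hasDerivAt (l := fderiv ℝ Ψ) t h1 hs
  have hX : HasDerivAt (fun s : ℝ => fderiv ℝ Ψ (s • v) v)
      (fderiv ℝ (fderiv ℝ Ψ) (t • v) v v) t := hasDerivAt_clm_apply_const hX₀ v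
  have hm := h.hasDerivAt_metric hU hc hX hX
  simp only [map_smul, smul_apply] at hgeo
  rw [← smul_add, ← smul_add] at hgeo
  have hgeo' := (smul_eq_zero.1 ((smul_eq_zero.1 hgeo).resolve_left ht)).resolve_left ht
  refine hm.congr_deriv ?_
  rw [hgeo', map_zero, map_zero, zero_apply, add_zero]

/-- The pull-back of the metric under `F`. -/
def pullbackMetric (F : E → M) (y a b : E) : ℝ :=
  ⟪(mfderiv 𝓘(ℝ, E) (𝓡 n) F y a : TangentSpace (𝓡 n) (F y)), mfderiv 𝓘(ℝ, E) (𝓡 n) F y b⟫_ℝ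

namespace IsNormalChart

variable {x : M} {L : EuclideanSpace ℝ (Fin n) ≃ₗᵢ[ℝ] TangentSpace (𝓡 n) x}
  {F : EuclideanSpace ℝ (Fin n) → M} {r : ℝ} (h : IsNormalChart x L F r)
include h

theorem pullbackMetric_eq {y : E} (hy : y ∈ Metric.ball (0 : E) r) {p : M}
    (hp : F y ∈ (extChartAt (𝓡 n) p).source) (a b : E) :
    pullbackMetric F y a b = chartMetric p ((extChartAt (𝓡 n) p ∘ F) y)
      (fderiv ℝ (extChartAt (𝓡 n) p ∘ F) y a) (fderiv ℝ (extChartAt (𝓡 n) p ∘ F) y b) :=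
  inner_mfderiv_eq_chartMetric (h.contMDiffAt hy) hp a b

theorem eventually_mem {y : E} (hy : y ∈ Metric.ball (0 : E) r) {p : M}
    (hp : F y ∈ (extChartAt (𝓡 n) p).source) :
    ∀ᶠ z in 𝓝 y, z ∈ Metric.ball (0 : E) r ∧ F z ∈ (extChartAt (𝓡 n) p).source :=
  (Metric.isOpen_ball.eventually_mem hy).and
    (eventually_mem_source (h.contMDiffAt hy) hp)

theorem continuousOn_pullbackMetric (a b : E) :
    ContinuousOn (fun y => pullbackMetric F y a b) (Metric.ball 0 r) := by
  intro y hy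
  refine ContinuousAt.continuousWithinAt ?_
  set p := F y with hpy
  have hp : F y ∈ (extChartAt (𝓡 n) p).source := mem_extChartAt_source p
  have hd := h.contDiffAt hy hp
  have hg : ContinuousAt (chartMetric (n := n) p) ((extChartAt (𝓡 n) p ∘ F) y) :=
    ((contDiffOn_chartMetric p).continuousOn.continuousAt
      ((isOpen_extChartAt_target p).mem_nhds ((extChartAt (𝓡 n) p).map_source hp)))
  have hc : ContinuousAt (fun z => chartMetric p ((extChartAt (𝓡 n) p ∘ F) z)
      (fderiv ℝ (extChartAt (𝓡 n) p ∘ F) z a) (fderiv ℝ (extChartAt (𝓡 n) p ∘ F) z b)) y := by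
    have h1 : ContinuousAt (fun z => chartMetric p ((extChartAt (𝓡 n) p ∘ F) z)) y :=
      hg.comp hd.continuousAt
    have h2 : ContinuousAt (fderiv ℝ (extChartAt (𝓡 n) p ∘ F)) y :=
      (hd.fderiv_right (m := ∞) (by simp)).continuousAt
    exact (h1.clm_apply (h2.clm_apply continuousAt_const)).clm_apply
      (h2.clm_apply continuousAt_const)
  refine hc.congr ?_
  filter_upwards [h.eventually_mem hy hp] with z hz
  exact (h.pullbackMetric_eq hz.1 hz.2 a b).symm

theorem pullbackMetric_zero [T2Space M] (hr : 0 < r) (a b : E) :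
    pullbackMetric F 0 a b = ⟪a, b⟫_ℝ := by
  have h0 : F 0 = x := h.map_zero hr
  have hx : F 0 ∈ (extChartAt (𝓡 n) x).source := by rw [h0]; exact mem_extChartAt_source x
  have key : ∀ a, (mfderiv 𝓘(ℝ, E) (𝓡 n) F 0 a : E) = (L a : E) := by
    intro a
    have h1 := mfderiv_comp (I := 𝓘(ℝ, E)) (I' := 𝓡 n) (I'' := 𝓘(ℝ, E)) (0 : E)
      (mdifferentiableAt_extChartAt (by rwa [extChartAt_source] at hx))
      ((h.contMDiffAt (Metric.mem_ball_self hr)).mdifferentiableAt (by simp))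
    have h2 := congrArg (fun A : E →L[ℝ] E => A a) h1
    rw [mfderiv_eq_fderiv] at h2
    have h3 : (L a : E) = (mfderiv (𝓡 n) 𝓘(ℝ, E) (extChartAt (𝓡 n) x) (F 0)
        (mfderiv 𝓘(ℝ, E) (𝓡 n) F 0 a) : E) := (h.fderiv_zero hr a).symm.trans h2
    rw [h3]
    have h4 : ∀ (z : M) (w : E), z = x →
        (mfderiv (𝓡 n) 𝓘(ℝ, E) (extChartAt (𝓡 n) x) z w : E) = w := by
      rintro z w rfl
      rw [mfderiv_extChartAt_self]
      rfl
    exact (h4 _ _ h0).symm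
  have h5 := inner_congr_base (n := n) h0 (mfderiv 𝓘(ℝ, E) (𝓡 n) F 0 a : E)
    (mfderiv 𝓘(ℝ, E) (𝓡 n) F 0 b : E)
  rw [pullbackMetric]
  refine h5.trans ?_
  rw [key a, key b]
  exact L.inner_map_map a b

theorem pullbackMetric_smul {y : E} (hy : y ∈ Metric.ball (0 : E) r) (c d : ℝ) (a b : E) :
    pullbackMetric F y (c • a) (d • b) = c * d * pullbackMetric F y a b := by
  rw [h.pullbackMetric_eq hy (mem_extChartAt_source _),
    h.pullbackMetric_eq hy (mem_extChartAt_source _)]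
  simp only [map_smul, smul_apply, smul_eq_mul]
  ring

theorem pullbackMetric_self_pos {y : E} (hy : y ∈ Metric.ball (0 : E) r) {a : E} (ha : a ≠ 0) :
    0 < pullbackMetric F y a a := by
  rw [pullbackMetric, real_inner_self_pos]
  intro h0
  exact ha (h.injective_mfderiv y hy (h0.trans (_root_.map_zero _).symm))

/-- The Gauss lemma, for radial vectors. -/
theorem pullbackMetric_self [T2Space M] {v : E} (hv : v ∈ Metric.ball (0 : E) r) :
    pullbackMetric F v v v = ‖v‖ ^ 2 := by
  have hr : 0 < r := (norm_nonneg v).trans_lt (mem_ball_zero_iff.1 hv)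
  have hcont : ContinuousOn (fun t : ℝ => pullbackMetric F (t • v) v v) (Icc 0 1) :=
    (h.continuousOn_pullbackMetric v v).comp (by fun_prop) fun t ht => h.smul_mem hv ht
  have hder : ∀ t ∈ Ioo (0 : ℝ) 1, HasDerivAt (fun t : ℝ => pullbackMetric F (t • v) v v) 0 t := by
    intro t ht
    have hy := h.smul_mem hv (Ioo_subset_Icc_self ht)
    set p := F (t • v) with hpy
    have hp : F (t • v) ∈ (extChartAt (𝓡 n) p).source := mem_extChartAt_source p
    set Ψ := extChartAt (𝓡 n) p ∘ F with hΨ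
    have hd := h.contDiffAt hy hp
    have hs : ContinuousAt (fun s : ℝ => s • v) t := by fun_prop
    have hm := (isLeviCivitaOn_chart p).hasDerivAt_radial ht.1.ne' hd
      ((extChartAt (𝓡 n) p).map_source hp) (h.geodesic_equation hy hp)
    refine hm.congr_of_eventuallyEq ?_
    filter_upwards [hs.eventually (h.eventually_mem hy hp)] with s hs
    exact h.pullbackMetric_eq hs.1 hs.2 v v
  -- The squared speed is constant along the ray, and at the origin the pulled-back metric is the
  -- Euclidean one.
  obtain ⟨t, ht, hslope⟩ := exists_deriv_eq_slope _ zero_lt_one hcont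
    fun t ht => (hder t ht).differentiableAt.differentiableWithinAt
  rw [(hder t ht).deriv] at hslope
  simp only [one_smul, zero_smul, sub_zero, div_one] at hslope
  rw [eq_of_sub_eq_zero hslope.symm, h.pullbackMetric_zero hr, real_inner_self_eq_norm_sq]

/-- A lower bound for the metric in normal coordinates (from the Jacobi equation and a bound for
the curvature). -/
theorem le_pullbackMetric [T2Space M] {C : ℝ}
    (hC : ∀ z : M, tensorNormSq n z (curvDeriv n z 0) (extChartAt (𝓡 n) z z) ≤ C) {v : E}
    (hv : v ∈ Metric.ball (0 : E) r) (hvC : √C * ‖v‖ ^ 2 ≤ 1 / 2) (w : E) :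
    ‖w‖ ^ 2 / 4 ≤ pullbackMetric F v w w := by
  -- The comparison below requires `f > 0`, which excludes `w = 0`.
  rcases eq_or_ne w 0 with rfl | hw
  · have h0 := h.pullbackMetric_smul hv 0 0 0 0
    simp only [smul_zero, mul_zero, zero_mul] at h0
    simp [h0]
  have hr : 0 < r := (norm_nonneg v).trans_lt (mem_ball_zero_iff.1 hv)
  set f : ℝ → ℝ := fun t => pullbackMetric F (t • v) (t • w) (t • w) with hf
  have hIoc : ∀ t ∈ Ioc (0 : ℝ) 1, t • v ∈ Metric.ball (0 : E) r :=
    fun t ht => h.smul_mem hv (Ioc_subset_Icc_self ht)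
  have hjac : ∀ t ∈ Ioc (0 : ℝ) 1, DifferentiableAt ℝ f t ∧ DifferentiableAt ℝ (deriv f) t ∧
      -(4 * (√C * ‖v‖ ^ 2) * f t ^ 2) ≤ 2 * f t * deriv (deriv f) t - deriv f t ^ 2 := by
    intro t ht
    have hy := hIoc t ht
    -- The curvature bound is given only at the centre of each chart, so the chart is recentred at
    -- the current point of the ray for every `t`; `f` is intrinsic and does not notice the change.
    set p := F (t • v) with hpy
    have hp : F (t • v) ∈ (extChartAt (𝓡 n) p).source := mem_extChartAt_source p
    have hs : ContinuousAt (fun s : ℝ => s • v) t := by fun_prop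
    have hfe : ∀ᶠ s in 𝓝 t, f s = chartMetric p ((extChartAt (𝓡 n) p ∘ F) (s • v))
        (fderiv ℝ (extChartAt (𝓡 n) p ∘ F) (s • v) (s • w))
        (fderiv ℝ (extChartAt (𝓡 n) p ∘ F) (s • v) (s • w)) := by
      filter_upwards [hs.eventually (h.eventually_mem hy hp)] with s hs
      exact h.pullbackMetric_eq hs.1 hs.2 _ _
    have hyt : (extChartAt (𝓡 n) p ∘ F) (t • v) ∈ (extChartAt (𝓡 n) p).target :=
      (extChartAt (𝓡 n) p).map_source hp
    obtain ⟨j1, j2, j3⟩ := (isLeviCivitaOn_chart p).jacobi_inequality ht.1 (h.contDiffAt hy hp)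
      hyt ((h.eventually_mem hy hp).mono fun z hz => h.geodesic_equation hz.1 hz.2) hfe
    refine ⟨j1.self_of_nhds, j2, le_trans ?_ j3⟩
    have hcurv := curvature_sq_le p hyt (fderiv ℝ (extChartAt (𝓡 n) p ∘ F) (t • v) v)
      (fderiv ℝ (extChartAt (𝓡 n) p ∘ F) (t • v) (t • w))
    have hvv : chartMetric p ((extChartAt (𝓡 n) p ∘ F) (t • v))
        (fderiv ℝ (extChartAt (𝓡 n) p ∘ F) (t • v) v)
        (fderiv ℝ (extChartAt (𝓡 n) p ∘ F) (t • v) v) = ‖v‖ ^ 2 := by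
      rw [← h.pullbackMetric_eq hy hp]
      have h1 := h.pullbackMetric_self hy
      rw [h.pullbackMetric_smul hy, norm_smul, mul_pow, Real.norm_of_nonneg ht.1.le, ← sq] at h1
      exact mul_left_cancel₀ (pow_ne_zero 2 ht.1.ne') h1
    rw [hvv, ← hfe.self_of_nhds] at hcurv
    have hf0 : 0 ≤ f t := (h.pullbackMetric_self_pos hy (smul_ne_zero ht.1.ne' hw)).le
    have hCp : tensorNormSq n p (curvDeriv n p 0) ((extChartAt (𝓡 n) p ∘ F) (t • v)) ≤ C := hC p
    generalize (chartMetric p ((extChartAt (𝓡 n) p ∘ F) (t • v))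
      (curvatureForm (chartChristoffel p) ((extChartAt (𝓡 n) p ∘ F) (t • v))
        (fderiv ℝ (extChartAt (𝓡 n) p ∘ F) (t • v) v)
        (fderiv ℝ (extChartAt (𝓡 n) p ∘ F) (t • v) (t • w))
        (fderiv ℝ (extChartAt (𝓡 n) p ∘ F) (t • v) v)))
        (fderiv ℝ (extChartAt (𝓡 n) p ∘ F) (t • v) (t • w)) = X at hcurv ⊢
    -- The radial vector has norm `‖v‖`, so the curvature term is at most `√C ‖v‖² f`; the constant
    -- `K = √C ‖v‖²` of the comparison is at most `1/2` by hypothesis.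
    have hX : |X| ≤ √C * (‖v‖ ^ 2 * f t) := by
      have h2 := Real.sqrt_le_sqrt (hcurv.trans (mul_le_mul_of_nonneg_right hCp (sq_nonneg _)))
      rwa [Real.sqrt_sq_eq_abs, Real.sqrt_mul' _ (sq_nonneg _), Real.sqrt_sq
        (mul_nonneg (sq_nonneg _) hf0)] at h2
    have h3 := neg_le_of_abs_le hX
    nlinarith [mul_le_mul_of_nonneg_left h3 hf0]
  have key := sq_div_four_le_of_jacobi hvC (norm_nonneg w) (fun t ht => (hjac t ht).1)
    (fun t ht => (hjac t ht).2.1)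
    (fun t ht => h.pullbackMetric_self_pos (hIoc t ht) (smul_ne_zero ht.1.ne' hw))
    (fun t ht => (hjac t ht).2.2) ?_
  · simpa [hf] using key
  · have h1 : ContinuousAt (fun y => pullbackMetric F y w w) ((0 : ℝ) • v) := by
      rw [zero_smul]
      exact (h.continuousOn_pullbackMetric w w).continuousAt (Metric.ball_mem_nhds 0 hr)
    have h2 : Tendsto (fun t : ℝ => pullbackMetric F (t • v) w w) (𝓝[>] 0) (𝓝 (‖w‖ ^ 2)) := by
      have h3 : ContinuousAt (fun t : ℝ => pullbackMetric F (t • v) w w) 0 :=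
        ContinuousAt.comp (f := fun t : ℝ => t • v) h1 (by fun_prop)
      have h4 := h3.tendsto
      rw [zero_smul, h.pullbackMetric_zero hr, real_inner_self_eq_norm_sq] at h4
      exact h4.mono_left nhdsWithin_le_nhds
    refine h2.congr' ?_
    filter_upwards [Ioc_mem_nhdsGT (zero_lt_one (α := ℝ))] with t ht
    rw [hf]
    simp only
    rw [h.pullbackMetric_smul (hIoc t ht), ← sq, mul_div_cancel_left₀ _ (pow_ne_zero 2 ht.1.ne')]

end IsNormalChart

end NormalMetric

/-! ### The volume of a manifold of bounded geometry -/

section Volume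

set_option maxSynthPendingDepth 4

/-- Every eigenvalue is at least `c`, as the quadratic form shows on a unit eigenvector. -/
theorem _root_.Matrix.IsHermitian.pow_card_le_det {ι : Type*} [Fintype ι] [DecidableEq ι]
    {A : Matrix ι ι ℝ} (hA : A.IsHermitian) {c : ℝ} (hc : 0 ≤ c)
    (h : ∀ v : EuclideanSpace ℝ ι, c * ‖v‖ ^ 2 ≤ v.ofLp ⬝ᵥ A.mulVec v.ofLp) :
    c ^ Fintype.card ι ≤ A.det := by
  rw [hA.det_eq_prod_eigenvalues, ← Finset.card_univ, ← Finset.prod_const]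
  refine Finset.prod_le_prod (fun _ _ => hc) fun i _ => ?_
  have h1 := h (hA.eigenvectorBasis i)
  rw [OrthonormalBasis.norm_eq_one, one_pow, mul_one] at h1
  have h2 := hA.eigenvalues_eq i
  simp only [star_trivial, RCLike.re_to_real] at h2
  simpa [h2] using h1

variable {n : ℕ} {M : Type*}

local notation "E" => EuclideanSpace ℝ (Fin n)

section Density

variable [TopologicalSpace M] [ChartedSpace (EuclideanSpace ℝ (Fin n)) M] [IsManifold (𝓡 n) ∞ M]
  [RiemannianBundle (fun x : M => TangentSpace (𝓡 n) x)]
  [IsContMDiffRiemannianBundle (𝓡 n) ∞ (EuclideanSpace ℝ (Fin n))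
      (fun x : M => TangentSpace (𝓡 n) x)]

/-- The form `Aᵀ G A` is bounded below by `c²`, so its determinant `(det A)² det G` is at least
`c^{2n}`. -/
theorem pow_le_sqrt_det_gram (p : M) {y : E} (hy : y ∈ (extChartAt (𝓡 n) p).target)
    (A : E →L[ℝ] E) {c : ℝ} (hc : 0 ≤ c)
    (h : ∀ w, (c * ‖w‖) ^ 2 ≤ chartMetric p y (A w) (A w)) :
    c ^ n ≤ |A.det| * √(gram n p y).det := by
  set b := (EuclideanSpace.basisFun (Fin n) ℝ).toBasis with hb
  set P := LinearMap.toMatrix b b (A : E →ₗ[ℝ] E) with hP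
  have hPA : ∀ w : E, (A w).ofLp = P.mulVec w.ofLp := fun w => by
    have := LinearMap.toMatrix_mulVec_repr b b (A : E →ₗ[ℝ] E) w
    exact this.symm
  have hG := posDef_gram p hy
  have hH : (P.transpose * gram n p y * P).IsHermitian := by
    have := Matrix.isHermitian_conjTranspose_mul_mul P hG.isHermitian
    rwa [Matrix.conjTranspose_eq_transpose_of_trivial] at this
  have key := hH.pow_card_le_det (c := c ^ 2) (sq_nonneg c) fun v => by
    rw [← mul_pow]
    refine (h v).trans_eq ?_
    rw [chartMetric_eq_dotProduct, hPA, ← Matrix.mulVec_mulVec, ← Matrix.mulVec_mulVec,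
      Matrix.dotProduct_mulVec v.ofLp, Matrix.vecMul_transpose]
  rw [Fintype.card_fin, Matrix.det_mul, Matrix.det_mul, Matrix.det_transpose] at key
  have hdet : P.det = A.det := by rw [hP, LinearMap.det_toMatrix]
  rw [hdet] at key
  have h1 := Real.sqrt_le_sqrt key
  rw [← pow_mul, mul_comm 2 n, pow_mul, Real.sqrt_sq (pow_nonneg hc n)] at h1
  refine h1.trans_eq ?_
  rw [show A.det * (gram n p y).det * A.det = A.det ^ 2 * (gram n p y).det by ring,
    Real.sqrt_mul (sq_nonneg _), Real.sqrt_sq_eq_abs]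

variable [MeasurableSpace M] [BorelSpace M]

theorem aemeasurable_extChartAt_symm (p : M) :
    AEMeasurable (extChartAt (𝓡 n) p).symm
      ((volume.restrict (extChartAt (𝓡 n) p).target).withDensity
        fun y => ENNReal.ofReal √(gram n p y).det) :=
  ((continuousOn_extChartAt_symm p).aemeasurable
    (isOpen_extChartAt_target p).measurableSet).mono_ac (withDensity_absolutelyContinuous _ _)

/-- The volume is the supremum of the chart measures, so each of them is a lower bound; agreement on
overlaps is not involved. -/
theorem lintegral_le_riemannianVolume (p : M) {B : Set E} (hB : MeasurableSet B)
    (hBt : B ⊆ (extChartAt (𝓡 n) p).target) :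
    ∫⁻ y in B, ENNReal.ofReal √(gram n p y).det
      ≤ riemannianVolume n M ((extChartAt (𝓡 n) p).symm '' B) := by
  calc ∫⁻ y in B, ENNReal.ofReal √(gram n p y).det
      = ((volume.restrict (extChartAt (𝓡 n) p).target).withDensity
        fun y => ENNReal.ofReal √(gram n p y).det) B := by
        rw [withDensity_apply _ hB, Measure.restrict_restrict hB, inter_eq_left.2 hBt]
    _ ≤ ((volume.restrict (extChartAt (𝓡 n) p).target).withDensity
        fun y => ENNReal.ofReal √(gram n p y).det)
          ((extChartAt (𝓡 n) p).symm ⁻¹' ((extChartAt (𝓡 n) p).symm '' B)) :=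
        measure_mono (subset_preimage_image _ _)
    _ ≤ chartVolume n p ((extChartAt (𝓡 n) p).symm '' B) :=
        Measure.le_map_apply (aemeasurable_extChartAt_symm p) _
    _ ≤ riemannianVolume n M ((extChartAt (𝓡 n) p).symm '' B) :=
        (le_iSup (chartVolume (M := M) n) p) _

namespace IsNormalChart

variable {x : M} {L : EuclideanSpace ℝ (Fin n) ≃ₗᵢ[ℝ] TangentSpace (𝓡 n) x}
  {F : EuclideanSpace ℝ (Fin n) → M} {r : ℝ} (h : IsNormalChart x L F r)
include h

/-- Change of variables along `F` read in the chart at `p`: the Jacobian times the Riemannian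
density is at least `c^n`, by `pow_le_sqrt_det_gram`. -/
theorem le_riemannianVolume_of_subset_source {c : ℝ} (hc : 0 ≤ c) {A : Set E}
    (hA : MeasurableSet A) (hAr : A ⊆ Metric.ball 0 r)
    (hAc : ∀ y ∈ A, ∀ w, (c * ‖w‖) ^ 2 ≤ pullbackMetric F y w w) {p : M}
    (hp : ∀ y ∈ A, F y ∈ (extChartAt (𝓡 n) p).source) :
    ENNReal.ofReal (c ^ n) * volume A ≤ riemannianVolume n M (F '' A) := by
  set Ψ := extChartAt (𝓡 n) p ∘ F with hΨ
  have hinj : InjOn Ψ A := fun y hy z hz hyz =>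
    h.injOn (hAr hy) (hAr hz) ((extChartAt (𝓡 n) p).injOn (hp y hy) (hp z hz) hyz)
  have hcont : ContinuousOn Ψ A := fun y hy =>
    (h.contDiffAt (hAr hy) (hp y hy)).continuousAt.continuousWithinAt
  have himg : (extChartAt (𝓡 n) p).symm '' (Ψ '' A) = F '' A := by
    rw [← image_comp]
    exact image_congr fun y hy => (extChartAt (𝓡 n) p).left_inv (hp y hy)
  have htgt : Ψ '' A ⊆ (extChartAt (𝓡 n) p).target := by
    rintro _ ⟨y, hy, rfl⟩
    exact (extChartAt (𝓡 n) p).map_source (hp y hy)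
  rw [← himg]
  refine le_trans ?_ (lintegral_le_riemannianVolume p (hA.image_of_continuousOn_injOn hcont hinj)
    htgt)
  rw [lintegral_image_eq_lintegral_abs_det_fderiv_mul volume hA
    (fun y hy => (h.hasFDerivAt (hAr hy) (hp y hy)).hasFDerivWithinAt) hinj,
    ← setLIntegral_const]
  refine setLIntegral_mono' hA fun y hy => ?_
  rw [← ENNReal.ofReal_mul (abs_nonneg _)]
  refine ENNReal.ofReal_le_ofReal (pow_le_sqrt_det_gram p (htgt (mem_image_of_mem _ hy)) _ hc
    fun w => ?_)
  rw [← h.pullbackMetric_eq (hAr hy) (hp y hy)]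
  exact hAc y hy w

/-- The image may leave a single chart domain, so `U` is cut into countably many disjoint pieces,
each mapped into one; injectivity of `F` keeps the images disjoint. -/
theorem le_riemannianVolume [T2Space M] [SecondCountableTopology M] {c : ℝ} (hc : 0 ≤ c)
    {U : Set E} (hU : IsOpen U) (hUr : U ⊆ Metric.ball 0 r)
    (hUc : ∀ y ∈ U, ∀ w, (c * ‖w‖) ^ 2 ≤ pullbackMetric F y w w) :
    ENNReal.ofReal (c ^ n) * volume U ≤ riemannianVolume n M (F '' U) := by
  obtain ⟨S, hS, hSu⟩ := TopologicalSpace.countable_cover_nhds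
    fun p : M => extChartAt_source_mem_nhds (I := 𝓡 n) p
  have hSne : S.Nonempty := by
    have hx : x ∈ ⋃ p ∈ S, (extChartAt (𝓡 n) p).source := hSu ▸ mem_univ x
    simp only [mem_iUnion] at hx
    obtain ⟨p, hp, -⟩ := hx
    exact ⟨p, hp⟩
  obtain ⟨q, rfl⟩ := hS.exists_eq_range hSne
  have hcont : ContinuousOn F U := h.contMDiffOn.continuousOn.mono hUr
  set V : ℕ → Set E := fun k => U ∩ F ⁻¹' (extChartAt (𝓡 n) (q k)).source with hV
  have hVm : ∀ k, MeasurableSet (V k) := fun k =>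
    (hcont.isOpen_inter_preimage hU (isOpen_extChartAt_source (q k))).measurableSet
  set A : ℕ → Set E := disjointed V with hAV
  have hAm : ∀ k, MeasurableSet (A k) := MeasurableSet.disjointed hVm
  have hAd : Pairwise (Function.onFun Disjoint A) := disjoint_disjointed V
  have hAsub : ∀ k, A k ⊆ V k := disjointed_subset V
  have hAU : ∀ k, A k ⊆ U := fun k => (hAsub k).trans inter_subset_left
  have hUA : U = ⋃ k, A k := by
    rw [hAV, iUnion_disjointed]
    refine Subset.antisymm (fun y hy => ?_) (iUnion_subset fun k => inter_subset_left)
    have hx : F y ∈ ⋃ p ∈ range q, (extChartAt (𝓡 n) p).source := hSu ▸ mem_univ _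
    simp only [mem_iUnion, mem_range, exists_prop, exists_exists_eq_and] at hx
    obtain ⟨k, hk⟩ := hx
    exact mem_iUnion.2 ⟨k, hy, hk⟩
  have hinj : InjOn F U := h.injOn.mono hUr
  have hFm : ∀ k, MeasurableSet (F '' A k) := fun k =>
    (hAm k).image_of_continuousOn_injOn (hcont.mono (hAU k)) (hinj.mono (hAU k))
  have hFd : Pairwise (Function.onFun Disjoint fun k => F '' A k) := by
    intro i j hij
    refine disjoint_left.2 ?_
    rintro _ ⟨y, hy, rfl⟩ ⟨z, hz, hzy⟩
    rw [hinj (hAU j hz) (hAU i hy) hzy] at hz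
    exact disjoint_left.1 (hAd hij) hy hz
  rw [hUA, image_iUnion, measure_iUnion hAd hAm, measure_iUnion hFd hFm, ← ENNReal.tsum_mul_left]
  exact ENNReal.tsum_le_tsum fun k => h.le_riemannianVolume_of_subset_source hc (hAm k)
    ((hAU k).trans hUr) (fun y hy => hUc y (hAU k hy)) fun y hy => (hAsub k hy).2

end IsNormalChart

end Density

/-- The ray from `x` to `F v` has constant speed `‖v‖`, hence length `‖v‖`. -/
theorem IsNormalChart.edist_le [PseudoEMetricSpace M] [T2Space M]
    [ChartedSpace (EuclideanSpace ℝ (Fin n)) M] [IsManifold (𝓡 n) ∞ M]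
    [RiemannianBundle (fun x : M => TangentSpace (𝓡 n) x)]
    [IsContMDiffRiemannianBundle (𝓡 n) ∞ (EuclideanSpace ℝ (Fin n))
      (fun x : M => TangentSpace (𝓡 n) x)] [IsRiemannianManifold (𝓡 n) M]
    {x : M} {L : EuclideanSpace ℝ (Fin n) ≃ₗᵢ[ℝ] TangentSpace (𝓡 n) x}
    {F : EuclideanSpace ℝ (Fin n) → M} {r : ℝ} (h : IsNormalChart x L F r) {v : E}
    (hv : v ∈ Metric.ball (0 : E) r) : edist x (F v) ≤ ‖v‖ₑ := by
  have hr : 0 < r := (norm_nonneg v).trans_lt (mem_ball_zero_iff.1 hv)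
  have hray : ∀ t ∈ Icc (0 : ℝ) 1, ContMDiffAt 𝓘(ℝ, ℝ) (𝓡 n) ∞ (fun s : ℝ => F (s • v)) t :=
    fun t ht => ContMDiffAt.comp (I' := 𝓘(ℝ, E)) (f := fun s : ℝ => s • v) t
      (h.contMDiffAt (h.smul_mem hv ht)) (contDiff_id.smul contDiff_const).contMDiff.contMDiffAt
  rw [IsRiemannianManifold.out (I := 𝓡 n) x (F v)]
  refine (riemannianEDist_le_pathELength (I := 𝓡 n) (γ := fun s : ℝ => F (s • v)) (a := 0) (b := 1)
    (fun t ht => ((hray t ht).of_le (by simp)).contMDiffWithinAt) (by simp [h.map_zero hr])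
    (by simp) zero_le_one).trans ?_
  rw [pathELength_eq_lintegral_mfderiv_Icc]
  have hspeed : ∀ t ∈ Icc (0 : ℝ) 1,
      ‖mfderiv 𝓘(ℝ, ℝ) (𝓡 n) (fun s : ℝ => F (s • v)) t (1 : ℝ)‖ₑ = ‖v‖ₑ := by
    intro t ht
    have hy := h.smul_mem hv ht
    have hs : HasFDerivAt (fun s : ℝ => s • v) (ContinuousLinearMap.toSpanSingleton ℝ v) t := by
      have : HasDerivAt (fun s : ℝ => s • v) v t := by simpa using (hasDerivAt_id' t).smul_const v
      exact this.hasFDerivAt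
    have h1 := mfderiv_comp (I := 𝓘(ℝ, ℝ)) (I' := 𝓘(ℝ, E)) (I'' := 𝓡 n) t (g := F)
      (f := fun s : ℝ => s • v) ((h.contMDiffAt hy).mdifferentiableAt (by simp))
      hs.differentiableAt.mdifferentiableAt
    have h2 := congrArg (fun B : ℝ →L[ℝ] E => B 1) h1
    have h3 : (mfderiv 𝓘(ℝ, ℝ) (𝓡 n) (fun s : ℝ => F (s • v)) t (1 : ℝ) : E)
        = mfderiv 𝓘(ℝ, E) (𝓡 n) F (t • v) v := by
      refine h2.trans ?_
      have h4 : mfderiv 𝓘(ℝ, ℝ) 𝓘(ℝ, E) (fun s : ℝ => s • v) t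
          = ContinuousLinearMap.toSpanSingleton ℝ v := by
        rw [mfderiv_eq_fderiv]; exact hs.fderiv
      rw [h4]
      change mfderiv 𝓘(ℝ, E) (𝓡 n) F (t • v) ((1 : ℝ) • v) = _
      rw [one_smul]
    have h5 : pullbackMetric F (t • v) v v = ‖v‖ ^ 2 := by
      rcases ht.1.eq_or_lt with h0 | h0
      · rw [← h0, zero_smul, h.pullbackMetric_zero hr, real_inner_self_eq_norm_sq]
      · have h6 := h.pullbackMetric_self hy
        rw [h.pullbackMetric_smul hy, norm_smul, mul_pow, Real.norm_of_nonneg ht.1, ← sq] at h6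
        exact mul_left_cancel₀ (pow_ne_zero 2 h0.ne') h6
    rw [pullbackMetric, ← h3, real_inner_self_eq_norm_sq] at h5
    have h7 := (sq_eq_sq₀ (norm_nonneg _) (norm_nonneg _)).1 h5
    rw [← ofReal_norm, ← ofReal_norm]
    exact congrArg ENNReal.ofReal h7
  refine le_of_eq ((setLIntegral_congr_fun measurableSet_Icc hspeed).trans ?_)
  simp

/-- An open manifold of bounded geometry has infinite volume. -/
theorem BoundedGeometry.riemannianVolume_univ [MetricSpace M]
    [ChartedSpace (EuclideanSpace ℝ (Fin n)) M] [IsManifold (𝓡 n) ∞ M]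
    [SecondCountableTopology M] [NoncompactSpace M] [CompleteSpace M]
    [RiemannianBundle (fun x : M => TangentSpace (𝓡 n) x)]
    [IsContMDiffRiemannianBundle (𝓡 n) ∞ (EuclideanSpace ℝ (Fin n))
      (fun x : M => TangentSpace (𝓡 n) x)] [IsRiemannianManifold (𝓡 n) M]
    [MeasurableSpace M] [BorelSpace M] (hM : BoundedGeometry n M) :
    riemannianVolume n M univ = ⊤ := by
  obtain ⟨r, hr, hchart⟩ := hM.exists_isNormalChart
  obtain ⟨C, hC⟩ := hM.curvature_bounded 0
  choose L F hLF using hchart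
  -- A complete totally bounded space is compact; without total boundedness, points at mutual
  -- distance at least `ε` can be chosen one after the other.
  have hntb : ¬ TotallyBounded (univ : Set M) := fun h =>
    noncompact_univ M (isCompact_iff_totallyBounded_isComplete.2 ⟨h, isComplete_univ⟩)
  rw [Metric.totallyBounded_iff] at hntb
  push Not at hntb
  obtain ⟨ε, hε, hcov⟩ := hntb
  obtain ⟨f, -, hf⟩ := exists_seq_of_forall_finset_exists (fun _ : M => True)
    (fun y z => ε ≤ dist z y) fun s _ => by
      obtain ⟨z, -, hz⟩ := not_subset.1 (hcov s s.finite_toSet)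
      simp only [mem_iUnion, not_exists, Metric.mem_ball, not_lt] at hz
      exact ⟨z, trivial, fun y hy => hz y hy⟩
  -- The radius lies within the normal charts, is at most half the separation, so that the images
  -- are disjoint, and is small enough for the comparison of Jacobi fields.
  obtain ⟨ρ, hρ, hρr, hρε, hρC⟩ : ∃ ρ : ℝ, 0 < ρ ∧ ρ ≤ r ∧ ρ ≤ ε / 2 ∧ √C * ρ ^ 2 ≤ 1 / 2 := by
    have hlim : Tendsto (fun ρ : ℝ => √C * ρ ^ 2) (𝓝[>] 0) (𝓝 0) := by
      have : Continuous fun ρ : ℝ => √C * ρ ^ 2 := by fun_prop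
      simpa using (this.tendsto 0).mono_left nhdsWithin_le_nhds
    have hev : ∀ᶠ ρ in 𝓝[>] (0 : ℝ), 0 < ρ ∧ ρ ≤ r ∧ ρ ≤ ε / 2 ∧ √C * ρ ^ 2 ≤ 1 / 2 := by
      filter_upwards [hlim.eventually_le_const (show (0 : ℝ) < 1 / 2 by norm_num),
        Ioc_mem_nhdsGT hr, Ioc_mem_nhdsGT (half_pos hε)] with ρ h1 h2 h3
      exact ⟨h2.1, h2.2, h3.2, h1⟩
    exact hev.exists
  set B : ℕ → Set M := fun k => F (f k) '' Metric.ball 0 ρ with hB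
  have hsub : Metric.ball (0 : E) ρ ⊆ Metric.ball 0 r := Metric.ball_subset_ball hρr
  have hBo : ∀ k, MeasurableSet (B k) := fun k =>
    ((hLF (f k)).isOpen_image _ hsub Metric.isOpen_ball).measurableSet
  have hBdist : ∀ k, ∀ y ∈ B k, dist (f k) y < ε / 2 := by
    rintro k _ ⟨v, hv, rfl⟩
    have h1 := (hLF (f k)).edist_le (hsub hv)
    rw [edist_dist, ← ofReal_norm, ENNReal.ofReal_le_ofReal_iff (norm_nonneg _)] at h1
    exact h1.trans_lt ((mem_ball_zero_iff.1 hv).trans_le hρε)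
  have hBd : Pairwise (Function.onFun Disjoint B) := by
    have key : ∀ i j, i < j → Disjoint (B i) (B j) := fun i j hij => disjoint_left.2 fun y h1 h2 => by
      have h3 := dist_triangle_right (f j) (f i) y
      linarith [hf i j hij, hBdist i y h1, hBdist j y h2]
    intro i j hij
    rcases hij.lt_or_gt with h | h
    · exact key i j h
    · exact (key j i h).symm
  -- The metric bound `‖w‖²/4` is `(c‖w‖)²` with `c = 1/2`, so the volume bound is the same for
  -- every `k`.
  have hvol : ∀ k, ENNReal.ofReal ((1 / 2) ^ n) * volume (Metric.ball (0 : E) ρ)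
      ≤ riemannianVolume n M (B k) := by
    refine fun k => (hLF (f k)).le_riemannianVolume (by norm_num) Metric.isOpen_ball hsub
      fun y hy w => ?_
    have h1 : √C * ‖y‖ ^ 2 ≤ 1 / 2 := le_trans (mul_le_mul_of_nonneg_left (pow_le_pow_left₀
      (norm_nonneg y) (mem_ball_zero_iff.1 hy).le 2) (Real.sqrt_nonneg C)) hρC
    refine le_trans (le_of_eq ?_) ((hLF (f k)).le_pullbackMetric hC (hsub hy) h1 w)
    ring
  have hpos : ENNReal.ofReal ((1 / 2) ^ n) * volume (Metric.ball (0 : E) ρ) ≠ 0 :=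
    mul_ne_zero (ENNReal.ofReal_pos.2 (by positivity)).ne' (Metric.measure_ball_pos volume _ hρ).ne'
  refine top_le_iff.1 ?_
  calc ⊤ = ∑' _ : ℕ, ENNReal.ofReal ((1 / 2) ^ n) * volume (Metric.ball (0 : E) ρ) :=
        (ENNReal.tsum_const_eq_top_of_ne_zero hpos).symm
    _ ≤ ∑' k, riemannianVolume n M (B k) := ENNReal.tsum_le_tsum hvol
    _ = riemannianVolume n M (⋃ k, B k) := (measure_iUnion hBd hBo).symm
    _ ≤ riemannianVolume n M univ := measure_mono (subset_univ _)

end Volume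

end OpenManifold

end

theorem theorem4p3 (n : ℕ) (M : Type*) [MetricSpace M] [ChartedSpace (EuclideanSpace ℝ (Fin n)) M]
    [IsManifold (𝓡 n) ∞ M] [SecondCountableTopology M] [SigmaCompactSpace M]
    [ConnectedSpace M] [NoncompactSpace M] [CompleteSpace M]
    [RiemannianBundle (fun x : M => TangentSpace (𝓡 n) x)]
    [IsContMDiffRiemannianBundle (𝓡 n) ∞ (EuclideanSpace ℝ (Fin n))
      (fun x : M => TangentSpace (𝓡 n) x)]
    [IsRiemannianManifold (𝓡 n) M] [MeasurableSpace M] [BorelSpace M]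
    (hM : BoundedGeometry n M) (𝒦 : RegularExhaustion (riemannianVolume n M))
    (Lim : GeneralizedLimit)
    (Fm : Type*) [NormedAddCommGroup Fm] [NormedSpace ℂ Fm] [FiniteDimensional ℂ Fm]
    (E : M → Type*) [∀ x, NormedAddCommGroup (E x)] [∀ x, InnerProductSpace ℂ (E x)]
    [TopologicalSpace (TotalSpace Fm E)] [FiberBundle Fm E] [VectorBundle ℂ Fm E]
    [IsHermitianBundle Fm E] :
    IsTrace (roeTrace Fm E 𝒦 Lim) ∧
      LowerSemicontinuousOn (roeTrace Fm E 𝒦 Lim) {T | 0 ≤ T} ∧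
      IsSemifinite (roeTrace Fm E 𝒦 Lim) ∧
      ∀ T : L2 Fm E (riemannianVolume n M) →L[ℂ] L2 Fm E (riemannianVolume n M),
        IsCompactOperator T → ∃ hT : T ∈ almostLocal Fm E (riemannianVolume n M),
          (0 ≤ T → roeTrace Fm E 𝒦 Lim ⟨T, hT⟩ = 0) ∧
          ∃ hJ : (⟨T, hT⟩ : almostLocal Fm E (riemannianVolume n M)) ∈
              finiteSpan (roeTrace Fm E 𝒦 Lim),
            ∀ t : finiteSpan (roeTrace Fm E 𝒦 Lim) →ₗ[ℂ] ℂ,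
              IsLinearExtension (roeTrace Fm E 𝒦 Lim) t → t ⟨⟨T, hT⟩, hJ⟩ = 0 := by
  exact OpenManifold.roeTrace_properties (OpenManifold.BoundedGeometry.riemannianVolume_univ hM) 𝒦 Lim
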